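/- Let $T$ be a finite tree with node set $V(T)$ and nonnegative real edge lengths $l\colon E(T)\to\mathbb{R}_+$, let $\emptyset\neq V\subseteq V(T)$ be a set of terminals, and let $K_V$ be the complete graph on $V$. Let the edge cost $a\colon E(K_V)\to\mathbb{R}_+$ be the tree metric represented by $(T,l)$, that is, $a(ij)$ is the $l$-length of the path between $i$ and $j$ in $T$ for all distinct $i,j\in V$. Let $r\colon V\times V\to\mathbb{Z}_+$ be a symmetric connectivity requirement. An integer realization of $r$ is a function $y\colon E(K_V)\to\mathbb{Z}_+$ such that $y(\delta(X))\ge r(s,t)$ for all distinct $s,t\in V$ and all $X\subseteq V$ with $s\in X\not\ni t$, where $\delta(X)$ is the set of edges between $X$ and its complement; its cost is $\sum_{e\in E(K_V)}a(e)y(e)$. For $X\subseteq V$ let $R(X)=\max\{r(i,j)\mid i\in X\not\ni j\}$, with $R(X)=0$ if $X\in\{\emptyset,V\}$. Fix any $v\in V$; for $e\in E(T)$ let $X_e\subseteq V$ be the set of terminals reachable from $v$ in $T$ without using $e$, and put $c^R(e)=R(X_e)$. An inner-odd join is a set $F\subseteq E(T)$ with $$\sum_{e\in\delta_T(w)}c^R(e)\equiv|\delta_T(w)\cap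 F| \pmod 2\qquad\text{for all } w\in V(T)\setminus V.$$ Theorem 2.4. Suppose that $R(X_e)>1$ for every $e\in E(T)$. Then the following hold. (1) A minimum-cost integer realization of $r$ can be found in polynomial time: there is a single algorithm that, given $T$, $V$, $r$ and $l$, outputs a minimum-cost integer realization of $r$ after a number of steps bounded by a polynomial in $|V(T)|$. (The steps are those of a random access program: addition, truncated subtraction, halving (rounded down) and comparison of natural numbers, addition, subtraction and comparison of real numbers, and memory access and assignment; so for rational $l$ this is also polynomial time on a Turing machine.) (2) An inner-odd join and a minimum-cost integer realization exist, and the minimum cost of an integer realization of $r$ is equal to $$\sum_{e\in E(T)}l(e)R(X_e)+\min_F\sum_{e\in F}l(e),$$ where $F$ ranges over all inner-odd joins. -/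

import Mathlib

universe u

/-! ### Graphs, cuts and network synthesis -/

/-- The edges of a graph on a finite node set, as a finite set. -/
noncomputable def edgesOf {W : Type u} [Finite W] (G : SimpleGraph W) : Finset (Sym2 W) :=
  G.edgeSet.toFinite.toFinset

/-- `δ_G(X)`: the edges of `G` that connect `X` with its complement. -/
noncomputable def cutEdges {W : Type u} [Finite W] (G : SimpleGraph W) (X : Set W) :
    Finset (Sym2 W) :=
  {e | e ∈ G.edgeSet ∧ ∃ x ∈ X, ∃ y ∉ X, e = s(x, y)}.toFinite.toFinset

/-- `y` is a realization of the requirement `r` on the node set `W`: a nonnegative capacity on the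
edges of the complete graph such that every cut separating `s` from `t` has capacity at least
`r s t`. Only the values of `y` on non-diagonal pairs matter. -/
def IsRealization {W : Type u} [Finite W] (r : W → W → ℕ) (y : Sym2 W → ℝ) : Prop :=
  (∀ e ∈ edgesOf (⊤ : SimpleGraph W), 0 ≤ y e) ∧
    ∀ s t : W, s ≠ t → ∀ X : Set W, s ∈ X → t ∉ X →
      (r s t : ℝ) ≤ ∑ e ∈ cutEdges (⊤ : SimpleGraph W) X, y e

/-- A realization with values in the nonnegative integers. -/
def IsIntegerRealization {W : Type u} [Finite W] (r : W → W → ℕ) (y : Sym2 W → ℕ) : Prop :=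
  IsRealization r (fun e => (y e : ℝ))

/-- The cost of an integer capacity on the edges of the complete graph. -/
noncomputable def capacityCost {W : Type u} [Finite W] (a : Sym2 W → ℝ) (y : Sym2 W → ℕ) : ℝ :=
  ∑ e ∈ edgesOf (⊤ : SimpleGraph W), a e * (y e : ℝ)

/-- A minimum-cost integer realization. -/
def IsMinCostIntegerRealization {W : Type u} [Finite W] (a : Sym2 W → ℝ) (r : W → W → ℕ)
    (y : Sym2 W → ℕ) : Prop :=
  IsIntegerRealization r y ∧
    ∀ z : Sym2 W → ℕ, IsIntegerRealization r z → capacityCost a y ≤ capacityCost a z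

/-- `R(X) = max {r i j | i ∈ X, j ∉ X}` (and `0` if there is no such pair). -/
noncomputable def maxReq {W : Type u} (r : W → W → ℕ) (X : Set W) : ℕ :=
  sSup {k | ∃ i ∈ X, ∃ j ∉ X, k = r i j}

/-- `X_e`: the terminals that are reachable from the terminal `v` in `T` without using `e`. -/
def sideOf {N : Type u} (T : SimpleGraph N) (V : Finset N) (v : V) (e : Sym2 N) : Set V :=
  {x | (T.deleteEdges {e}).Reachable (v : N) (x : N)}

/-- The edge cost `a` on the complete graph on `V` is represented by the tree `T` and the edge
length `l`: the cost of `ij` is the length of the path between `i` and `j` in `T`. -/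
def Represents {N : Type u} (T : SimpleGraph N) (V : Finset N) (l : Sym2 N → ℝ)
    (a : Sym2 V → ℝ) : Prop :=
  ∀ i j : V, i ≠ j → ∀ p : T.Walk (i : N) (j : N), p.IsPath → a s(i, j) = (p.edges.map l).sum

/-- A network synthesis problem whose edge cost is a tree metric, together with a tree and an edge
length that represent it. Edge functions are functions on unordered pairs, of which only the values
on edges matter. -/
structure TreeMetricInstance (N : Type u) where
  /-- the tree -/
  T : SimpleGraph N
  isTree : T.IsTree
  /-- the terminals, i.e. the nodes of the network to be designed -/
  V : Finset N
  nonempty : V.Nonempty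
  /-- the connectivity requirement -/
  r : V → V → ℕ
  symm : ∀ i j, r i j = r j i
  /-- the edge length on the tree -/
  l : Sym2 N → ℝ
  nonneg : ∀ e ∈ T.edgeSet, 0 ≤ l e
  /-- the edge cost on the complete graph on the terminals -/
  a : Sym2 V → ℝ
  represents : Represents T V l a

namespace TreeMetricInstance

variable {N : Type u} (I : TreeMetricInstance N)

/-- The capacity `c^R(e) = R(X_e)` on the edges of the tree. -/
noncomputable def cR (v : I.V) (e : Sym2 N) : ℕ :=
  maxReq I.r (sideOf I.T I.V v e)

open Classical in
/-- An inner-odd join: a set `F` of tree edges whose degree at every node outside `V` has the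
same parity as `c^R(δ_T(w))`. -/
def IsInnerOddJoin [Finite N] (v : I.V) (F : Finset (Sym2 N)) : Prop :=
  F ⊆ edgesOf I.T ∧
    ∀ w : N, w ∉ I.V →
      (∑ e ∈ cutEdges I.T {w}, I.cR v e) ≡ (cutEdges I.T {w} ∩ F).card [MOD 2]

end TreeMetricInstance

/-! ### A machine model

Random access programs over two kinds of memory cells, holding natural numbers and real numbers.
The memory is organized in two-dimensional arrays; array names are constants of the program, and
indices are computed. The arithmetic consists of addition, (truncated) subtraction and halving of
natural numbers, addition and subtraction of real numbers, and comparisons; each operation, memory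
access, test and assignment is one step. There is no multiplication, no real constant besides `0`,
and no conversion between the two kinds. Hence in every step bit lengths grow by at most a
constant over the largest one present so far, and on rational data a number of steps that is
polynomial in the input size is polynomial time on a Turing machine. -/

namespace RAM

/-- A memory state: array name, row, column. -/
structure State where
  nat : ℕ → ℕ → ℕ → ℕ
  real : ℕ → ℕ → ℕ → ℝ

/-- Expressions for natural numbers; `get A i j` is the cell `A[i, j]`. -/
inductive NExpr where
  | lit (k : ℕ)
  | get (A : ℕ) (i j : NExpr)
  | add (x y : NExpr)
  | sub (x y : NExpr)
  | half (x : NExpr)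

/-- Expressions for real numbers. -/
inductive RExpr where
  | zero
  | get (A : ℕ) (i j : NExpr)
  | add (x y : RExpr)
  | sub (x y : RExpr)

/-- Tests. -/
inductive Test where
  | natLe (x y : NExpr)
  | realLe (x y : RExpr)
  | neg (b : Test)
  | conj (b c : Test)

/-- Programs. -/
inductive Prog where
  | skip
  | setNat (A : ℕ) (i j : NExpr) (x : NExpr)
  | setReal (A : ℕ) (i j : NExpr) (x : RExpr)
  | seq (P Q : Prog)
  | ite (b : Test) (P Q : Prog)
  | loop (b : Test) (P : Prog)

/-- The value of an expression. -/
def NExpr.eval (σ : State) : NExpr → ℕ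
  | lit k => k
  | get A i j => σ.nat A (i.eval σ) (j.eval σ)
  | add x y => x.eval σ + y.eval σ
  | sub x y => x.eval σ - y.eval σ
  | half x => x.eval σ / 2

/-- The number of operations in an expression. -/
def NExpr.ops : NExpr → ℕ
  | lit _ => 1
  | get _ i j => i.ops + j.ops + 1
  | add x y => x.ops + y.ops + 1
  | sub x y => x.ops + y.ops + 1
  | half x => x.ops + 1

/-- The value of a real expression. -/
noncomputable def RExpr.eval (σ : State) : RExpr → ℝ
  | zero => 0
  | get A i j => σ.real A (i.eval σ) (j.eval σ)
  | add x y => x.eval σ + y.eval σ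
  | sub x y => x.eval σ - y.eval σ

/-- The number of operations in a real expression. -/
def RExpr.ops : RExpr → ℕ
  | zero => 1
  | get _ i j => i.ops + j.ops + 1
  | add x y => x.ops + y.ops + 1
  | sub x y => x.ops + y.ops + 1

/-- The outcome of a test. -/
def Test.Holds (σ : State) : Test → Prop
  | natLe x y => x.eval σ ≤ y.eval σ
  | realLe x y => x.eval σ ≤ y.eval σ
  | neg b => ¬ b.Holds σ
  | conj b c => b.Holds σ ∧ c.Holds σ

/-- The number of operations in a test. -/
def Test.ops : Test → ℕ
  | natLe x y => x.ops + y.ops + 1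
  | realLe x y => x.ops + y.ops + 1
  | neg b => b.ops + 1
  | conj b c => b.ops + c.ops + 1

/-- Overwrite the cell `A[i, j]` of a memory. -/
def write {α : Type} (m : ℕ → ℕ → ℕ → α) (A i j : ℕ) (x : α) : ℕ → ℕ → ℕ → α :=
  fun A' i' j' => if A' = A ∧ i' = i ∧ j' = j then x else m A' i' j'

/-- `Exec P σ t τ`: started in the state `σ`, the program `P` halts in the state `τ` after exactly
`t` steps. -/
inductive Exec : Prog → State → ℕ → State → Prop
  | skip (σ : State) : Exec .skip σ 1 σ
  | setNat (A : ℕ) (i j x : NExpr) (σ : State) :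
      Exec (.setNat A i j x) σ (i.ops + j.ops + x.ops + 1)
        { σ with nat := write σ.nat A (i.eval σ) (j.eval σ) (x.eval σ) }
  | setReal (A : ℕ) (i j : NExpr) (x : RExpr) (σ : State) :
      Exec (.setReal A i j x) σ (i.ops + j.ops + x.ops + 1)
        { σ with real := write σ.real A (i.eval σ) (j.eval σ) (x.eval σ) }
  | seq {P Q : Prog} {σ σ₁ σ₂ : State} {s t : ℕ} :
      Exec P σ s σ₁ → Exec Q σ₁ t σ₂ → Exec (.seq P Q) σ (s + t) σ₂
  | iteTrue {b : Test} {P Q : Prog} {σ τ : State} {t : ℕ} :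
      b.Holds σ → Exec P σ t τ → Exec (.ite b P Q) σ (b.ops + t) τ
  | iteFalse {b : Test} {P Q : Prog} {σ τ : State} {t : ℕ} :
      ¬ b.Holds σ → Exec Q σ t τ → Exec (.ite b P Q) σ (b.ops + t) τ
  | loopStop {b : Test} {P : Prog} {σ : State} :
      ¬ b.Holds σ → Exec (.loop b P) σ b.ops σ
  | loopStep {b : Test} {P : Prog} {σ σ₁ τ : State} {s t : ℕ} :
      b.Holds σ → Exec P σ s σ₁ → Exec (.loop b P) σ₁ t τ →
        Exec (.loop b P) σ (b.ops + s + t) τ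

/-- Programs are deterministic, so that the final state and the number of steps are those of
the run of the program. -/
theorem Exec.deterministic {P : Prog} {σ τ τ' : State} {t t' : ℕ}
    (h : Exec P σ t τ) (h' : Exec P σ t' τ') : t = t' ∧ τ = τ' := by
  induction h generalizing t' τ' with
  | skip => cases h'; exact ⟨rfl, rfl⟩
  | setNat => cases h'; exact ⟨rfl, rfl⟩
  | setReal => cases h'; exact ⟨rfl, rfl⟩
  | seq _ _ ih₁ ih₂ =>
    cases h' with
    | seq g₁ g₂ =>
      obtain ⟨rfl, rfl⟩ := ih₁ g₁
      obtain ⟨rfl, rfl⟩ := ih₂ g₂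
      exact ⟨rfl, rfl⟩
  | iteTrue hb _ ih =>
    cases h' with
    | iteTrue _ g => obtain ⟨rfl, rfl⟩ := ih g; exact ⟨rfl, rfl⟩
    | iteFalse hb' _ => exact absurd hb hb'
  | iteFalse hb _ ih =>
    cases h' with
    | iteTrue hb' _ => exact absurd hb' hb
    | iteFalse _ g => obtain ⟨rfl, rfl⟩ := ih g; exact ⟨rfl, rfl⟩
  | loopStop hb =>
    cases h' with
    | loopStop _ => exact ⟨rfl, rfl⟩
    | loopStep hb' _ _ => exact absurd hb' hb
  | loopStep hb _ _ ih₁ ih₂ =>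
    cases h' with
    | loopStop hb' => exact absurd hb hb'
    | loopStep _ g₁ g₂ =>
      obtain ⟨rfl, rfl⟩ := ih₁ g₁
      obtain ⟨rfl, rfl⟩ := ih₂ g₂
      exact ⟨rfl, rfl⟩

end RAM

namespace TreeMetricInstance

open Classical in
/-- The initial memory for an instance whose tree has the nodes `0, …, n - 1`: the number `n`, the
adjacency matrix of the tree, the indicator of the terminals, the requirement matrix, and (in the
real memory) the matrix of edge lengths. All other cells are zero. -/
noncomputable def input {n : ℕ} (I : TreeMetricInstance (Fin n)) : RAM.State where
  nat := fun A i j =>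
    match A with
    | 0 => if i = 0 ∧ j = 0 then n else 0
    | 1 => if ∃ (hi : i < n) (hj : j < n), I.T.Adj ⟨i, hi⟩ ⟨j, hj⟩ then 1 else 0
    | 2 => if (∃ hi : i < n, ⟨i, hi⟩ ∈ I.V) ∧ j = 0 then 1 else 0
    | 3 =>
      if h : (∃ hi : i < n, (⟨i, hi⟩ : Fin n) ∈ I.V) ∧ (∃ hj : j < n, (⟨j, hj⟩ : Fin n) ∈ I.V) then
        I.r ⟨⟨i, h.1.fst⟩, h.1.snd⟩ ⟨⟨j, h.2.fst⟩, h.2.snd⟩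
      else 0
    | _ => 0
  real := fun A i j =>
    match A with
    | 0 =>
      if h : ∃ (hi : i < n) (hj : j < n), I.T.Adj ⟨i, hi⟩ ⟨j, hj⟩ then
        I.l s(⟨i, h.fst⟩, ⟨j, h.snd.fst⟩)
      else 0
    | _ => 0

/-- In the memory state `τ`, the natural-number array `4` contains the capacity `y`. -/
def Outputs {n : ℕ} (I : TreeMetricInstance (Fin n)) (τ : RAM.State) (y : Sym2 I.V → ℕ) : Prop :=
  ∀ i j : I.V, i ≠ j → τ.nat 4 (i : Fin n) (j : Fin n) = y s(i, j)

end TreeMetricInstance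

/-! Lower bound. The load of a tree edge `e` under `y` is the total capacity of the pairs separated
by `e`. As `a` is given by path lengths, the cost of `y` is `∑ l e * load e`. For a realization the
load is at least `R(X_e)`. At a node outside `V` the loads of the incident edges have an even sum,
since every path between terminals passes through. So the edges whose load differs in parity from
`R(X_e)` form an inner-odd join, and on them the load is at least `R(X_e) + 1` (`le_capacityCost`,
`oddEdges_isInnerOddJoin`).

Upper bound. For an inner-odd join `F`, give the tree the capacities `R(X_e) + 1_F(e)`. All nodes
outside `V` then have even degree, and `R(X_e) > 1` excludes cuts of capacity one. By Mader's
theorem pairs of edges at these nodes can be split off until the nodes are isolated, without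
violating the bottleneck requirement of any two remaining nodes. Splitting off never increases a
cut, so the load of each tree edge is at most its capacity (`exists_reduction`,
`exists_realization`).

Mader's theorem (`Setting.exists_admissible`). A pair `su`, `sv` can be split off unless a dangerous
set, one whose cut exceeds its requirement by at most one, contains `u` and `v`. Suppose all pairs
are blocked. Inside a Boolean algebra of node sets, dangerous sets are uncrossed with tight ones
until tight sets are atoms; this plays the role of contracting tight sets. Three maximal dangerous
sets around one neighbour of `s` then pairwise meet in the same atom, and for each two of them
exactly one keeps its requirement outside that atom. Two possibilities for three sets are too few.

Algorithm. A shortest inner-odd join is found by admitting the terminals one at a time and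
exchanging the best path from the new terminal (`IsOptimalJoin.insert`). Splitting off edge by edge
would take time proportional to the capacities `c`, so they are decomposed by the levels of `c / 2`.
For each level, capacity two on all edges that reach it is split off once and the result is used
with the multiplicity of the level, except that one copy per level is held back. The held-back
copies together with the parities of `c` give capacities of at most `2 * n + 1`, which have the same
bottlenecks as `c` and are split off in a final round (`LevelInv`).

Memory of the program: arrays 10 to 33 hold loop counters and current nodes; 40 a digraph to be
searched, with source 41, visited nodes 42 and predecessors 43; 44 the root; 45 the requirements of
the edges, 46 the join, 47 the capacities, 48 their halves; 49 and 51 the current and the next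
level, 50 the held-back copies; 52 the tree capacities to be split off, 53 the current graph, 54 the
bottlenecks, 55 the remaining nodes, 56 a trial splitting, 57 its verdict, 58 a flow value. -/

set_option linter.unusedSectionVars false
set_option linter.unusedSimpArgs false

/-! ### Mader's splitting theorem: uncrossing of dangerous sets. -/

namespace SplittingOff

variable {N : Type u} [Fintype N] [DecidableEq N]

/-- The total capacity between two node sets. -/
def between (g : N → N → ℕ) (P Q : Finset N) : ℕ := ∑ x ∈ P, ∑ y ∈ Q, g x y

/-- The capacity of the cut of a node set. -/
def cut (g : N → N → ℕ) (X : Finset N) : ℕ := between g X Xᶜ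

/-- The capacity between a node and a node set. -/
def degTo (g : N → N → ℕ) (s : N) (X : Finset N) : ℕ := ∑ x ∈ X, g s x

theorem between_eq_ite (g : N → N → ℕ) (P Q : Finset N) :
    between g P Q = ∑ x, ∑ y, if x ∈ P ∧ y ∈ Q then g x y else 0 := by
  rw [between, ← Finset.sum_subset (Finset.subset_univ P)]
  · refine Finset.sum_congr rfl fun x hx => ?_
    rw [← Finset.sum_subset (Finset.subset_univ Q)]
    · exact Finset.sum_congr rfl fun y hy => by simp [hx, hy]
    · intro y _ hy; simp [hy]
  · intro x _ hx; simp [hx]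

theorem between_comm {g : N → N → ℕ} (hg : ∀ x y, g x y = g y x) (P Q : Finset N) :
    between g P Q = between g Q P := by
  unfold between
  rw [Finset.sum_comm]
  exact Finset.sum_congr rfl fun y _ => Finset.sum_congr rfl fun x _ => hg x y

theorem between_mono (g : N → N → ℕ) {P P' Q Q' : Finset N} (hP : P ⊆ P') (hQ : Q ⊆ Q') :
    between g P Q ≤ between g P' Q' :=
  (Finset.sum_le_sum fun _ _ => Finset.sum_le_sum_of_subset hQ).trans
    (Finset.sum_le_sum_of_subset hP)

theorem le_between (g : N → N → ℕ) {P Q : Finset N} {x y : N} (hx : x ∈ P) (hy : y ∈ Q) :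
    g x y ≤ between g P Q :=
  (Finset.single_le_sum (f := fun y => g x y) (fun _ _ => Nat.zero_le _) hy).trans
    (Finset.single_le_sum (f := fun x => ∑ y ∈ Q, g x y) (fun _ _ => Nat.zero_le _) hx)

theorem between_union_right (g : N → N → ℕ) (P : Finset N) {Q Q' : Finset N}
    (h : Disjoint Q Q') : between g P (Q ∪ Q') = between g P Q + between g P Q' := by
  simp only [between, Finset.sum_union h, Finset.sum_add_distrib]

theorem between_singleton_right {g : N → N → ℕ} (hg : ∀ x y, g x y = g y x) (P : Finset N)
    (s : N) : between g P {s} = degTo g s P := by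
  simp only [between, degTo, Finset.sum_singleton]
  exact Finset.sum_congr rfl fun x _ => hg x s

theorem between_union_right_le (g : N → N → ℕ) (P Q Q' : Finset N) :
    between g P (Q ∪ Q') ≤ between g P Q + between g P Q' := by
  rw [← Finset.union_sdiff_self_eq_union, between_union_right g P Finset.disjoint_sdiff]
  exact Nat.add_le_add_left (between_mono g subset_rfl Finset.sdiff_subset) _

theorem cut_compl {g : N → N → ℕ} (hg : ∀ x y, g x y = g y x) (X : Finset N) :
    cut g Xᶜ = cut g X := by
  rw [cut, cut, compl_compl, between_comm hg]

/-- Both sides count every ordered pair of nodes equally often; the diagonal edges are the exact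
excess in submodularity. -/
theorem cut_add_cut {g : N → N → ℕ} (hg : ∀ x y, g x y = g y x) (X Y : Finset N) :
    cut g X + cut g Y = cut g (X ∩ Y) + cut g (X ∪ Y) + 2 * between g (X \ Y) (Y \ X) := by
  have h : 2 * between g (X \ Y) (Y \ X)
      = between g (X \ Y) (Y \ X) + between g (Y \ X) (X \ Y) := by
    rw [between_comm hg (Y \ X)]; ring
  rw [h]
  simp only [cut, between_eq_ite, ← Finset.sum_add_distrib]
  refine Finset.sum_congr rfl fun x _ => Finset.sum_congr rfl fun y _ => ?_
  by_cases h1 : x ∈ X <;> by_cases h2 : x ∈ Y <;> by_cases h3 : y ∈ X <;> by_cases h4 : y ∈ Y <;>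
    simp [h1, h2, h3, h4]

/-- Submodularity for `X` and the complement of `Y`. If `s` is outside both sets, the excess counts
the edges from `s` to `X ∩ Y`; this is what bounds the degree of `s` into intersections. -/
theorem cut_add_cut' {g : N → N → ℕ} (hg : ∀ x y, g x y = g y x) (X Y : Finset N) :
    cut g X + cut g Y = cut g (X \ Y) + cut g (Y \ X) + 2 * between g (X ∩ Y) (X ∪ Y)ᶜ := by
  have h := cut_add_cut hg X Yᶜ
  have e1 : X ∩ Yᶜ = X \ Y := by ext; simp
  have e2 : X ∪ Yᶜ = (Y \ X)ᶜ := by ext; simp; tauto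
  have e3 : X \ Yᶜ = X ∩ Y := by ext; simp
  have e4 : Yᶜ \ X = (X ∪ Y)ᶜ := by ext; simp; tauto
  rw [e1, e2, e3, e4, cut_compl hg, cut_compl hg] at h
  exact h

/-- The situation in which a pair of edges at the node `s` is to be split off: `A` is the set of
the other nodes, and the cuts of subsets of `A` have to satisfy the requirement `R`. -/
structure Setting (g : N → N → ℕ) (s : N) (A : Finset N) (R : Finset N → ℕ) : Prop where
  symm : ∀ x y, g x y = g y x
  notMem : s ∉ A
  zero : ∀ x, x ∉ A → x ≠ s → ∀ y, y ≠ x → g x y = 0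
  req_sdiff : ∀ X, X ⊆ A → R (A \ X) = R X
  req_union : ∀ P Q, R (P ∪ Q) ≤ max (R P) (R Q)
  req_self : R A = 0
  le_cut : ∀ X, X ⊆ A → X.Nonempty → X ≠ A → R X ≤ cut g X
  even : Even (degTo g s A)
  pos : 0 < degTo g s A
  two_le_cut : ∀ X, X ⊆ A → 0 < degTo g s X → 2 ≤ cut g X

/-- A set whose cut exceeds its requirement by at most one. -/
def Dangerous (g : N → N → ℕ) (A : Finset N) (R : Finset N → ℕ) (X : Finset N) : Prop :=
  X ⊆ A ∧ X.Nonempty ∧ X ≠ A ∧ cut g X ≤ R X + 1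

namespace Setting

variable {g : N → N → ℕ} {s : N} {A : Finset N} {R : Finset N → ℕ} (S : Setting g s A R)

include S

/-- `X`, `Y` and their complements in `A` are each a union of two of the four parts into which `X`
and `Y` divide `A`. So each of `R X`, `R Y` is bounded by one of two parts in two ways, and every
combination yields one of the alternatives. -/
theorem req_skew {X Y : Finset N} (hX : X ⊆ A) (hY : Y ⊆ A) :
    R X + R Y ≤ R (X ∩ Y) + R (X ∪ Y) ∨ R X + R Y ≤ R (X \ Y) + R (Y \ X) := by
  have h1 := S.req_union (X ∩ Y) (X \ Y)
  have h2 := S.req_union (X ∩ Y) (Y \ X)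
  have h3 := S.req_union (Y \ X) (A \ (X ∪ Y))
  have h4 := S.req_union (X \ Y) (A \ (X ∪ Y))
  rw [show X ∩ Y ∪ X \ Y = X by ext; simp; tauto] at h1
  rw [show X ∩ Y ∪ Y \ X = Y by ext; simp; tauto] at h2
  rw [S.req_sdiff _ (Finset.union_subset hX hY)] at h3 h4
  rw [show Y \ X ∪ A \ (X ∪ Y) = A \ X by
    ext z; have := @hY z; simp; tauto, S.req_sdiff _ hX] at h3
  rw [show X \ Y ∪ A \ (X ∪ Y) = A \ Y by
    ext z; have := @hX z; simp; tauto, S.req_sdiff _ hY] at h4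
  simp only [le_max_iff] at h1 h2 h3 h4
  omega

theorem degTo_le_between {P Q : Finset N} (hs : s ∈ Q) : degTo g s P ≤ between g P Q := by
  rw [← between_singleton_right S.symm]
  exact between_mono g subset_rfl (by simpa using hs)

/-- Nodes outside `A` other than `s` are isolated, so an edge leaving `X` ends in `A \ X` or at `s`.
-/
theorem cut_eq {X : Finset N} (hX : X ⊆ A) :
    cut g X = between g X (A \ X) + degTo g s X := by
  have hs : s ∉ A \ X := fun h => S.notMem (Finset.mem_sdiff.1 h).1
  rw [← between_singleton_right S.symm, ← between_union_right g X (by simpa using hs), cut,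
    between, between]
  refine Finset.sum_congr rfl fun x hx => (Finset.sum_subset ?_ ?_).symm
  · intro y hy
    simp only [Finset.mem_union, Finset.mem_sdiff, Finset.mem_singleton, Finset.mem_compl] at hy ⊢
    rcases hy with h | rfl
    · exact h.2
    · exact fun h => S.notMem (hX h)
  · intro y hy hy'
    have hxy : x ≠ y := fun h => Finset.mem_compl.1 hy (h ▸ hx)
    simp only [Finset.mem_union, Finset.mem_sdiff, Finset.mem_singleton, Finset.mem_compl,
      not_or, not_and] at hy hy'
    rw [S.symm]
    exact S.zero y (fun h => hy (by simpa using hy'.1 h)) hy'.2 x hxy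

theorem degTo_add_sdiff {X : Finset N} (hX : X ⊆ A) :
    degTo g s (A \ X) + degTo g s X = degTo g s A :=
  Finset.sum_sdiff hX

/-- The cuts of `X` and `A \ X` differ only in the edges at `s`, and both sets have the same
requirement. Hence `s` sends at most one edge more to `X` than to `A \ X`, and evenness of the
degree rules out that one. -/
theorem two_mul_degTo_le {X : Finset N} (hX : Dangerous g A R X) :
    2 * degTo g s X ≤ degTo g s A := by
  obtain ⟨hXA, hne, hne', hd⟩ := hX
  have h1 := S.cut_eq hXA
  have h2 := S.cut_eq (X := A \ X) Finset.sdiff_subset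
  rw [Finset.sdiff_sdiff_eq_self hXA, between_comm S.symm] at h2
  have h3 := S.le_cut (A \ X) Finset.sdiff_subset
    (Finset.sdiff_nonempty.2 fun h => hne' (hXA.antisymm h))
    (fun h => by
      obtain ⟨x, hx⟩ := hne
      have := h ▸ hXA hx
      exact (Finset.mem_sdiff.1 this).2 hx)
  rw [S.req_sdiff _ hXA] at h3
  have h4 := S.degTo_add_sdiff hXA
  obtain ⟨k, hk⟩ := S.even
  omega

theorem cut_self : cut g A = degTo g s A := by
  rw [S.cut_eq subset_rfl]; simp [between]

/-- The union of a dangerous set and another set is not all of `A` if they share a neighbour. -/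
theorem exists_notMem_union {X Y : Finset N} (hX : Dangerous g A R X) (hY : Dangerous g A R Y)
    {t : N} (htX : t ∈ X) (htY : t ∈ Y) (ht : 0 < g s t) :
    ∃ z ∈ A, 0 < g s z ∧ z ∉ X ∧ z ∉ Y := by
  -- Each of the sets receives at most half of the edges at `s`, and `st` is counted in both, so
  -- together they cannot receive all.
  by_contra! h
  have h1 := S.two_mul_degTo_le hX
  have h2 := S.two_mul_degTo_le hY
  have h3 : degTo g s (X ∪ Y) + degTo g s (X ∩ Y) = degTo g s X + degTo g s Y :=
    Finset.sum_union_inter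
  have h4 : degTo g s A = degTo g s (X ∪ Y) := by
    symm
    refine Finset.sum_subset (Finset.union_subset hX.1 hY.1) fun z hz hz' => ?_
    by_contra h0
    simp only [Finset.mem_union, not_or] at hz'
    exact hz'.2 (h z hz (Nat.pos_of_ne_zero h0) hz'.1)
  have h5 : g s t ≤ degTo g s (X ∩ Y) :=
    Finset.single_le_sum (f := fun y => g s y) (fun _ _ => Nat.zero_le _)
      (Finset.mem_inter.2 ⟨htX, htY⟩)
  omega

theorem degTo_pos {X : Finset N} {t : N} (htX : t ∈ X) (ht : 0 < g s t) : 0 < degTo g s X :=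
  ht.trans_le (Finset.single_le_sum (f := fun y => g s y) (fun _ _ => Nat.zero_le _) htX)

end Setting

/-- A family of subsets of `A` that is closed under the Boolean operations and in which tight sets
are atoms, and which contains dangerous sets for all pairs of neighbours of `s`. -/
structure Blocked (g : N → N → ℕ) (s : N) (A : Finset N) (R : Finset N → ℕ)
    (F : Finset (Finset N)) : Prop where
  subset : ∀ X ∈ F, X ⊆ A
  inter : ∀ X ∈ F, ∀ Y ∈ F, X ∩ Y ∈ F
  sdiff : ∀ X ∈ F, ∀ Y ∈ F, X \ Y ∈ F
  union : ∀ X ∈ F, ∀ Y ∈ F, X ∪ Y ∈ F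
  dangerous : ∀ u ∈ A, ∀ v ∈ A, u ≠ v → 0 < g s u → 0 < g s v → ∃ X ∈ F, Dangerous g A R X ∧ u ∈ X ∧ v ∈ X

/-- Every set of the family with a tight cut is an atom of the family. -/
def TightAtoms (g : N → N → ℕ) (A : Finset N) (R : Finset N → ℕ) (F : Finset (Finset N)) : Prop :=
  ∀ X ∈ F, X.Nonempty → X ≠ A → cut g X ≤ R X → ∀ Y ∈ F, X ⊆ Y ∨ Disjoint X Y

/-- The weight by which dangerous sets are compared: first by the number of neighbours of `s`, then
by size. -/
def weight (g : N → N → ℕ) (s : N) (X : Finset N) : ℕ :=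
  X.card + (Fintype.card N + 1) * (X.filter fun x => 0 < g s x).card

/-- A dangerous set that is maximal with respect to the weight. -/
def MaxDangerous (g : N → N → ℕ) (s : N) (A : Finset N) (R : Finset N → ℕ)
    (F : Finset (Finset N)) (X : Finset N) : Prop :=
  X ∈ F ∧ Dangerous g A R X ∧ ∀ Y ∈ F, Dangerous g A R Y →
    (∀ x ∈ X, 0 < g s x → x ∈ Y) → weight g s Y ≤ weight g s X

/-- The factor `Fintype.card N + 1` lets a single additional neighbour of `s` outweigh any
difference in size. -/
theorem weight_lt {g : N → N → ℕ} {s : N} {X Y : Finset N} (h : ∀ x ∈ X, 0 < g s x → x ∈ Y)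
    {y : N} (hy : y ∈ Y) (hyX : y ∉ X) (hgy : 0 < g s y) : weight g s X < weight g s Y := by
  have h1 : (X.filter fun x => 0 < g s x).card < (Y.filter fun x => 0 < g s x).card := by
    refine Finset.card_lt_card (Finset.ssubset_iff_subset_ne.2 ⟨?_, ?_⟩)
    · intro x hx
      rw [Finset.mem_filter] at hx ⊢
      exact ⟨h x hx.1 hx.2, hx.2⟩
    · intro he
      have : y ∈ X.filter fun x => 0 < g s x := by rw [he]; simp [hy, hgy]
      exact hyX (Finset.mem_filter.1 this).1
  have h2 : X.card ≤ Fintype.card N := Finset.card_le_univ X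
  unfold weight
  nlinarith

theorem exists_maxDangerous {g : N → N → ℕ} {s : N} {A : Finset N} {R : Finset N → ℕ}
    {F : Finset (Finset N)} {X : Finset N} (hXF : X ∈ F) (hX : Dangerous g A R X) :
    ∃ Y, MaxDangerous g s A R F Y ∧ ∀ x ∈ X, 0 < g s x → x ∈ Y := by
  classical
  obtain ⟨Y, hY, hmax⟩ := Finset.exists_max_image
    (F.filter fun Y => Dangerous g A R Y ∧ ∀ x ∈ X, 0 < g s x → x ∈ Y) (weight g s)
    ⟨X, Finset.mem_filter.2 ⟨hXF, hX, fun x hx _ => hx⟩⟩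
  simp only [Finset.mem_filter] at hY hmax
  exact ⟨Y, ⟨hY.1, hY.2.1, fun Z hZ hZd hZY =>
    hmax Z ⟨hZ, hZd, fun x hx hgx => hZY x (hY.2.2 x hx hgx) hgx⟩⟩, hY.2.2⟩

section Core

variable {g : N → N → ℕ} {s : N} {A : Finset N} {R : Finset N → ℕ} {F : Finset (Finset N)}
  (S : Setting g s A R) (hB : Blocked g s A R F) (hT : TightAtoms g A R F)

/-- Otherwise `Y` would contain all neighbours of `s` in `X` and also `y`, contradicting the
maximality of `X`. -/
theorem MaxDangerous.exists_mem_notMem {X Y : Finset N} (hX : MaxDangerous g s A R F X)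
    (hY : MaxDangerous g s A R F Y) {y : N} (hyY : y ∈ Y) (hyX : y ∉ X) (hy : 0 < g s y) :
    ∃ x ∈ X, x ∉ Y ∧ 0 < g s x := by
  by_contra! h
  have h1 : ∀ x ∈ X, 0 < g s x → x ∈ Y := fun x hx hgx => by
    by_contra hxY
    exact absurd (h x hx hxY) (by omega)
  exact absurd (hX.2.2 Y hY.1 hY.2.1 h1) (not_le.2 (weight_lt h1 hyY hyX hy))

include S hB

/-- The common neighbour `t` keeps the union from being all of `A`, and `y` would make a dangerous
union heavier than `X`. -/
theorem MaxDangerous.union_not_dangerous {X Y : Finset N} (hX : MaxDangerous g s A R F X)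
    (hY : MaxDangerous g s A R F Y) {t y : N} (htX : t ∈ X) (htY : t ∈ Y) (ht : 0 < g s t)
    (hyY : y ∈ Y) (hyX : y ∉ X) (hy : 0 < g s y) : R (X ∪ Y) + 2 ≤ cut g (X ∪ Y) := by
  by_contra h
  obtain ⟨z, hzA, -, hzX, hzY⟩ := S.exists_notMem_union hX.2.1 hY.2.1 htX htY ht
  have h1 : Dangerous g A R (X ∪ Y) :=
    ⟨Finset.union_subset hX.2.1.1 hY.2.1.1, ⟨t, Finset.mem_union_left _ htX⟩,
      fun he => by rw [← he, Finset.mem_union] at hzA; tauto, by omega⟩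
  have h2 : ∀ x ∈ X, 0 < g s x → x ∈ X ∪ Y := fun x hx _ => Finset.mem_union_left _ hx
  exact absurd (hX.2.2 _ (hB.union _ hX.1 _ hY.1) h1 h2)
    (not_le.2 (weight_lt h2 (Finset.mem_union_right _ hyY) hyX hy))

/-- The two cuts together exceed the requirements by at most 2, and the union alone takes up this
slack. -/
theorem MaxDangerous.of_inter {X Y : Finset N} (hX : MaxDangerous g s A R F X)
    (hY : MaxDangerous g s A R F Y) {t y : N} (htX : t ∈ X) (htY : t ∈ Y) (ht : 0 < g s t)
    (hyY : y ∈ Y) (hyX : y ∉ X) (hy : 0 < g s y)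
    (hR : R X + R Y ≤ R (X ∩ Y) + R (X ∪ Y)) :
    cut g Y = R Y + 1 ∧ cut g (X ∩ Y) ≤ R (X ∩ Y) ∧ X ∩ Y ≠ A := by
  have h1 := hX.union_not_dangerous S hB hY htX htY ht hyY hyX hy
  have h2 := cut_add_cut S.symm X Y
  have hne : X ∩ Y ≠ A := fun he => hX.2.1.2.2.1 (hX.2.1.1.antisymm
    (he ▸ Finset.inter_subset_left))
  have h3 := S.le_cut (X ∩ Y) (Finset.inter_subset_left.trans hX.2.1.1)
    ⟨t, Finset.mem_inter.2 ⟨htX, htY⟩⟩ hne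
  have h4 := hX.2.1.2.2.2
  have h5 := hY.2.1.2.2.2
  exact ⟨by omega, by omega, hne⟩

/-- The edge `st` counts twice in the excess of `cut_add_cut'` and takes up the whole slack of 2.
Thus the differences are tight, and no second edge leads from `X ∩ Y` out of the union. -/
theorem MaxDangerous.of_sdiff {X Y : Finset N} (hX : MaxDangerous g s A R F X)
    (hY : MaxDangerous g s A R F Y) {t y : N} (htX : t ∈ X) (htY : t ∈ Y) (ht : 0 < g s t)
    (hyY : y ∈ Y) (hyX : y ∉ X) (hy : 0 < g s y)
    (hR : R X + R Y ≤ R (X \ Y) + R (Y \ X)) :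
    cut g (X \ Y) ≤ R (X \ Y) ∧ cut g (Y \ X) ≤ R (Y \ X) ∧
      between g (X ∩ Y) (X ∪ Y)ᶜ ≤ 1 ∧ X \ Y ≠ A ∧ Y \ X ≠ A := by
  obtain ⟨x, hxX, hxY, hx⟩ := hX.exists_mem_notMem hY hyY hyX hy
  have h2 := cut_add_cut' S.symm X Y
  have hne1 : X \ Y ≠ A := fun he => hX.2.1.2.2.1 (hX.2.1.1.antisymm
    (he ▸ Finset.sdiff_subset))
  have hne2 : Y \ X ≠ A := fun he => hY.2.1.2.2.1 (hY.2.1.1.antisymm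
    (he ▸ Finset.sdiff_subset))
  have h3 := S.le_cut (X \ Y) (Finset.sdiff_subset.trans hX.2.1.1)
    ⟨x, Finset.mem_sdiff.2 ⟨hxX, hxY⟩⟩ hne1
  have h3' := S.le_cut (Y \ X) (Finset.sdiff_subset.trans hY.2.1.1)
    ⟨y, Finset.mem_sdiff.2 ⟨hyY, hyX⟩⟩ hne2
  have h4 := hX.2.1.2.2.2
  have h5 := hY.2.1.2.2.2
  have hs : s ∈ (X ∪ Y)ᶜ := by
    rw [Finset.mem_compl, Finset.mem_union]
    rintro (h | h)
    · exact S.notMem (hX.2.1.1 h)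
    · exact S.notMem (hY.2.1.1 h)
  have h6 := le_between g (Finset.mem_inter.2 ⟨htX, htY⟩) hs
  rw [S.symm] at h6
  exact ⟨by omega, by omega, by omega, hne1, hne2⟩

include hT

/-- One step of the uncrossing of three dangerous sets. -/
theorem MaxDangerous.sdiff_inter_disjoint {X Y Z : Finset N} (hX : MaxDangerous g s A R F X)
    (hY : MaxDangerous g s A R F Y) (hZ : MaxDangerous g s A R F Z) {t x z : N}
    (htX : t ∈ X) (htY : t ∈ Y) (htZ : t ∈ Z) (ht : 0 < g s t)
    (hxX : x ∈ X) (hxY : x ∉ Y) (hx : 0 < g s x)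
    (hzX : z ∉ X) (hzZ : z ∈ Z) (hz : 0 < g s z)
    (htight : cut g (X \ Y) ≤ R (X \ Y)) (hne : X \ Y ≠ A) :
    x ∉ Z ∧ Disjoint (X \ Y) Z := by
  -- If `x ∈ Z`, either `X ∩ Z` is tight and hence an atom, although `Y` contains `t` but not `x`;
  -- or at most one edge leads from `s` to `X ∩ Z`, although `t` and `x` are both neighbours.
  have hxZ : x ∉ Z := by
    intro hxZ
    rcases S.req_skew hX.2.1.1 hZ.2.1.1 with h | h
    · obtain ⟨-, h2, h3⟩ := hX.of_inter S hB hZ htX htZ ht hzZ hzX hz h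
      rcases hT _ (hB.inter _ hX.1 _ hZ.1) ⟨t, Finset.mem_inter.2 ⟨htX, htZ⟩⟩ h3 h2 _ hY.1
        with h4 | h4
      · exact hxY (h4 (Finset.mem_inter.2 ⟨hxX, hxZ⟩))
      · exact Finset.disjoint_left.1 h4 (Finset.mem_inter.2 ⟨htX, htZ⟩) htY
    · obtain ⟨-, -, h3, -⟩ := hX.of_sdiff S hB hZ htX htZ ht hzZ hzX hz h
      have hs : s ∈ (X ∪ Z)ᶜ := by
        rw [Finset.mem_compl, Finset.mem_union]
        rintro (h | h)
        · exact S.notMem (hX.2.1.1 h)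
        · exact S.notMem (hZ.2.1.1 h)
      have h4 := S.degTo_le_between (P := X ∩ Z) hs
      have h5 : degTo g s {t, x} ≤ degTo g s (X ∩ Z) := Finset.sum_le_sum_of_subset (by
        intro w hw
        simp only [Finset.mem_insert, Finset.mem_singleton] at hw
        rcases hw with rfl | rfl <;> simp [*])
      have htx : t ≠ x := fun h => hxY (h ▸ htY)
      rw [degTo, Finset.sum_pair htx] at h5
      omega
  refine ⟨hxZ, ?_⟩
  rcases hT _ (hB.sdiff _ hX.1 _ hY.1) ⟨x, Finset.mem_sdiff.2 ⟨hxX, hxY⟩⟩ hne htight _ hZ.1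
    with h | h
  · exact absurd (h (Finset.mem_sdiff.2 ⟨hxX, hxY⟩)) hxZ
  · exact h

/-- A maximal dangerous set `Z` around `t` and a neighbour `z` outside `X ∪ Y` avoids both
differences. If it uncrosses with `X` or `Y` by intersection, its cut decomposes into two cuts and
is too large to be dangerous. Otherwise all three pairwise intersections agree, and `st` is the only
edge leaving them, against `two_le_cut`. -/
theorem MaxDangerous.not_sdiff {X Y : Finset N} (hX : MaxDangerous g s A R F X)
    (hY : MaxDangerous g s A R F Y) {t y : N} (htX : t ∈ X) (htY : t ∈ Y) (ht : 0 < g s t)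
    (hyY : y ∈ Y) (hyX : y ∉ X) (hy : 0 < g s y) :
    ¬ R X + R Y ≤ R (X \ Y) + R (Y \ X) := by
  intro hR
  obtain ⟨hXY, hYX, hout, hneX, hneY⟩ := hX.of_sdiff S hB hY htX htY ht hyY hyX hy hR
  obtain ⟨x, hxX, hxY, hx⟩ := hX.exists_mem_notMem hY hyY hyX hy
  obtain ⟨z, hzA, hz, hzX, hzY⟩ := S.exists_notMem_union hX.2.1 hY.2.1 htX htY ht
  obtain ⟨Z₀, hZ₀F, hZ₀, htZ₀, hzZ₀⟩ := hB.dangerous t (hX.2.1.1 htX) z hzA (fun h => hzX (h ▸ htX)) ht hz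
  obtain ⟨Z, hZ, hZZ⟩ := exists_maxDangerous (s := s) hZ₀F hZ₀
  have htZ := hZZ t htZ₀ ht
  have hzZ := hZZ z hzZ₀ hz
  obtain ⟨hxZ, hdX⟩ := hX.sdiff_inter_disjoint S hB hT hY hZ htX htY htZ ht hxX hxY hx hzX hzZ hz
    hXY hneX
  obtain ⟨hyZ, hdY⟩ := hY.sdiff_inter_disjoint S hB hT hX hZ htY htX htZ ht hyY hyX hy hzY hzZ hz
    hYX hneY
  have hXZ : ∀ w ∈ X, w ∈ Z → w ∈ Y := fun w hw hwZ => by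
    by_contra h
    exact Finset.disjoint_left.1 hdX (Finset.mem_sdiff.2 ⟨hw, h⟩) hwZ
  have hYZ : ∀ w ∈ Y, w ∈ Z → w ∈ X := fun w hw hwZ => by
    by_contra h
    exact Finset.disjoint_left.1 hdY (Finset.mem_sdiff.2 ⟨hw, h⟩) hwZ
  have hsX : s ∉ X := fun h => S.notMem (hX.2.1.1 h)
  have hsY : s ∉ Y := fun h => S.notMem (hY.2.1.1 h)
  have hsZ : s ∉ Z := fun h => S.notMem (hZ.2.1.1 h)
  -- the case of a tight intersection
  have key : ∀ W, MaxDangerous g s A R F W → t ∈ W → z ∉ W → X ∩ Z = W ∩ Z →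
      ¬ R W + R Z ≤ R (W ∩ Z) + R (W ∪ Z) := by
    intro W hW htW hzW hWZ hRW
    obtain ⟨h1, h2, -⟩ := hW.of_inter S hB hZ htW htZ ht hzZ hzW hz hRW
    rw [← hWZ] at h2
    have htK : t ∈ X ∩ Z := Finset.mem_inter.2 ⟨htX, htZ⟩
    have hzK : z ∈ Z \ (X ∩ Z) := by simp [hzZ, hzX]
    have h3 := cut_add_cut' S.symm Z (X ∩ Z)
    have e1 : Z ∩ (X ∩ Z) = X ∩ Z := by ext; simp
    have e2 : (Z ∪ X ∩ Z)ᶜ = Zᶜ := by congr 1; ext; simp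
    have e3 : (X ∩ Z) \ Z = ∅ := by ext; simp
    rw [e1, e2, e3] at h3
    have h4 : cut g (X ∩ Z) = between g (X ∩ Z) Zᶜ + between g (X ∩ Z) (Z \ (X ∩ Z)) := by
      rw [← between_union_right]
      · rw [cut]; congr 1; ext w; simp; tauto
      · rw [Finset.disjoint_left]; intro w; simp; tauto
    -- `X ∩ Z` lies in `X ∩ Y`, while `s` and `Z \ X` lie outside `X ∪ Y`, so `hout` bounds all
    -- these edges together. The edge `st` is one of them and leaves none between the two parts of
    -- `Z`.
    have h5 : between g (X ∩ Z) (Z \ (X ∩ Z)) + degTo g s (X ∩ Z) ≤ 1 := by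
      rw [← between_singleton_right S.symm, ← between_union_right]
      · refine (between_mono g ?_ ?_).trans hout
        · intro w hw
          simp only [Finset.mem_inter] at hw ⊢
          exact ⟨hw.1, hXZ w hw.1 hw.2⟩
        · intro w hw
          simp only [Finset.mem_union, Finset.mem_sdiff, Finset.mem_inter, Finset.mem_singleton,
            Finset.mem_compl] at hw ⊢
          rcases hw with hw | rfl
          · rintro (h | h)
            · exact hw.2 ⟨h, hw.1⟩
            · exact hw.2 ⟨hYZ w h hw.1, hw.1⟩
          · tauto
      · simp [hsZ]
    have h6 := S.degTo_pos htK ht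
    have h7 := S.two_le_cut (X ∩ Z) (Finset.inter_subset_left.trans hX.2.1.1) h6
    have h8 := S.two_le_cut (Z \ (X ∩ Z)) (Finset.sdiff_subset.trans hZ.2.1.1)
      (S.degTo_pos hzK hz)
    -- The cut of `Z` is now the sum of the cuts of its two parts. One part has requirement at least
    -- `R Z` and the other has a cut of at least 2.
    have h9 := S.req_union (X ∩ Z) (Z \ (X ∩ Z))
    rw [show X ∩ Z ∪ Z \ (X ∩ Z) = Z by ext; simp; tauto] at h9
    have h10 := S.le_cut (Z \ (X ∩ Z)) (Finset.sdiff_subset.trans hZ.2.1.1) ⟨z, hzK⟩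
      (fun he => by
        have := S.notMem
        have h := hX.2.1.1 htX
        rw [← he, Finset.mem_sdiff] at h
        exact h.2 htK)
    have h11 := S.le_cut (X ∩ Z) (Finset.inter_subset_left.trans hX.2.1.1) ⟨t, htK⟩
      (fun he => hX.2.1.2.2.1 (hX.2.1.1.antisymm (he ▸ Finset.inter_subset_left)))
    have hcut0 : cut g (∅ : Finset N) = 0 := by simp [cut, between]
    rw [le_max_iff] at h9
    omega
  have hsame : X ∩ Z = Y ∩ Z := by
    ext w; simp only [Finset.mem_inter]
    exact ⟨fun h => ⟨hXZ w h.1 h.2, h.2⟩, fun h => ⟨hYZ w h.1 h.2, h.2⟩⟩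
  have hRX := (S.req_skew hX.2.1.1 hZ.2.1.1).resolve_left (key X hX htX hzX rfl)
  have hRY := (S.req_skew hY.2.1.1 hZ.2.1.1).resolve_left (key Y hY htY hzY hsame)
  obtain ⟨hXZt, -, houtX, hneXZ, -⟩ := hX.of_sdiff S hB hZ htX htZ ht hzZ hzX hz hRX
  obtain ⟨-, -, houtY, -⟩ := hY.of_sdiff S hB hZ htY htZ ht hzZ hzY hz hRY
  -- `X \ Z` is a tight atom containing `x ∉ Y`, so it is disjoint from `Y`.
  have hMZ : ∀ w ∈ X, w ∈ Y → w ∈ Z := by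
    intro w hwX hwY
    by_contra hwZ
    rcases hT _ (hB.sdiff _ hX.1 _ hZ.1) ⟨x, Finset.mem_sdiff.2 ⟨hxX, hxZ⟩⟩ hneXZ hXZt _ hY.1
      with h | h
    · exact hxY (h (Finset.mem_sdiff.2 ⟨hxX, hxZ⟩))
    · exact Finset.disjoint_left.1 h (Finset.mem_sdiff.2 ⟨hwX, hwZ⟩) hwY
  have e1 : X ∩ Z = X ∩ Y := by
    ext w; simp only [Finset.mem_inter]
    exact ⟨fun h => ⟨h.1, hXZ w h.1 h.2⟩, fun h => ⟨h.1, hMZ w h.1 h.2⟩⟩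
  rw [e1] at houtX hsame
  rw [← hsame] at houtY
  set M := X ∩ Y with hM
  have htM : t ∈ M := Finset.mem_inter.2 ⟨htX, htY⟩
  have hMpos := S.degTo_pos htM ht
  have h2 := S.two_le_cut M (Finset.inter_subset_left.trans hX.2.1.1) hMpos
  have split : ∀ P Q : Finset N, s ∉ P → s ∉ Q →
      between g M (P ∪ Q)ᶜ = degTo g s M + between g M ((P ∪ Q)ᶜ \ {s}) := by
    intro P Q hP hQ
    rw [← between_singleton_right S.symm, ← between_union_right g M Finset.disjoint_sdiff]
    congr 1
    ext w
    simp only [Finset.mem_compl, Finset.mem_union, Finset.mem_singleton, Finset.mem_sdiff]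
    by_cases hw : w = s <;> simp [hw, hP, hQ]
  rw [split X Y hsX hsY] at hout
  rw [split X Z hsX hsZ] at houtX
  rw [split Y Z hsY hsZ] at houtY
  -- A node outside `M` other than `s` avoids two of the three sets, and the edge `st` already
  -- exhausts the bound for each two of them. So only `st` leaves `M`.
  have hcover : Mᶜ ⊆ {s} ∪ (((X ∪ Y)ᶜ \ {s}) ∪ (((X ∪ Z)ᶜ \ {s}) ∪ ((Y ∪ Z)ᶜ \ {s}))) := by
    intro w hw
    rw [hM, Finset.mem_compl, Finset.mem_inter] at hw
    simp only [Finset.mem_compl, Finset.mem_union, Finset.mem_singleton, Finset.mem_sdiff]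
    by_cases hws : w = s
    · exact Or.inl hws
    by_cases hwX : w ∈ X
    · have hwY : w ∉ Y := fun h => hw ⟨hwX, h⟩
      exact Or.inr (Or.inr (Or.inr ⟨not_or.2 ⟨hwY, fun h => hwY (hXZ w hwX h)⟩, hws⟩))
    · by_cases hwY : w ∈ Y
      · exact Or.inr (Or.inr (Or.inl ⟨not_or.2 ⟨hwX, fun h => hwX (hYZ w hwY h)⟩, hws⟩))
      · exact Or.inr (Or.inl ⟨not_or.2 ⟨hwX, hwY⟩, hws⟩)
  have h3 : cut g M ≤ _ := between_mono g (subset_refl M) hcover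
  have h4 := between_union_right_le g M {s}
    (((X ∪ Y)ᶜ \ {s}) ∪ (((X ∪ Z)ᶜ \ {s}) ∪ ((Y ∪ Z)ᶜ \ {s})))
  have h5 := between_union_right_le g M ((X ∪ Y)ᶜ \ {s})
    (((X ∪ Z)ᶜ \ {s}) ∪ ((Y ∪ Z)ᶜ \ {s}))
  have h6 := between_union_right_le g M ((X ∪ Z)ᶜ \ {s}) ((Y ∪ Z)ᶜ \ {s})
  rw [between_singleton_right S.symm] at h4
  omega

/-- With the difference alternative excluded, intersections are tight and hence atoms. What is left
of the exclusion is that not both sets keep their requirement after removal of the intersection. -/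
theorem MaxDangerous.tight_inter {X Y : Finset N} (hX : MaxDangerous g s A R F X)
    (hY : MaxDangerous g s A R F Y) {t y : N} (htX : t ∈ X) (htY : t ∈ Y) (ht : 0 < g s t)
    (hyY : y ∈ Y) (hyX : y ∉ X) (hy : 0 < g s y) :
    (∀ Z ∈ F, X ∩ Y ⊆ Z ∨ Disjoint (X ∩ Y) Z) ∧ ¬ (R X ≤ R (X \ Y) ∧ R Y ≤ R (Y \ X)) := by
  have h := hX.not_sdiff S hB hT hY htX htY ht hyY hyX hy
  obtain ⟨-, h1, h2⟩ := hX.of_inter S hB hY htX htY ht hyY hyX hy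
    ((S.req_skew hX.2.1.1 hY.2.1.1).resolve_right h)
  exact ⟨hT _ (hB.inter _ hX.1 _ hY.1) ⟨t, Finset.mem_inter.2 ⟨htX, htY⟩⟩ h2 h1,
    fun h' => h (Nat.add_le_add h'.1 h'.2)⟩

/-- Two dangerous sets around a common neighbour cannot both have their requirement attained only
in the intersection. -/
theorem MaxDangerous.not_both_bad {X Y : Finset N} (hX : MaxDangerous g s A R F X)
    (hY : MaxDangerous g s A R F Y) {t y : N} (htX : t ∈ X) (htY : t ∈ Y) (ht : 0 < g s t)
    (hyY : y ∈ Y) (hyX : y ∉ X) (hy : 0 < g s y) :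
    R X ≤ R (X \ Y) ∨ R Y ≤ R (Y \ X) := by
  by_contra! hbad
  obtain ⟨hatom, -⟩ := hX.tight_inter S hB hT hY htX htY ht hyY hyX hy
  obtain ⟨x, hxX, hxY, hx⟩ := hX.exists_mem_notMem hY hyY hyX hy
  -- `W` joins a neighbour in `X \ Y` to one in `Y \ X`. The atom `X ∩ W` contains `x ∉ Y`, so no
  -- node lies in all three sets, and each set is the union of its differences with the other two.
  -- As `X` and `Y` lose their requirement outside each other, they keep it outside `W`; and `W`
  -- keeps its own outside one of them, which `tight_inter` forbids.
  obtain ⟨W₀, hW₀F, hW₀, hxW₀, hyW₀⟩ := hB.dangerous x (hX.2.1.1 hxX) y (hY.2.1.1 hyY) (fun h => hyX (h ▸ hxX)) hx hy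
  obtain ⟨W, hW, hWW⟩ := exists_maxDangerous (s := s) hW₀F hW₀
  have hxW := hWW x hxW₀ hx
  have hyW := hWW y hyW₀ hy
  obtain ⟨hatomX, hgX⟩ := hX.tight_inter S hB hT hW hxX hxW hx hyW hyX hy
  obtain ⟨hatomY, hgY⟩ := hY.tight_inter S hB hT hW hyY hyW hy hxW hxY hx
  have hdX : Disjoint (X ∩ W) (X ∩ Y) := by
    refine (hatomX _ (hB.inter _ hX.1 _ hY.1)).resolve_left fun h => ?_
    exact hxY (Finset.mem_inter.1 (h (Finset.mem_inter.2 ⟨hxX, hxW⟩))).2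
  have hdis : ∀ w ∈ X, w ∈ Y → w ∉ W := fun w h1 h2 h3 =>
    Finset.disjoint_left.1 hdX (Finset.mem_inter.2 ⟨h1, h3⟩) (Finset.mem_inter.2 ⟨h1, h2⟩)
  have h1 := S.req_union (X \ Y) (X \ W)
  rw [show X \ Y ∪ X \ W = X by ext w; have := hdis w; simp; tauto] at h1
  have h2 := S.req_union (Y \ X) (Y \ W)
  rw [show Y \ X ∪ Y \ W = Y by ext w; have := hdis w; simp; tauto] at h2
  have h3 := S.req_union (W \ X) (W \ Y)
  rw [show W \ X ∪ W \ Y = W by ext w; have := hdis w; simp; tauto] at h3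
  simp only [le_max_iff] at h1 h2 h3
  omega

/-- Take three maximal dangerous sets around `t`, each new one containing a neighbour missed by the
earlier ones. Their pairwise intersections are atoms containing `t` and therefore coincide. For each
two sets exactly one keeps its requirement outside the common atom, which is impossible for three.
-/
theorem not_blocked_of_tightAtoms (hcard : ∃ u ∈ A, ∃ v ∈ A, u ≠ v ∧ 0 < g s u ∧ 0 < g s v) : False := by
  obtain ⟨t, htA, u, huA, htu, ht, hu⟩ := hcard
  have ex : ∀ v ∈ A, t ≠ v → 0 < g s v → ∃ X, MaxDangerous g s A R F X ∧ t ∈ X ∧ v ∈ X := by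
    intro v hvA htv hv
    obtain ⟨X₀, hX₀F, hX₀, htX₀, hvX₀⟩ := hB.dangerous t htA v hvA htv ht hv
    obtain ⟨X, hX, hXX⟩ := exists_maxDangerous (s := s) hX₀F hX₀
    exact ⟨X, hX, hXX t htX₀ ht, hXX v hvX₀ hv⟩
  obtain ⟨X, hX, htX, huX⟩ := ex u huA htu hu
  obtain ⟨v, hvA, hv, hvX, -⟩ := S.exists_notMem_union hX.2.1 hX.2.1 htX htX ht
  obtain ⟨Y, hY, htY, hvY⟩ := ex v hvA (fun h => hvX (h ▸ htX)) hv
  obtain ⟨w, hwA, hw, hwX, hwY⟩ := S.exists_notMem_union hX.2.1 hY.2.1 htX htY ht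
  obtain ⟨Z, hZ, htZ, hwZ⟩ := ex w hwA (fun h => hwX (h ▸ htX)) hw
  obtain ⟨aXY, gXY⟩ := hX.tight_inter S hB hT hY htX htY ht hvY hvX hv
  obtain ⟨aXZ, gXZ⟩ := hX.tight_inter S hB hT hZ htX htZ ht hwZ hwX hw
  obtain ⟨aYZ, gYZ⟩ := hY.tight_inter S hB hT hZ htY htZ ht hwZ hwY hw
  have bXY := hX.not_both_bad S hB hT hY htX htY ht hvY hvX hv
  have bXZ := hX.not_both_bad S hB hT hZ htX htZ ht hwZ hwX hw
  have bYZ := hY.not_both_bad S hB hT hZ htY htZ ht hwZ hwY hw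
  have atom : ∀ P Q U : Finset N, t ∈ P → t ∈ Q → t ∈ U → U ∈ F →
      (∀ Z ∈ F, P ∩ Q ⊆ Z ∨ Disjoint (P ∩ Q) Z) → ∀ a ∈ P, a ∈ Q → a ∈ U := by
    intro P Q U hP hQ hU hUF h a haP haQ
    rcases h U hUF with h | h
    · exact h (Finset.mem_inter.2 ⟨haP, haQ⟩)
    · exact absurd hU (Finset.disjoint_left.1 h (Finset.mem_inter.2 ⟨hP, hQ⟩))
  have k1 := atom X Y Z htX htY htZ hZ.1 aXY
  have k2 := atom X Z Y htX htZ htY hY.1 aXZ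
  have k3 := atom Y Z X htY htZ htX hX.1 aYZ
  have e1 : X \ Z = X \ Y := by
    ext a; simp only [Finset.mem_sdiff]
    exact ⟨fun h => ⟨h.1, fun h' => h.2 (k1 a h.1 h')⟩, fun h => ⟨h.1, fun h' => h.2 (k2 a h.1 h')⟩⟩
  have e2 : Y \ Z = Y \ X := by
    ext a; simp only [Finset.mem_sdiff]
    exact ⟨fun h => ⟨h.1, fun h' => h.2 (k1 a h' h.1)⟩, fun h => ⟨h.1, fun h' => h.2 (k3 a h.1 h')⟩⟩
  have e3 : Z \ Y = Z \ X := by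
    ext a; simp only [Finset.mem_sdiff]
    exact ⟨fun h => ⟨h.1, fun h' => h.2 (k2 a h' h.1)⟩, fun h => ⟨h.1, fun h' => h.2 (k3 a h' h.1)⟩⟩
  rw [e1] at gXZ bXZ
  rw [e2, e3] at gYZ bYZ
  omega

end Core

/-- Induction on the family. If a tight member `P` is not an atom, only the members containing `P`
or disjoint from it are kept. They still form a Boolean algebra, and uncrossing with `P` turns every
lost dangerous set into a kept one that contains the same two neighbours. -/
theorem Setting.not_blocked {g : N → N → ℕ} {s : N} {A : Finset N} {R : Finset N → ℕ}
    (S : Setting g s A R) (hcard : ∃ u ∈ A, ∃ v ∈ A, u ≠ v ∧ 0 < g s u ∧ 0 < g s v)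
    (k : ℕ) (F : Finset (Finset N)) (hk : F.card ≤ k) : ¬ Blocked g s A R F := by
  classical
  induction k generalizing F with
  | zero =>
    intro hB
    obtain ⟨u, huA, v, hvA, huv, hu, hv⟩ := hcard
    obtain ⟨X, hX, -⟩ := hB.dangerous u huA v hvA huv hu hv
    exact absurd (Finset.card_pos.2 ⟨X, hX⟩) (by omega)
  | succ k ih =>
    intro hB
    by_cases hT : TightAtoms g A R F
    · exact not_blocked_of_tightAtoms S hB hT hcard
    simp only [TightAtoms, not_forall, not_or] at hT
    obtain ⟨P, hPF, hP, hPA, htight, Q, hQF, hPQ, hPQ'⟩ := hT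
    refine ih (F.filter fun X => P ⊆ X ∨ Disjoint P X) ?_ ⟨?_, ?_, ?_, ?_, ?_⟩
    · have : (F.filter fun X => P ⊆ X ∨ Disjoint P X).card < F.card :=
        Finset.card_lt_card (Finset.filter_ssubset.2 ⟨Q, hQF, by tauto⟩)
      omega
    · exact fun X hX => hB.subset X (Finset.mem_filter.1 hX).1
    · intro X hX Y hY
      rw [Finset.mem_filter] at hX hY ⊢
      refine ⟨hB.inter X hX.1 Y hY.1, ?_⟩
      rcases hX.2 with h | h
      · rcases hY.2 with h' | h'
        · exact Or.inl (Finset.subset_inter h h')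
        · exact Or.inr (h'.mono_right Finset.inter_subset_right)
      · exact Or.inr (h.mono_right Finset.inter_subset_left)
    · intro X hX Y hY
      rw [Finset.mem_filter] at hX hY ⊢
      refine ⟨hB.sdiff X hX.1 Y hY.1, ?_⟩
      rcases hX.2 with h | h
      · rcases hY.2 with h' | h'
        · exact Or.inr (Finset.disjoint_left.2 fun a ha ha' => (Finset.mem_sdiff.1 ha').2 (h' ha))
        · exact Or.inl fun a ha => Finset.mem_sdiff.2 ⟨h ha, Finset.disjoint_left.1 h' ha⟩
      · exact Or.inr (h.mono_right Finset.sdiff_subset)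
    · intro X hX Y hY
      rw [Finset.mem_filter] at hX hY ⊢
      refine ⟨hB.union X hX.1 Y hY.1, ?_⟩
      rcases hX.2 with h | h
      · exact Or.inl (h.trans Finset.subset_union_left)
      · rcases hY.2 with h' | h'
        · exact Or.inl (h'.trans Finset.subset_union_right)
        · exact Or.inr (Finset.disjoint_union_right.2 ⟨h, h'⟩)
    · intro u huA v hvA huv hu hv
      obtain ⟨X, hXF, hX, huX, hvX⟩ := hB.dangerous u huA v hvA huv hu hv
      by_cases hc : P ⊆ X ∨ Disjoint P X
      · exact ⟨X, Finset.mem_filter.2 ⟨hXF, hc⟩, hX, huX, hvX⟩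
      rw [not_or, Finset.not_disjoint_iff] at hc
      obtain ⟨hPX, c, hcP, hcX⟩ := hc
      have hP' := hB.subset P hPF
      have hX4 := hX.2.2.2
      obtain ⟨b, hbP, hbX⟩ := Finset.not_subset.1 hPX
      rcases S.req_skew hX.1 hP' with h | h
      · have h1 := cut_add_cut S.symm X P
        have h2 := S.le_cut (X ∩ P) (Finset.inter_subset_left.trans hX.1)
          ⟨c, Finset.mem_inter.2 ⟨hcX, hcP⟩⟩ (fun he => hPA (hP'.antisymm
            (he ▸ Finset.inter_subset_right)))
        refine ⟨X ∪ P, Finset.mem_filter.2 ⟨hB.union X hXF P hPF,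
          Or.inl Finset.subset_union_right⟩, ⟨Finset.union_subset hX.1 hP',
          ⟨u, Finset.mem_union_left _ huX⟩, ?_, by omega⟩, Finset.mem_union_left _ huX,
          Finset.mem_union_left _ hvX⟩
        -- If the union were `A`, it would have requirement 0 but a cut of at least 2, the even
        -- positive degree of `s`. The slack is only 1 because `P` is tight.
        intro he
        rw [he, S.cut_self] at h1
        rw [he, S.req_self] at h
        obtain ⟨j, hj⟩ := S.even
        have := S.pos
        omega
      · have h1 := cut_add_cut' S.symm X P
        have h2 := S.le_cut (P \ X) (Finset.sdiff_subset.trans hP')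
          ⟨b, Finset.mem_sdiff.2 ⟨hbP, hbX⟩⟩ (fun he => hPA (hP'.antisymm
            (he ▸ Finset.sdiff_subset)))
        have hs : s ∈ (X ∪ P)ᶜ := by
          rw [Finset.mem_compl, Finset.mem_union]
          rintro (h | h)
          · exact S.notMem (hX.1 h)
          · exact S.notMem (hP' h)
        have hne : X \ P ≠ A := fun he => hX.2.2.1 (hX.1.antisymm (he ▸ Finset.sdiff_subset))
        -- The slack of 1 is less than the 2 that an edge from `s` to `X ∩ P` would cost, so no
        -- neighbour is lost by removing `P`.
        have h0 : ∀ a ∈ X, 0 < g s a → a ∈ X \ P := by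
          intro a haX ha
          refine Finset.mem_sdiff.2 ⟨haX, fun haP => ?_⟩
          have h3 := le_between g (Finset.mem_inter.2 ⟨haX, haP⟩) hs
          rw [S.symm] at h3
          have h4 : R (X \ P) ≤ cut g (X \ P) := by
            by_cases hemp : (X \ P).Nonempty
            · exact S.le_cut _ (Finset.sdiff_subset.trans hX.1) hemp hne
            · rw [Finset.not_nonempty_iff_eq_empty.1 hemp]
              have := S.req_sdiff A subset_rfl
              rw [Finset.sdiff_self, S.req_self] at this
              omega
          omega
        exact ⟨X \ P, Finset.mem_filter.2 ⟨hB.sdiff X hXF P hPF,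
          Or.inr Finset.disjoint_sdiff⟩, ⟨Finset.sdiff_subset.trans hX.1, ⟨u, h0 u huX hu⟩, hne,
          by omega⟩, h0 u huX hu, h0 v hvX hv⟩

/-- **Mader's splitting theorem** for a node of even degree that is not incident with a cut edge:
some pair of edges is not covered by a dangerous set. -/
theorem Setting.exists_admissible {g : N → N → ℕ} {s : N} {A : Finset N} {R : Finset N → ℕ}
    (S : Setting g s A R) :
    ∃ u ∈ A, ∃ v ∈ A, 0 < g s u ∧ 0 < g s v ∧ (u = v → 2 ≤ g s u) ∧
      ∀ X, Dangerous g A R X → u ∈ X → v ∉ X := by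
  classical
  by_contra! h
  obtain ⟨t, htA, ht⟩ : ∃ t ∈ A, g s t ≠ 0 := by
    by_contra! h0
    exact absurd S.pos (by simp [degTo, Finset.sum_eq_zero h0])
  by_cases hcard : ∃ u ∈ A, ∃ v ∈ A, u ≠ v ∧ 0 < g s u ∧ 0 < g s v
  · obtain ⟨u, huA, v, hvA, huv, hu, hv⟩ := hcard
    refine S.not_blocked ⟨u, huA, v, hvA, huv, hu, hv⟩ _ A.powerset le_rfl
      ⟨fun X hX => Finset.mem_powerset.1 hX,
       fun X hX Y _ => Finset.mem_powerset.2
        (Finset.inter_subset_left.trans (Finset.mem_powerset.1 hX)),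
       fun X hX Y _ => Finset.mem_powerset.2
        (Finset.sdiff_subset.trans (Finset.mem_powerset.1 hX)),
       fun X hX Y hY => Finset.mem_powerset.2
        (Finset.union_subset (Finset.mem_powerset.1 hX) (Finset.mem_powerset.1 hY)),
       fun a haA b hbA hab ha hb => ?_⟩
    obtain ⟨X, hX, haX, hbX⟩ := h a haA b hbA ha hb (fun h => absurd h hab)
    exact ⟨X, Finset.mem_powerset.2 hX.1, hX, haX, hbX⟩
  -- With a single neighbour `t`, the pair consists of two copies of `st`; a dangerous set contains
  -- at most half of the edges at `s`, hence not `t`.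
  · push Not at hcard
    have hdeg : degTo g s A = g s t := by
      rw [degTo, Finset.sum_eq_single_of_mem t htA]
      intro b hb hbt
      have := hcard t htA b hb hbt.symm (Nat.pos_of_ne_zero ht)
      omega
    obtain ⟨k, hk⟩ := S.even
    obtain ⟨X, hX, htX, -⟩ := h t htA t htA (by omega) (by omega) (fun _ => by omega)
    have h1 := S.two_mul_degTo_le hX
    have h2 : g s t ≤ degTo g s X :=
      Finset.single_le_sum (f := fun y => g s y) (fun _ _ => Nat.zero_le _) htX
    omega

end SplittingOff

/-! ### Splitting off repeatedly until given nodes are isolated. -/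

namespace SplittingOff

variable {N : Type u} [Fintype N] [DecidableEq N]

/-- The adjacency matrix of a single edge. -/
def single (a b x y : N) : ℕ :=
  (if x = a ∧ y = b then 1 else 0) + (if x = b ∧ y = a then 1 else 0)

/-- Replace one copy of each of the edges `su` and `sv` by a copy of `uv`. -/
def splitOff (g : N → N → ℕ) (s u v : N) : N → N → ℕ :=
  fun x y => g x y + single u v x y - (single s u x y + single s v x y)

/-- The number of edges `ab` in the cut of `X`. -/
def sep (X : Finset N) (a b : N) : ℕ := if (a ∈ X ↔ b ∈ X) then 0 else 1

theorem cut_add (g h : N → N → ℕ) (X : Finset N) :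
    cut (fun x y => g x y + h x y) X = cut g X + cut h X := by
  simp only [cut, between, Finset.sum_add_distrib]

theorem cut_single (a b : N) (X : Finset N) : cut (single a b) X = sep X a b := by
  have h : ∀ c d : N, (∑ x ∈ X, ∑ y ∈ Xᶜ, if x = c ∧ y = d then 1 else 0)
      = if c ∈ X ∧ d ∉ X then 1 else 0 := by
    intro c d
    simp only [ite_and, Finset.sum_ite_eq', Finset.sum_ite_irrel, Finset.sum_const_zero,
      Finset.mem_compl]
  unfold single
  rw [cut_add, cut, cut, between, between, h, h, sep]
  by_cases ha : a ∈ X <;> by_cases hb : b ∈ X <;> simp [ha, hb]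

/-- The pair `su`, `sv` of edges can be split off. -/
structure Splittable (g : N → N → ℕ) (s u v : N) : Prop where
  ne_left : u ≠ s
  ne_right : v ≠ s
  pos_left : 0 < g s u
  pos_right : 0 < g s v
  two_le : u = v → 2 ≤ g s u

/-- `Splittable` makes the truncated subtraction exact; for `u = v` two units are taken from `su`.
The loop created in that case is on the diagonal, which no cut sees. -/
theorem splitOff_add {g : N → N → ℕ} (hg : ∀ x y, g x y = g y x) {s u v : N}
    (h : Splittable g s u v) (x y : N) :
    splitOff g s u v x y + (single s u x y + single s v x y) = g x y + single u v x y := by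
  obtain ⟨h1, h2, h3, h4, h5⟩ := h
  refine Nat.sub_add_cancel ?_
  have h3' := hg s u
  have h4' := hg s v
  unfold single
  grind

theorem splitOff_symm {g : N → N → ℕ} (hg : ∀ x y, g x y = g y x) (s u v x y : N) :
    splitOff g s u v x y = splitOff g s u v y x := by
  have h : ∀ a b : N, single a b x y = single a b y x := by
    intro a b
    unfold single
    rw [add_comm]
    congr 1 <;> simp [and_comm]
  simp only [splitOff, hg x y, h]

theorem cut_splitOff {g : N → N → ℕ} (hg : ∀ x y, g x y = g y x) {s u v : N}
    (h : Splittable g s u v) (X : Finset N) :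
    cut (splitOff g s u v) X + (sep X s u + sep X s v) = cut g X + sep X u v := by
  rw [← cut_single, ← cut_single, ← cut_single, ← cut_add, ← cut_add, ← cut_add]
  congr 1
  funext x y
  exact splitOff_add hg h x y

theorem cut_splitOff_self {g : N → N → ℕ} (hg : ∀ x y, g x y = g y x) {s u v : N}
    (h : Splittable g s u v) : cut (splitOff g s u v) {s} + 2 = cut g {s} := by
  have := cut_splitOff hg h {s}
  simpa [sep, h.ne_left, h.ne_right] using this

/-- Every cut that separates two nodes of `A` has at least the required capacity. -/
def Feasible (q : N → N → ℕ) (A : Finset N) (g : N → N → ℕ) : Prop :=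
  ∀ x ∈ A, ∀ y ∈ A, x ≠ y → ∀ X : Finset N, x ∈ X → y ∉ X → q x y ≤ cut g X

/-- `g` has been obtained from `g₀` by splitting off, so that the nodes in `W` are isolated and
the requirement between the nodes in `A` is satisfied. -/
structure Reduction (g₀ q : N → N → ℕ) (W A : Finset N) (g : N → N → ℕ) : Prop where
  symm : ∀ x y, g x y = g y x
  zero : ∀ x ∈ W, ∀ y, y ≠ x → g x y = 0
  le : ∀ X, cut g X ≤ cut g₀ X
  parity : ∀ X, Even (cut g X) ↔ Even (cut g₀ X)
  feasible : Feasible q A g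

/-- The requirement of a set: the largest requirement between nodes of `A` that it separates. -/
def reqOf (q : N → N → ℕ) (A X : Finset N) : ℕ :=
  ((A ∩ X) ×ˢ (A \ X)).sup fun p => q p.1 p.2

theorem reqOf_le_iff {q : N → N → ℕ} {A X : Finset N} {k : ℕ} :
    reqOf q A X ≤ k ↔ ∀ x ∈ A, x ∈ X → ∀ y ∈ A, y ∉ X → q x y ≤ k := by
  simp only [reqOf, Finset.sup_le_iff, Finset.mem_product, Finset.mem_inter, Finset.mem_sdiff,
    Prod.forall]
  exact ⟨fun h x hx hx' y hy hy' => h x y ⟨⟨hx, hx'⟩, hy, hy'⟩,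
    fun h x y hxy => h x hxy.1.1 hxy.1.2 y hxy.2.1 hxy.2.2⟩

theorem le_reqOf {q : N → N → ℕ} {A X : Finset N} {x y : N} (hxA : x ∈ A) (hx : x ∈ X)
    (hyA : y ∈ A) (hy : y ∉ X) : q x y ≤ reqOf q A X :=
  reqOf_le_iff.1 le_rfl x hxA hx y hyA hy

/-- The nodes of `X` outside `A` belong to `W` and have no edges. -/
theorem cut_inter_eq {g : N → N → ℕ} (hg : ∀ x y, g x y = g y x) {W A X : Finset N} {s : N}
    (hz : ∀ x ∈ W, ∀ y, y ≠ x → g x y = 0) (hA : A = (insert s W)ᶜ) (hs : s ∉ X) :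
    cut g (X ∩ A) = cut g X := by
  simp only [cut, between_eq_ite]
  refine Finset.sum_congr rfl fun x _ => Finset.sum_congr rfl fun y _ => ?_
  have hA' : ∀ w, w ∈ X → w ∉ A → w ∈ W := by
    intro w hw hwA
    rw [hA, Finset.mem_compl, not_not, Finset.mem_insert] at hwA
    exact hwA.resolve_left fun h => hs (h ▸ hw)
  simp only [Finset.mem_inter, Finset.mem_compl]
  by_cases hxX : x ∈ X
  · by_cases hxA : x ∈ A
    · by_cases hyX : y ∈ X
      · by_cases hyA : y ∈ A
        · simp [hyX, hyA]
        · have hxy : x ≠ y := fun h => hyA (h ▸ hxA)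
          have := hz y (hA' y hyX hyA) x hxy
          rw [hg] at this
          simp [this]
      · simp [hxX, hxA, hyX]
    · by_cases hyX : y ∈ X
      · simp [hxA, hyX]
      · have hxy : y ≠ x := fun h => hyX (h ▸ hxX)
        simp [hxA, hz x (hA' x hxX hxA) y hxy]
  · simp [hxX]

namespace Reduction

variable {g₀ q : N → N → ℕ} {W A : Finset N} {g : N → N → ℕ}

/-- `sep X` satisfies the triangle inequality with a gap of 0 or 2, so cuts do not increase and keep
their parity. -/
theorem splitOff (h : Reduction g₀ q W A g) {s u v : N} (hs : s ∉ W) (hu : u ∉ W) (hv : v ∉ W)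
    (hsp : Splittable g s u v) (hf : Feasible q A (splitOff g s u v)) :
    Reduction g₀ q W A (SplittingOff.splitOff g s u v) where
  symm := splitOff_symm h.symm s u v
  zero x hx y hy := by
    have h1 : x ≠ s := fun h => hs (h ▸ hx)
    have h2 : x ≠ u := fun h => hu (h ▸ hx)
    have h3 : x ≠ v := fun h => hv (h ▸ hx)
    simp [SplittingOff.splitOff, single, h.zero x hx y hy, h1, h2, h3]
  le X := by
    have h1 := cut_splitOff h.symm hsp X
    have h2 := h.le X
    have h3 : sep X u v ≤ sep X s u + sep X s v := by
      unfold sep; split_ifs <;> first | omega | (exfalso; tauto)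
    omega
  parity X := by
    have h1 := cut_splitOff h.symm hsp X
    rw [← h.parity X]
    have h3 : sep X s u + sep X s v = sep X u v ∨ sep X s u + sep X s v = sep X u v + 2 := by
      unfold sep; split_ifs <;> first | omega | (exfalso; tauto)
    have h4 : cut g X = cut (SplittingOff.splitOff g s u v) X ∨
        cut g X = cut (SplittingOff.splitOff g s u v) X + 2 := by omega
    rcases h4 with h4 | h4 <;> rw [h4]
    simp [Nat.even_add]
  feasible := hf

theorem cut_singleton_eq (h : Reduction g₀ q W A g) {s : N} (hA : A = (insert s W)ᶜ) : cut g {s} = degTo g s A := by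
  rw [cut, between, Finset.sum_singleton, degTo]
  symm
  refine Finset.sum_subset (fun y hy => ?_) fun y hy hy' => ?_
  · rw [hA] at hy
    simp only [Finset.mem_compl, Finset.mem_insert, Finset.mem_singleton] at hy ⊢
    tauto
  · rw [hA] at hy'
    simp only [Finset.mem_compl, Finset.mem_insert, Finset.mem_singleton, not_not] at hy hy'
    rw [h.symm, h.zero y (hy'.resolve_left hy) s (Ne.symm hy)]

/-- Cuts of capacity one are excluded either because all requirements are at least 2 or because all
cuts are even. The first case serves the min-max formula and the last round of the algorithm, the
second the rounds for single levels. -/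
theorem setting (h : Reduction g₀ q W A g) {s : N} (hA : A = (insert s W)ᶜ)
    (hq : ∀ x y, q x y = q y x)
    (hcut : (∀ x y, x ≠ y → 2 ≤ q x y) ∨ ∀ X, Even (cut g₀ X))
    (heven : Even (cut g₀ {s})) (hpos : 0 < cut g {s}) : Setting g s A (reqOf q A) where
  symm := h.symm
  notMem := by simp [hA]
  zero x hx hxs := h.zero x (by
    rw [hA, Finset.mem_compl, not_not, Finset.mem_insert] at hx
    exact hx.resolve_left hxs)
  req_sdiff X hX := by
    refine le_antisymm (reqOf_le_iff.2 fun x hx hx' y hy hy' => ?_)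
      (reqOf_le_iff.2 fun x hx hx' y hy hy' => ?_)
    · rw [hq]
      rw [Finset.mem_sdiff] at hx' hy'
      exact le_reqOf hy (by_contra fun h => hy' ⟨hy, h⟩) hx hx'.2
    · rw [hq]
      exact le_reqOf hy (Finset.mem_sdiff.2 ⟨hy, hy'⟩) hx (fun h => (Finset.mem_sdiff.1 h).2 hx')
  req_union P Q := by
    refine reqOf_le_iff.2 fun x hx hx' y hy hy' => ?_
    rw [Finset.mem_union, not_or] at hy'
    rcases Finset.mem_union.1 hx' with h | h
    · exact (le_reqOf hx h hy hy'.1).trans (le_max_left _ _)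
    · exact (le_reqOf hx h hy hy'.2).trans (le_max_right _ _)
  req_self := Nat.le_zero.1 (reqOf_le_iff.2 fun x _ _ y hy hy' => absurd hy hy')
  le_cut X _ _ _ := reqOf_le_iff.2 fun x hx hx' y hy hy' =>
    h.feasible x hx y hy (fun h => hy' (h ▸ hx')) X hx' hy'
  even := by rw [← h.cut_singleton_eq hA, h.parity]; exact heven
  pos := by rwa [← h.cut_singleton_eq hA]
  two_le_cut X hX hdeg := by
    have h0 : degTo g s X ≤ cut g X := by
      rw [← between_singleton_right h.symm, cut]
      refine between_mono g subset_rfl ?_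
      rw [Finset.singleton_subset_iff, Finset.mem_compl]
      intro hsX
      have := hX hsX
      rw [hA] at this
      simp at this
    have two : Even (cut g X) → 2 ≤ cut g X := by
      rintro ⟨k, hk⟩; omega
    rcases hcut with hcut | hcut
    -- No requirement applies to `A` itself, but its cut is at least the degree of `s`, which is
    -- even and positive.
    · by_cases hXA : X = A
      · have h1 : Even (degTo g s A) := by
          rw [← h.cut_singleton_eq hA, h.parity]; exact heven
        subst hXA
        obtain ⟨k, hk⟩ := h1
        omega
      · obtain ⟨x, hx⟩ : X.Nonempty := by
          rw [Finset.nonempty_iff_ne_empty]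
          rintro rfl
          simp [degTo] at hdeg
        obtain ⟨y, hy, hyX⟩ := Finset.not_subset.1 fun h' => hXA (hX.antisymm h')
        have hxy : x ≠ y := fun h => hyX (h ▸ hx)
        exact (hcut x y hxy).trans (h.feasible x (hX hx) y hy hxy X hx hyX)
    · exact two ((h.parity X).2 (hcut X))

/-- Among the sets without `s`, only those containing both `u` and `v` lose capacity, namely 2. They
are not dangerous, so they can afford it. Sets with `s` are replaced by their complements. -/
theorem exists_splitOff (h : Reduction g₀ q W A g) {s : N} (hA : A = (insert s W)ᶜ)
    (hq : ∀ x y, q x y = q y x)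
    (hcut : (∀ x y, x ≠ y → 2 ≤ q x y) ∨ ∀ X, Even (cut g₀ X))
    (heven : Even (cut g₀ {s})) (hpos : 0 < cut g {s}) :
    ∃ u ∈ A, ∃ v ∈ A, Splittable g s u v ∧ Feasible q A (SplittingOff.splitOff g s u v) := by
  obtain ⟨u, hu, v, hv, hgu, hgv, huv, hadm⟩ :=
    (h.setting hA hq hcut heven hpos).exists_admissible
  have hne : ∀ w ∈ A, w ≠ s := by
    rintro w hw rfl
    rw [hA] at hw
    simp at hw
  have hsp : Splittable g s u v := ⟨hne u hu, hne v hv, hgu, hgv, huv⟩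
  refine ⟨u, hu, v, hv, hsp, ?_⟩
  have key : ∀ x ∈ A, ∀ y ∈ A, ∀ X : Finset N, s ∉ X → x ∈ X → y ∉ X →
      q x y ≤ cut (SplittingOff.splitOff g s u v) X := by
    intro x hx y hy X hsX hxX hyX
    have hxy : x ≠ y := fun h => hyX (h ▸ hxX)
    have h1 := cut_splitOff h.symm hsp X
    by_cases huX : u ∈ X
    · by_cases hvX : v ∈ X
      · have h2 : ¬ Dangerous g A (reqOf q A) (X ∩ A) := fun hd =>
          hadm _ hd (Finset.mem_inter.2 ⟨huX, hu⟩) (Finset.mem_inter.2 ⟨hvX, hv⟩)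
        have h3 : reqOf q A (X ∩ A) + 2 ≤ cut g (X ∩ A) := by
          by_contra hlt
          exact h2 ⟨Finset.inter_subset_right, ⟨x, Finset.mem_inter.2 ⟨hxX, hx⟩⟩,
            fun he => hyX (Finset.mem_inter.1 (he ▸ hy)).1, by omega⟩
        have h4 : q x y ≤ reqOf q A (X ∩ A) :=
          le_reqOf hx (Finset.mem_inter.2 ⟨hxX, hx⟩) hy fun h => hyX (Finset.mem_inter.1 h).1
        rw [cut_inter_eq h.symm h.zero hA hsX] at h3
        simp only [sep, huX, hvX, hsX] at h1
        simp at h1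
        omega
      · have h5 := h.feasible x hx y hy hxy X hxX hyX
        simp only [sep, huX, hvX, hsX] at h1
        simp at h1
        omega
    · have h5 := h.feasible x hx y hy hxy X hxX hyX
      by_cases hvX : v ∈ X <;> simp only [sep, huX, hvX, hsX] at h1 <;> simp at h1 <;> omega
  intro x hx y hy _ X hxX hyX
  by_cases hsX : s ∈ X
  · rw [← cut_compl (splitOff_symm h.symm s u v), hq]
    exact key y hy x hx Xᶜ (by simpa using hsX) (by simpa using hyX) (by simpa using hxX)
  · exact key x hx y hy X hsX hxX hyX

theorem isolate (h : Reduction g₀ q W A g) {s : N} (h0 : cut g {s} = 0) :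
    Reduction g₀ q (insert s W) A g where
  symm := h.symm
  zero x hx y hy := by
    rcases Finset.mem_insert.1 hx with rfl | hx
    · rw [cut, between, Finset.sum_singleton, Finset.sum_eq_zero_iff] at h0
      exact h0 y (by simpa using hy)
    · exact h.zero x hx y hy
  le := h.le
  parity := h.parity
  feasible := h.feasible

theorem mono (h : Reduction g₀ q W A g) {A' : Finset N} (hA : A' ⊆ A) : Reduction g₀ q W A' g where
  symm := h.symm
  zero := h.zero
  le := h.le
  parity := h.parity
  feasible x hx y hy := h.feasible x (hA hx) y (hA hy)

end Reduction

theorem exists_reduction_isolating {g₀ q : N → N → ℕ} {W : Finset N} {s : N}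
    (hs : s ∉ W) (hq : ∀ x y, q x y = q y x)
    (hcut : (∀ x y, x ≠ y → 2 ≤ q x y) ∨ ∀ X, Even (cut g₀ X)) (heven : Even (cut g₀ {s}))
    (k : ℕ) (g : N → N → ℕ) (hk : cut g {s} ≤ k) (h : Reduction g₀ q W (insert s W)ᶜ g) :
    ∃ g', Reduction g₀ q (insert s W) (insert s W)ᶜ g' := by
  induction k generalizing g with
  | zero => exact ⟨g, h.isolate (Nat.le_zero.1 hk)⟩
  | succ k ih =>
    rcases Nat.eq_zero_or_pos (cut g {s}) with h0 | hpos
    · exact ⟨g, h.isolate h0⟩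
    obtain ⟨u, hu, v, hv, hsp, hf⟩ := h.exists_splitOff rfl hq hcut heven hpos
    have h1 := cut_splitOff_self h.symm hsp
    have hW : ∀ w ∈ (insert s W)ᶜ, w ∉ W := fun w hw hwW =>
      Finset.mem_compl.1 hw (Finset.mem_insert_of_mem hwW)
    exact ih _ (by omega) (h.splitOff hs (hW u hu) (hW v hv) hsp hf)

/-- All nodes of a set can be split off completely. -/
theorem exists_reduction {g₀ q : N → N → ℕ} (hg : ∀ x y, g₀ x y = g₀ y x)
    (hq : ∀ x y, q x y = q y x)
    (hcut : (∀ x y, x ≠ y → 2 ≤ q x y) ∨ ∀ X, Even (cut g₀ X))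
    (hf : Feasible q Finset.univ g₀) (W : Finset N) (heven : ∀ s ∈ W, Even (cut g₀ {s})) :
    ∃ g, Reduction g₀ q W Wᶜ g := by
  induction W using Finset.induction_on with
  | empty =>
    exact ⟨g₀, hg, fun x hx => absurd hx (Finset.notMem_empty x), fun _ => le_rfl,
      fun _ => Iff.rfl, by simpa using hf⟩
  | insert s W hs ih =>
    obtain ⟨g, h⟩ := ih fun w hw => heven w (Finset.mem_insert_of_mem hw)
    exact exists_reduction_isolating hs hq hcut (heven s (Finset.mem_insert_self s W)) _ g le_rfl
      (h.mono (Finset.compl_subset_compl.2 (Finset.subset_insert s W)))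

end SplittingOff

/-! ### Fundamental cuts of a tree, path parities and joins. -/

namespace TreeCut

open SplittingOff

variable {N : Type u} [Fintype N] [DecidableEq N] {T : SimpleGraph N}

/-- The nodes that are reachable from `v` without using the edge `e`. -/
noncomputable def side (T : SimpleGraph N) (v : N) (e : Sym2 N) : Finset N :=
  (Set.toFinite {x | (T.deleteEdges {e}).Reachable v x}).toFinset

theorem mem_side {v x : N} {e : Sym2 N} :
    x ∈ side T v e ↔ (T.deleteEdges {e}).Reachable v x := by
  simp [side]

/-- Deleting `e` cannot separate the ends of another edge. Conversely `e` is a bridge, and a path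
from `v` leaving the side of `v` can do so only through `e`, so exactly one end is on that side. -/
theorem side_adj (hT : T.IsTree) {x y : N} (h : T.Adj x y) (v : N) (e : Sym2 N) :
    (x ∈ side T v e ↔ y ∈ side T v e) ↔ e ≠ s(x, y) := by
  simp only [mem_side]
  constructor
  · rintro hiff rfl
    have hb : ¬ (T.deleteEdges {s(x, y)}).Reachable x y :=
      SimpleGraph.isBridge_iff.1 (SimpleGraph.isAcyclic_iff_forall_adj_isBridge.1 hT.isAcyclic h)
    by_cases hx : (T.deleteEdges {s(x, y)}).Reachable v x
    · exact hb (hx.symm.trans (hiff.1 hx))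
    · obtain ⟨p⟩ := hT.connected.preconnected v x
      obtain ⟨d, -, hd1, hd2⟩ := p.exists_boundary_dart
        {z | (T.deleteEdges {s(x, y)}).Reachable v z} (SimpleGraph.Reachable.refl v) hx
      have he : s(d.fst, d.snd) = s(x, y) := by
        by_contra hne
        refine hd2 (SimpleGraph.Reachable.trans hd1 (SimpleGraph.Adj.reachable ?_))
        rw [SimpleGraph.deleteEdges_adj]
        exact ⟨d.adj, by simpa using hne⟩
      rcases Sym2.eq_iff.1 he with ⟨h1, -⟩ | ⟨h1, -⟩
      · exact hx (h1 ▸ hd1)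
      · exact hx (hiff.2 (h1 ▸ hd1))
  · intro hne
    have hadj : (T.deleteEdges {e}).Adj x y := by
      rw [SimpleGraph.deleteEdges_adj]
      exact ⟨h, by simpa using Ne.symm hne⟩
    exact ⟨fun h => h.trans hadj.reachable, fun h => h.trans hadj.symm.reachable⟩

/-- Along a trail the side changes exactly when `e` is traversed, which happens at most once. -/
theorem mem_edges_iff (hT : T.IsTree) (v : N) (e : Sym2 N) {i j : N} (p : T.Walk i j)
    (hp : p.IsTrail) : e ∈ p.edges ↔ ¬ (i ∈ side T v e ↔ j ∈ side T v e) := by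
  induction p with
  | nil => simp
  | @cons a b c hab p ih =>
    rw [SimpleGraph.Walk.isTrail_cons] at hp
    have h1 := ih hp.1
    have h2 := side_adj hT hab v e
    rw [SimpleGraph.Walk.edges_cons, List.mem_cons]
    by_cases he : e = s(a, b)
    · have h3 : e ∉ p.edges := he ▸ hp.2
      tauto
    · tauto

theorem sep_side_eq_one_iff (hT : T.IsTree) (v : N) (e : Sym2 N) {i j : N} (p : T.Walk i j)
    (hp : p.IsTrail) : sep (side T v e) i j = 1 ↔ e ∈ p.edges := by
  rw [mem_edges_iff hT v e p hp, sep]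
  split_ifs with h <;> simp [h]

theorem sep_eq_ite (hT : T.IsTree) (v : N) (e : Sym2 N) {i j : N} (p : T.Walk i j)
    (hp : p.IsTrail) : sep (side T v e) i j = if e ∈ p.edges then 1 else 0 := by
  have h := sep_side_eq_one_iff hT v e p hp
  split_ifs with h'
  · exact h.2 h'
  · have h1 : sep (side T v e) i j ≤ 1 := by unfold sep; split_ifs <;> omega
    have h2 := mt h.1 h'
    omega

theorem mem_edgesOf {e : Sym2 N} : e ∈ edgesOf T ↔ e ∈ T.edgeSet := by
  simp [edgesOf]

theorem mem_cutEdges {W : Type u} [Finite W] {G : SimpleGraph W} {X : Set W} {x y : W} :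
    s(x, y) ∈ cutEdges G X ↔ G.Adj x y ∧ ¬ (x ∈ X ↔ y ∈ X) := by
  rw [cutEdges, Set.Finite.mem_toFinset, Set.mem_ofPred_eq, SimpleGraph.mem_edgeSet]
  refine and_congr_right fun _ => ⟨?_, fun h => ?_⟩
  · rintro ⟨a, ha, b, hb, he⟩
    rcases Sym2.eq_iff.1 he with ⟨rfl, rfl⟩ | ⟨rfl, rfl⟩ <;> tauto
  · by_cases hx : x ∈ X
    · exact ⟨x, hx, y, by tauto, rfl⟩
    · exact ⟨y, by tauto, x, hx, Sym2.eq_swap⟩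

theorem mem_cutEdges_singleton {e : Sym2 N} {w : N} :
    e ∈ cutEdges T {w} ↔ e ∈ T.edgeSet ∧ w ∈ e := by
  induction e with | h x y
  rw [mem_cutEdges, SimpleGraph.mem_edgeSet, Sym2.mem_iff]
  refine and_congr_right fun h => ?_
  have := h.ne
  simp only [Set.mem_singleton_iff]
  constructor
  · intro h'
    by_contra h''
    exact h' ⟨fun h => absurd h.symm (fun h => h'' (Or.inl h)),
      fun h => absurd h.symm (fun h => h'' (Or.inr h))⟩
  · rintro (rfl | rfl) h'
    · exact this (h'.1 rfl).symm
    · exact this (h'.2 rfl)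

open Classical in
/-- The capacity matrix of a tree with edge capacities `c`. -/
noncomputable def treeCap (T : SimpleGraph N) (c : Sym2 N → ℕ) (x y : N) : ℕ :=
  if T.Adj x y then c s(x, y) else 0

theorem treeCap_symm (c : Sym2 N → ℕ) (x y : N) : treeCap T c x y = treeCap T c y x := by
  by_cases h : T.Adj x y
  · rw [treeCap, treeCap, if_pos h, if_pos h.symm, Sym2.eq_swap]
  · rw [treeCap, treeCap, if_neg h, if_neg fun h' => h h'.symm]

/-- By `side_adj`, `e` is the only tree edge that leaves the side. -/
theorem cut_treeCap_side (hT : T.IsTree) (v : N) (c : Sym2 N → ℕ) {e : Sym2 N}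
    (he : e ∈ T.edgeSet) : cut (treeCap T c) (side T v e) = c e := by
  have key : ∀ a b : N, e = s(a, b) → a ∈ side T v e → b ∉ side T v e →
      cut (treeCap T c) (side T v e) = c e := by
    intro a b hab ha hb
    rw [hab, SimpleGraph.mem_edgeSet] at he
    have h0 : ∀ x ∈ side T v e, ∀ y ∉ side T v e, T.Adj x y → x = a ∧ y = b := by
      intro x hx y hy hxy
      have h1 := (side_adj hT hxy v e).not.1 (by tauto)
      rw [not_not, hab] at h1
      rcases Sym2.eq_iff.1 h1 with ⟨rfl, rfl⟩ | ⟨rfl, rfl⟩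
      · exact ⟨rfl, rfl⟩
      · exact absurd hx hb
    rw [cut, between, Finset.sum_eq_single_of_mem a ha, Finset.sum_eq_single_of_mem b (by simpa)]
    · rw [treeCap, if_pos he, hab]
    · intro y hy hyb
      rw [treeCap, if_neg fun h => hyb (h0 a ha y (by simpa using hy) h).2]
    · intro x hx hxa
      refine Finset.sum_eq_zero fun y hy => ?_
      rw [treeCap, if_neg fun h => hxa (h0 x hx y (by simpa using hy) h).1]
  induction e with | h a b
  have h1 := (side_adj hT ((SimpleGraph.mem_edgeSet T).1 he) v s(a, b)).not.2 (by simp)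
  by_cases ha : a ∈ side T v s(a, b)
  · exact key a b rfl ha (by tauto)
  · exact key b a Sym2.eq_swap (by tauto) ha

theorem cut_treeCap_singleton (c : Sym2 N → ℕ) (w : N) :
    cut (treeCap T c) {w} = ∑ e ∈ cutEdges T {w}, c e := by
  classical
  have h : cutEdges T {w} = (Finset.univ.filter fun y => T.Adj w y).image fun y => s(w, y) := by
    ext e
    rw [mem_cutEdges_singleton, Finset.mem_image]
    constructor
    · rintro ⟨he, hw⟩
      obtain ⟨y, rfl⟩ := hw
      exact ⟨y, by simpa using he, rfl⟩
    · rintro ⟨y, hy, rfl⟩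
      exact ⟨by simpa using hy, Sym2.mem_mk_left w y⟩
  rw [h, Finset.sum_image (fun a _ b _ hab => Sym2.congr_right.1 hab), Finset.sum_filter, cut,
    between, Finset.sum_singleton]
  refine Finset.sum_subset (Finset.subset_univ _) fun y _ hy => ?_
  have : y = w := by simpa using hy
  simp [this, treeCap]

/-- A requirement that is dominated by the capacities along the paths of the tree is feasible. -/
theorem feasible_treeCap (hT : T.IsTree) (v : N) (c : Sym2 N → ℕ) {q : N → N → ℕ}
    (hq : ∀ e ∈ T.edgeSet, ∀ x y, ¬ (x ∈ side T v e ↔ y ∈ side T v e) → q x y ≤ c e) :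
    Feasible q Finset.univ (treeCap T c) := by
  intro x _ y _ _ X hx hy
  obtain ⟨p, hp⟩ := (hT.connected.preconnected x y).exists_isPath
  obtain ⟨d, hd, hd1, hd2⟩ := p.exists_boundary_dart (X : Set N) hx hy
  have hdp : d.edge ∈ p.edges := List.mem_map_of_mem hd
  have h1 := hq d.edge d.edge_mem x y ((mem_edges_iff hT v _ p hp.isTrail).1 hdp)
  have h2 : c d.edge = treeCap T c d.fst d.snd := by
    rw [treeCap, if_pos d.adj]; rfl
  rw [h2] at h1
  exact h1.trans (le_between _ hd1 (by simpa using hd2))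

/-- The sum is the number of edges at `x` on the path from `i` to `j`, which is odd only at the ends
of a nontrivial path. -/
theorem even_sum_sep_iff (hT : T.IsTree) (v i j x : N) :
    Even (∑ e ∈ cutEdges T {x}, sep (side T v e) i j) ↔ (i ≠ j → x ≠ i ∧ x ≠ j) := by
  classical
  obtain ⟨p, hp⟩ := (hT.connected.preconnected i j).exists_isPath
  rw [← hp.isTrail.even_countP_edges_iff x]
  have h : ∑ e ∈ cutEdges T {x}, sep (side T v e) i j = p.edges.countP fun e => x ∈ e := by
    have h1 : p.edges.countP (fun e => x ∈ e) = (p.edges.toFinset.filter fun e => x ∈ e).card := by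
      rw [List.countP_eq_length_filter,
        ← List.toFinset_card_of_nodup (hp.isTrail.edges_nodup.filter _), List.toFinset_filter]
      simp
    rw [h1, Finset.card_eq_sum_ones, Finset.sum_congr rfl fun e _ => sep_eq_ite hT v e p hp.isTrail,
      ← Finset.sum_filter]
    refine Finset.sum_congr ?_ fun _ _ => rfl
    ext e
    simp only [Finset.mem_filter, mem_cutEdges_singleton, List.mem_toFinset]
    have := p.edges_subset_edgeSet (e := e)
    tauto
  rw [h]

theorem exists_edge_sep (hT : T.IsTree) (v : N) {i j : N} (hij : i ≠ j) :
    ∃ e ∈ T.edgeSet, ¬ (i ∈ side T v e ↔ j ∈ side T v e) := by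
  obtain ⟨p, hp⟩ := (hT.connected.preconnected i j).exists_isPath
  cases p with
  | nil => exact absurd rfl hij
  | cons h p =>
    exact ⟨_, (SimpleGraph.mem_edgeSet T).2 h, (mem_edges_iff hT v _ _ hp.isTrail).1 (by simp)⟩

theorem sum_edges_eq (hT : T.IsTree) (v : N) (l : Sym2 N → ℝ) {i j : N} (p : T.Walk i j)
    (hp : p.IsPath) :
    (p.edges.map l).sum = ∑ e ∈ edgesOf T, l e * (sep (side T v e) i j : ℝ) := by
  classical
  rw [← List.sum_toFinset _ hp.isTrail.edges_nodup]
  simp only [sep_eq_ite hT v _ p hp.isTrail, Nat.cast_ite, Nat.cast_one, Nat.cast_zero, mul_ite,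
    mul_one, mul_zero]
  rw [← Finset.sum_filter]
  refine Finset.sum_congr ?_ fun _ _ => rfl
  ext e
  simp only [Finset.mem_filter, mem_edgesOf, List.mem_toFinset]
  have := p.edges_subset_edgeSet (e := e)
  tauto

/-- The set of edges for which an odd number of nodes of `Y` is beyond the edge. -/
theorem even_sum_card_iff (hT : T.IsTree) (v x : N) (Y : Finset N) (hY : Even Y.card) :
    Even (∑ e ∈ cutEdges T {x}, ∑ y ∈ Y, sep (side T v e) v y) ↔ x ∉ Y := by
  rw [Finset.sum_comm]
  -- The path from `v` to `y` has odd degree at its two ends, which cancel for `y = v`. Summed over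
  -- the even set `Y`, the contributions of the end `v` cancel as well.
  have h : ∀ y, (∑ e ∈ cutEdges T {x}, sep (side T v e) v y)
      ≡ (if x = v then 1 else 0) + (if y = x then 1 else 0) [MOD 2] := by
    intro y
    have h1 := even_sum_sep_iff hT v v y x
    rw [Nat.even_iff] at h1
    unfold Nat.ModEq
    by_cases hxv : x = v <;> by_cases hxy : y = x
    · subst hxv; subst hxy; simp at h1; simp [h1]
    · subst hxv
      simp [hxy, Ne.symm hxy] at h1 ⊢
      omega
    · subst hxy
      simp [hxv, Ne.symm hxv] at h1 ⊢
      omega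
    · simp [hxv, hxy, Ne.symm hxy] at h1 ⊢
      omega
  have h2 : (∑ y ∈ Y, ∑ e ∈ cutEdges T {x}, sep (side T v e) v y)
      ≡ (if x ∈ Y then 1 else 0) [MOD 2] := by
    refine (Nat.ModEq.sum fun y _ => h y).trans ?_
    rw [Finset.sum_add_distrib, Finset.sum_ite_eq', Finset.sum_const, smul_eq_mul]
    obtain ⟨k, hk⟩ := hY
    unfold Nat.ModEq
    split_ifs <;> omega
  rw [Nat.even_iff]
  unfold Nat.ModEq at h2
  rw [h2]
  split_ifs with h3 <;> simp [h3]

/-- In a set of edges with odd degree exactly at the nodes of `Y`, each node of `Y` is joined to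
another one by a path. -/
theorem exists_path_in_join (hT : T.IsTree) (v u : N) (Y : Finset N) (hY : Even Y.card)
    (hu : u ∈ Y) : ∃ t ∈ Y, t ≠ u ∧ ∀ e ∈ T.edgeSet, ¬ (u ∈ side T v e ↔ t ∈ side T v e) →
      Odd (∑ y ∈ Y, sep (side T v e) v y) := by
  classical
  -- `D` is the join, `H` its graph and `K` the edges of the component of `u` in `H`. In `K` the odd
  -- nodes are exactly the nodes of `Y` in that component, so the handshake lemma yields a second
  -- one.
  let D : Set (Sym2 N) := {e | e ∈ T.edgeSet ∧ Odd (∑ y ∈ Y, sep (side T v e) v y)}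
  let H : SimpleGraph N := SimpleGraph.fromEdgeSet D
  let K : SimpleGraph N := SimpleGraph.fromEdgeSet {e | e ∈ D ∧ ∃ x ∈ e, H.Reachable u x}
  have hD : ∀ x y, s(x, y) ∈ D → x ≠ y := fun x y h => SimpleGraph.Adj.ne h.1
  have hKdeg : ∀ x, H.Reachable u x → (Odd (K.degree x) ↔ x ∈ Y) := by
    intro x hx
    have h1 : K.degree x = ((cutEdges T {x}).filter fun e => e ∈ D).card := by
      rw [← SimpleGraph.card_incidenceFinset_eq_degree]
      congr 1
      ext e
      rw [SimpleGraph.mem_incidenceFinset, SimpleGraph.incidenceSet, Set.mem_sep_iff,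
        Finset.mem_filter, mem_cutEdges_singleton]
      induction e with | h a b
      simp only [K, SimpleGraph.mem_edgeSet, SimpleGraph.fromEdgeSet_adj, Set.mem_ofPred_eq]
      constructor
      · rintro ⟨⟨⟨h1, h2⟩, h3⟩, h4⟩
        exact ⟨⟨h1.1, h4⟩, h1⟩
      · rintro ⟨⟨h1, h4⟩, h2⟩
        exact ⟨⟨⟨h2, x, h4, hx⟩, hD a b h2⟩, h4⟩
    have h2 := even_sum_card_iff hT v x Y hY
    have h3 : ∑ e ∈ cutEdges T {x}, ∑ y ∈ Y, sep (side T v e) v y ≡ K.degree x [MOD 2] := by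
      rw [h1, Finset.card_filter]
      refine Nat.ModEq.sum fun e he => ?_
      rw [mem_cutEdges_singleton] at he
      unfold Nat.ModEq
      by_cases hodd : Odd (∑ y ∈ Y, sep (side T v e) v y)
      · rw [if_pos (show e ∈ D from ⟨he.1, hodd⟩), Nat.odd_iff.1 hodd]
      · rw [if_neg fun h : e ∈ D => hodd h.2, Nat.even_iff.1 (Nat.not_odd_iff_even.1 hodd)]
    rw [Nat.even_iff] at h2
    unfold Nat.ModEq at h3
    rw [Nat.odd_iff, ← not_iff_not, ← h2]
    omega
  obtain ⟨t, htu, ht⟩ := K.exists_ne_odd_degree_of_exists_odd_degree u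
    ((hKdeg u (SimpleGraph.Reachable.refl u)).2 hu)
  have hreach : H.Reachable u t := by
    have hpos : 0 < K.degree t := ht.pos
    rw [SimpleGraph.degree_pos_iff_exists_adj] at hpos
    obtain ⟨w, hw⟩ := hpos
    simp only [K, SimpleGraph.fromEdgeSet_adj, Set.mem_ofPred_eq] at hw
    obtain ⟨⟨h1, x, hx, hux⟩, hne⟩ := hw
    have hadj : H.Adj t w := by
      simp only [H, SimpleGraph.fromEdgeSet_adj]
      exact ⟨h1, hne⟩
    rcases Sym2.mem_iff.1 hx with rfl | rfl
    · exact hux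
    · exact hux.trans hadj.symm.reachable
  refine ⟨t, (hKdeg t hreach).1 ht, htu, ?_⟩
  intro e he hsep
  obtain ⟨p⟩ := hreach
  have hle : H ≤ T := by
    intro a b hab
    simp only [H, SimpleGraph.fromEdgeSet_adj] at hab
    exact hab.1.1
  -- The path in `H` has to cross the fundamental cut of `e`, and the only tree edge doing so is
  -- `e`. Hence `e` belongs to `D`.
  obtain ⟨d, hd, hd1, hd2⟩ : ∃ d ∈ p.darts, ¬ (d.fst ∈ side T v e ↔ d.snd ∈ side T v e) ∧ True := by
    by_cases h : u ∈ side T v e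
    · obtain ⟨d, hd, h1, h2⟩ := p.exists_boundary_dart (side T v e : Set N) h (by
        simp only [Finset.mem_coe]; tauto)
      simp only [Finset.mem_coe] at h1 h2
      exact ⟨d, hd, by tauto⟩
    · obtain ⟨d, hd, h1, h2⟩ := p.exists_boundary_dart ((side T v e : Set N)ᶜ) h (by
        simp only [Set.mem_compl_iff, Finset.mem_coe]; tauto)
      simp only [Set.mem_compl_iff, Finset.mem_coe, not_not] at h1 h2
      exact ⟨d, hd, by tauto⟩
  have h3 := (side_adj hT (hle d.adj) v e).not.1 hd1
  rw [not_not] at h3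
  have h4 := d.adj
  simp only [H, SimpleGraph.fromEdgeSet_adj] at h4
  rw [h3]
  exact h4.1.2

end TreeCut

/-! ### The min-max formula for the cost of integer realizations. -/

namespace TreeMetricInstance

open SplittingOff TreeCut

variable {N : Type u} [Fintype N] [DecidableEq N]

/-- Translates from unordered pairs of terminals to matrices on all nodes. Every pair in the cut has
exactly one orientation that starts in `X`. -/
theorem sum_cutEdges_eq_cut {V : Finset N} {y : Sym2 V → ℕ} {g : N → N → ℕ}
    (hg : ∀ i j : V, i ≠ j → g i j = y s(i, j))
    (hz : ∀ x y, x ≠ y → x ∉ V ∨ y ∉ V → g x y = 0) (X : Finset N) :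
    ∑ e ∈ cutEdges (⊤ : SimpleGraph V) {i | (i : N) ∈ X}, y e = cut g X := by
  classical
  have hV : ∀ f : N → ℕ, (∀ x, x ∉ V → f x = 0) → ∑ x, f x = ∑ i : V, f i := by
    intro f hf
    rw [Finset.sum_coe_sort V f]
    exact (Finset.sum_subset (Finset.subset_univ V) fun x _ hx => hf x hx).symm
  have h1 : cutEdges (⊤ : SimpleGraph V) {i | (i : N) ∈ X}
      = (Finset.univ.filter fun p : V × V => (p.1 : N) ∈ X ∧ (p.2 : N) ∉ X).image
        fun p => s(p.1, p.2) := by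
    ext e
    induction e with | h i j
    rw [mem_cutEdges, Finset.mem_image]
    constructor
    · rintro ⟨-, h⟩
      simp only [Set.mem_ofPred_eq] at h
      by_cases hi : (i : N) ∈ X
      · exact ⟨(i, j), by simp only [Finset.mem_filter, Finset.mem_univ, true_and]; tauto, rfl⟩
      · exact ⟨(j, i), by simp only [Finset.mem_filter, Finset.mem_univ, true_and]; tauto,
          Sym2.eq_swap⟩
    · rintro ⟨⟨a, b⟩, hab, he⟩
      simp only [Finset.mem_filter, Finset.mem_univ, true_and] at hab
      have hne : a ≠ b := fun h => hab.2 (h ▸ hab.1)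
      rcases Sym2.eq_iff.1 he with ⟨rfl, rfl⟩ | ⟨rfl, rfl⟩
      · exact ⟨hne, by simp only [Set.mem_ofPred_eq]; tauto⟩
      · exact ⟨hne.symm, by simp only [Set.mem_ofPred_eq]; tauto⟩
  rw [h1, Finset.sum_image, Finset.sum_filter, Fintype.sum_prod_type, cut, between_eq_ite, hV]
  · refine Finset.sum_congr rfl fun i _ => ?_
    rw [hV]
    · refine Finset.sum_congr rfl fun j _ => ?_
      by_cases h : (i : N) ∈ X ∧ (j : N) ∉ X
      · rw [if_pos h, if_pos (by simpa using h), hg i j fun he => h.2 (he ▸ h.1)]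
      · rw [if_neg h, if_neg (by simpa using h)]
    · intro x hx
      split_ifs with h
      · exact hz _ _ (fun he => by simp [he] at h) (Or.inr hx)
      · rfl
  · intro x hx
    refine Finset.sum_eq_zero fun w _ => ?_
    split_ifs with h
    · exact hz _ _ (fun he => by simp [he] at h) (Or.inl hx)
    · rfl
  · rintro ⟨a, b⟩ hab ⟨a', b'⟩ hab' he
    simp only [Finset.coe_filter, Finset.mem_univ, true_and, Set.mem_ofPred_eq] at hab hab'
    rcases Sym2.eq_iff.1 he with ⟨rfl, rfl⟩ | ⟨rfl, rfl⟩
    · rfl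
    · exact absurd hab.1 hab'.2

theorem le_maxReq {W : Type u} [Finite W] (r : W → W → ℕ) {X : Set W} {i j : W} (hi : i ∈ X)
    (hj : j ∉ X) : r i j ≤ maxReq r X := by
  refine le_csSup (Set.Finite.bddAbove ?_) ⟨i, hi, j, hj, rfl⟩
  refine (Set.finite_range fun p : W × W => r p.1 p.2).subset ?_
  rintro k ⟨i, -, j, -, rfl⟩
  exact ⟨(i, j), rfl⟩

theorem maxReq_le {W : Type u} (r : W → W → ℕ) {X : Set W} {k : ℕ}
    (h : ∀ i ∈ X, ∀ j ∉ X, r i j ≤ k) : maxReq r X ≤ k := by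
  refine csSup_le' ?_
  rintro _ ⟨i, hi, j, hj, rfl⟩
  exact h i hi j hj

variable (I : TreeMetricInstance N) (v : I.V)

theorem sideOf_eq (e : Sym2 N) : sideOf I.T I.V v e = {i : I.V | (i : N) ∈ side I.T v e} := by
  ext i
  rw [Set.mem_ofPred_eq, mem_side]
  rfl

/-- The amount of a capacity on the complete graph that uses the tree edge `e`. -/
noncomputable def load (y : Sym2 I.V → ℕ) (e : Sym2 N) : ℕ :=
  ∑ p ∈ cutEdges (⊤ : SimpleGraph I.V) {i : I.V | (i : N) ∈ side I.T v e}, y p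

/-- Double counting: the cost of a pair is the total length of the tree edges separating it. -/
theorem capacityCost_eq (y : Sym2 I.V → ℕ) :
    capacityCost I.a y = ∑ e ∈ edgesOf I.T, I.l e * (I.load v y e : ℝ) := by
  classical
  have h1 : ∀ e, (I.load v y e : ℝ) = ∑ p ∈ edgesOf (⊤ : SimpleGraph I.V),
      if p ∈ cutEdges (⊤ : SimpleGraph I.V) {i : I.V | (i : N) ∈ side I.T v e} then (y p : ℝ) else 0 := by
    intro e
    rw [← Finset.sum_filter, load, Nat.cast_sum]
    refine Finset.sum_congr ?_ fun _ _ => rfl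
    ext p
    induction p with | h i j
    rw [Finset.mem_filter, mem_cutEdges, edgesOf, Set.Finite.mem_toFinset,
      SimpleGraph.mem_edgeSet]
    tauto
  simp only [h1, Finset.mul_sum]
  rw [Finset.sum_comm, capacityCost]
  refine Finset.sum_congr rfl fun p hp => ?_
  induction p with | h i j
  rw [edgesOf, Set.Finite.mem_toFinset, SimpleGraph.mem_edgeSet] at hp
  obtain ⟨w, hw⟩ := (I.isTree.connected.preconnected (i : N) (j : N)).exists_isPath
  rw [I.represents i j hp w hw, sum_edges_eq I.isTree v I.l w hw, Finset.sum_mul]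
  refine Finset.sum_congr rfl fun e _ => ?_
  rw [mul_assoc]
  congr 1
  simp only [mem_cutEdges, hp, true_and, sep, Set.mem_ofPred_eq]
  by_cases h : (i : N) ∈ side I.T v e ↔ (j : N) ∈ side I.T v e
  · simp [h]
  · simp [h]

theorem cR_eq (e : Sym2 N) : I.cR v e = maxReq I.r {i : I.V | (i : N) ∈ side I.T v e} := by
  rw [cR, sideOf_eq]

theorem cR_le_load {y : Sym2 I.V → ℕ} (hy : IsIntegerRealization I.r y) (e : Sym2 N) :
    I.cR v e ≤ I.load v y e := by
  rw [cR_eq]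
  refine maxReq_le _ fun i hi j hj => ?_
  have h : (I.r i j : ℝ) ≤ ∑ p ∈ cutEdges (⊤ : SimpleGraph I.V) {i : I.V | (i : N) ∈ side I.T v e},
    (y p : ℝ) := hy.2 i j (fun h => hj (h ▸ hi)) _ hi hj
  rw [load]
  exact_mod_cast h

open Classical in
/-- The tree edges whose load differs from the requirement in parity. -/
noncomputable def oddEdges (y : Sym2 I.V → ℕ) : Finset (Sym2 N) :=
  (edgesOf I.T).filter fun e => Odd (I.cR v e + I.load v y e)

theorem mem_oddEdges {y : Sym2 I.V → ℕ} {e : Sym2 N} :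
    e ∈ I.oddEdges v y ↔ e ∈ edgesOf I.T ∧ Odd (I.cR v e + I.load v y e) := by
  rw [oddEdges, Finset.mem_filter]

/-- The load is at least the requirement, and one more is needed wherever the parities differ. -/
theorem le_capacityCost {y : Sym2 I.V → ℕ} (hy : IsIntegerRealization I.r y) :
    ∑ e ∈ edgesOf I.T, I.l e * (I.cR v e : ℝ) + ∑ e ∈ I.oddEdges v y, I.l e
      ≤ capacityCost I.a y := by
  classical
  rw [capacityCost_eq I v, oddEdges, Finset.sum_filter, ← Finset.sum_add_distrib]
  refine Finset.sum_le_sum fun e he => ?_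
  have h1 := I.cR_le_load v hy e
  have hl := I.nonneg e (mem_edgesOf.1 he)
  split_ifs with hodd
  · have h2 : I.cR v e + 1 ≤ I.load v y e := by
      rcases h1.lt_or_eq with h | h
      · exact h
      · rw [h, ← two_mul] at hodd
        exact absurd hodd (by simp)
    have h3 : (I.cR v e : ℝ) + 1 ≤ I.load v y e := by exact_mod_cast h2
    nlinarith
  · rw [add_zero]
    exact mul_le_mul_of_nonneg_left (by exact_mod_cast h1) hl

theorem card_inter_eq_sum {α : Type*} [DecidableEq α] (A F : Finset α) :
    (A ∩ F).card = ∑ e ∈ A, if e ∈ F then 1 else 0 := by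
  rw [← Finset.sum_filter, ← Finset.card_eq_sum_ones, Finset.filter_mem_eq_inter]

/-- The congruence says that the capacity `cR + 1_F` has even degree at every node outside `V`, the
form needed for splitting off. -/
theorem isInnerOddJoin_iff {F : Finset (Sym2 N)} :
    I.IsInnerOddJoin v F ↔ F ⊆ edgesOf I.T ∧ ∀ w ∉ I.V,
      Even (∑ e ∈ cutEdges I.T {w}, (I.cR v e + if e ∈ F then 1 else 0)) := by
  classical
  unfold IsInnerOddJoin
  refine and_congr_right fun _ => forall_congr' fun w => imp_congr_right fun _ => ?_
  -- The intersection in the definition carries a classical decidability instance, hence the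
  -- quantification over instances.
  have h : ∀ (inst : DecidableEq (Sym2 N)) (dec : DecidablePred (· ∈ F)),
      (@Inter.inter _ (@Finset.instInter _ inst) (cutEdges I.T {w}) F).card
        = ∑ e ∈ cutEdges I.T {w}, @ite ℕ (e ∈ F) (dec e) 1 0 := by
    intro inst dec
    rw [@card_inter_eq_sum _ inst]
    refine Finset.sum_congr rfl fun e _ => ?_
    split_ifs <;> rfl
  rw [Finset.sum_add_distrib, h _ _, Nat.even_iff]
  unfold Nat.ModEq
  omega

/-- A path between two terminals has even degree at `w`, because `w` is not one of its ends. -/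
theorem even_sum_load (y : Sym2 I.V → ℕ) {w : N} (hw : w ∉ I.V) :
    Even (∑ e ∈ cutEdges I.T {w}, I.load v y e) := by
  classical
  have h1 : ∀ e, I.load v y e = ∑ p ∈ edgesOf (⊤ : SimpleGraph I.V),
      if p ∈ cutEdges (⊤ : SimpleGraph I.V) {i : I.V | (i : N) ∈ side I.T v e} then y p else 0 := by
    intro e
    rw [← Finset.sum_filter, load]
    refine Finset.sum_congr ?_ fun _ _ => rfl
    ext p
    induction p with | h i j
    rw [Finset.mem_filter, mem_cutEdges, edgesOf, Set.Finite.mem_toFinset,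
      SimpleGraph.mem_edgeSet]
    tauto
  simp only [h1]
  rw [Finset.sum_comm]
  refine Finset.even_sum _ fun p hp => ?_
  induction p with | h i j
  rw [edgesOf, Set.Finite.mem_toFinset, SimpleGraph.mem_edgeSet] at hp
  have h2 : ∀ e, (if s(i, j) ∈ cutEdges (⊤ : SimpleGraph I.V) {i : I.V | (i : N) ∈ side I.T v e} then
      y s(i, j) else 0) = sep (side I.T v e) i j * y s(i, j) := by
    intro e
    simp only [mem_cutEdges, hp, true_and, sep, Set.mem_ofPred_eq]
    by_cases h : (i : N) ∈ side I.T v e ↔ (j : N) ∈ side I.T v e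
    · simp [h]
    · simp [h]
  simp only [h2]
  rw [← Finset.sum_mul]
  refine Even.mul_right ?_ _
  rw [even_sum_sep_iff I.isTree]
  exact fun _ => ⟨fun h => hw (h ▸ i.2), fun h => hw (h ▸ j.2)⟩

theorem oddEdges_isInnerOddJoin (y : Sym2 I.V → ℕ) : I.IsInnerOddJoin v (I.oddEdges v y) := by
  classical
  rw [isInnerOddJoin_iff]
  refine ⟨Finset.filter_subset _ _, fun w hw => ?_⟩
  have h1 := I.even_sum_load v y hw
  have h2 : Even (∑ e ∈ cutEdges I.T {w}, (I.cR v e + (if e ∈ I.oddEdges v y then 1 else 0)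
      + I.load v y e)) := by
    refine Finset.even_sum _ fun e he => ?_
    have he' : e ∈ edgesOf I.T := mem_edgesOf.2 (mem_cutEdges_singleton.1 he).1
    by_cases hodd : Odd (I.cR v e + I.load v y e)
    · rw [if_pos ((I.mem_oddEdges v).2 ⟨he', hodd⟩)]
      obtain ⟨k, hk⟩ := hodd
      exact ⟨k + 1, by omega⟩
    · rw [if_neg fun h => hodd ((I.mem_oddEdges v).1 h).2]
      simpa using hodd
  rw [Finset.sum_add_distrib] at h2
  exact (Nat.even_add.1 h2).2 h1

theorem capacityCost_le {y : Sym2 I.V → ℕ} {c : Sym2 N → ℕ}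
    (h : ∀ e ∈ I.T.edgeSet, I.load v y e ≤ c e) :
    capacityCost I.a y ≤ ∑ e ∈ edgesOf I.T, I.l e * (c e : ℝ) := by
  rw [capacityCost_eq I v]
  refine Finset.sum_le_sum fun e he => ?_
  exact mul_le_mul_of_nonneg_left (by exact_mod_cast h e (mem_edgesOf.1 he))
    (I.nonneg e (mem_edgesOf.1 he))

theorem isIntegerRealization_of_cut {y : Sym2 I.V → ℕ} {g : N → N → ℕ}
    (hg : ∀ i j : I.V, i ≠ j → g i j = y s(i, j))
    (hz : ∀ x y, x ≠ y → x ∉ I.V ∨ y ∉ I.V → g x y = 0)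
    (hcut : ∀ s t : I.V, s ≠ t → ∀ X : Finset N, (s : N) ∈ X → (t : N) ∉ X → I.r s t ≤ cut g X) :
    IsIntegerRealization I.r y := by
  classical
  refine ⟨fun e _ => by positivity, fun s t hst X hs ht => ?_⟩
  have hX : {i : I.V | (i : N) ∈ (Set.toFinite (Subtype.val '' X)).toFinset} = X := by
    ext i; simp
  have h := hcut s t hst (Set.toFinite (Subtype.val '' X)).toFinset (by simpa using hs)
    (by simpa using ht)
  rw [← sum_cutEdges_eq_cut hg hz, hX] at h
  have h' : (I.r s t : ℝ) ≤ ∑ e ∈ cutEdges (⊤ : SimpleGraph I.V) X, (y e : ℝ) := by exact_mod_cast h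
  exact h'

/-- The largest requirement that is compatible with the capacities `c` on the tree. -/
noncomputable def pathMin (c : Sym2 N → ℕ) (x y : N) : ℕ :=
  sInf {k | ∃ e ∈ I.T.edgeSet, ¬ (x ∈ side I.T v e ↔ y ∈ side I.T v e) ∧ k = c e}

/-- Distinctness is essential: for `x = y` no edge separates, and the infimum takes the default
value 0. -/
theorem le_pathMin {c : Sym2 N → ℕ} {x y : N} (hxy : x ≠ y) {k : ℕ}
    (h : ∀ e ∈ I.T.edgeSet, ¬ (x ∈ side I.T v e ↔ y ∈ side I.T v e) → k ≤ c e) :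
    k ≤ I.pathMin v c x y := by
  obtain ⟨e, he, hs⟩ := exists_edge_sep I.isTree v hxy
  refine le_csInf ⟨c e, e, he, hs, rfl⟩ ?_
  rintro _ ⟨e, he, hs, rfl⟩
  exact h e he hs

theorem r_le_cR {s t : I.V} {e : Sym2 N}
    (h : ¬ ((s : N) ∈ side I.T v e ↔ (t : N) ∈ side I.T v e)) : I.r s t ≤ I.cR v e := by
  rw [cR_eq]
  by_cases hs : (s : N) ∈ side I.T v e
  · exact le_maxReq I.r (X := {i : I.V | (i : N) ∈ side I.T v e}) hs fun ht => h ⟨fun _ => ht, fun _ => hs⟩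
  · rw [I.symm]
    refine le_maxReq I.r (X := {i : I.V | (i : N) ∈ side I.T v e}) ?_ hs
    simp only [Set.mem_ofPred_eq]
    tauto

/-- Every inner-odd join gives rise to an integer realization. -/
theorem exists_realization (hR : ∀ e ∈ I.T.edgeSet, 1 < I.cR v e) {F : Finset (Sym2 N)}
    (hF : I.IsInnerOddJoin v F) : ∃ y : Sym2 I.V → ℕ, IsIntegerRealization I.r y ∧
      capacityCost I.a y ≤ ∑ e ∈ edgesOf I.T, I.l e * (I.cR v e : ℝ) + ∑ e ∈ F, I.l e := by
  classical
  rw [isInnerOddJoin_iff] at hF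
  set c : Sym2 N → ℕ := fun e => I.cR v e + if e ∈ F then 1 else 0 with hc
  have hqle : ∀ e ∈ I.T.edgeSet, ∀ x y, ¬ (x ∈ side I.T v e ↔ y ∈ side I.T v e) →
      I.pathMin v c x y ≤ c e := fun e he x y hxy => Nat.sInf_le ⟨e, he, hxy, rfl⟩
  obtain ⟨g, hg⟩ := exists_reduction (g₀ := treeCap I.T c) (q := I.pathMin v c) (treeCap_symm c)
    (fun x y => by
      unfold pathMin
      congr 1
      ext k
      refine exists_congr fun e => and_congr_right fun _ => and_congr_left fun _ => ?_
      tauto)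
    -- The hypothesis `R > 1` enters here. Bottlenecks are required between all nodes, also those
    -- outside `V`, so that during the whole process no cut separating remaining nodes has capacity
    -- one.
    (Or.inl fun x y hxy => I.le_pathMin v hxy fun e he _ => by
      have := hR e he
      simp only [hc]
      omega)
    (feasible_treeCap I.isTree v c hqle) I.Vᶜ (fun s hs => by
      rw [cut_treeCap_singleton]
      exact hF.2 s (by simpa using hs))
  rw [compl_compl] at hg
  let y : Sym2 I.V → ℕ := Sym2.lift ⟨fun i j => g i j, fun i j => hg.symm i j⟩
  have hgy : ∀ i j : I.V, i ≠ j → g i j = y s(i, j) := fun i j _ => rfl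
  have hz : ∀ x y, x ≠ y → x ∉ I.V ∨ y ∉ I.V → g x y = 0 := by
    rintro x y hxy (h | h)
    · exact hg.zero x (by simpa using h) y hxy.symm
    · rw [hg.symm]
      exact hg.zero y (by simpa using h) x hxy
  refine ⟨y, I.isIntegerRealization_of_cut hgy hz fun s t hst X hs ht => ?_, ?_⟩
  · have hst' : (s : N) ≠ t := fun h => hst (Subtype.ext h)
    refine le_trans (I.le_pathMin v hst' fun e _ hsep => ?_)
      (hg.feasible s s.2 t t.2 hst' X hs ht)
    exact (I.r_le_cR v hsep).trans (by simp only [hc]; omega)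
  · refine (I.capacityCost_le v (c := c) fun e he => ?_).trans_eq ?_
    · rw [load, sum_cutEdges_eq_cut hgy hz, ← cut_treeCap_side I.isTree v c he]
      exact hg.le _
    · simp only [hc, Nat.cast_add, mul_add, Finset.sum_add_distrib]
      congr 1
      rw [← Finset.sum_subset hF.1]
      · exact Finset.sum_congr rfl fun e he => by simp [he]
      · intro e _ he
        simp [he]

theorem exists_isLeast (hR : ∀ e ∈ I.T.edgeSet, 1 < I.cR v e) : ∃ m : ℝ,
    IsLeast {x : ℝ | ∃ F : Finset (Sym2 N), I.IsInnerOddJoin v F ∧ x = ∑ e ∈ F, I.l e} m ∧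
    IsLeast {x : ℝ | ∃ y : Sym2 I.V → ℕ, IsIntegerRealization I.r y ∧ x = capacityCost I.a y}
      (∑ e ∈ edgesOf I.T, I.l e * (I.cR v e : ℝ) + m) := by
  classical
  obtain ⟨F, hF, hmin⟩ := Finset.exists_min_image
    ((edgesOf I.T).powerset.filter fun F => I.IsInnerOddJoin v F) (fun F => ∑ e ∈ F, I.l e)
    -- The odd edges of the zero capacity show that inner-odd joins exist; no realization is needed
    -- for that.
    ⟨I.oddEdges v fun _ => 0, Finset.mem_filter.2 ⟨Finset.mem_powerset.2
      (Finset.filter_subset _ _), I.oddEdges_isInnerOddJoin v _⟩⟩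
  have hF' := (Finset.mem_filter.1 hF).2
  have hmin' : ∀ F', I.IsInnerOddJoin v F' → ∑ e ∈ F, I.l e ≤ ∑ e ∈ F', I.l e := fun F' hF' =>
    hmin F' (Finset.mem_filter.2 ⟨Finset.mem_powerset.2 hF'.1, hF'⟩)
  refine ⟨∑ e ∈ F, I.l e, ⟨⟨F, hF', rfl⟩, ?_⟩, ?_, ?_⟩
  · rintro _ ⟨F', h, rfl⟩
    exact hmin' F' h
  · obtain ⟨y, hy, hcost⟩ := I.exists_realization v hR hF'
    refine ⟨y, hy, le_antisymm ?_ hcost⟩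
    exact (add_le_add_right (hmin' _ (I.oddEdges_isInnerOddJoin v y)) _).trans
      (I.le_capacityCost v hy)
  · rintro _ ⟨y, hy, rfl⟩
    exact (add_le_add_right (hmin' _ (I.oddEdges_isInnerOddJoin v y)) _).trans
      (I.le_capacityCost v hy)

end TreeMetricInstance

/-! ### Structured programs: semantics, frame conditions and running time. -/

namespace RAM

namespace State

/-- Overwrite a cell of the natural-number memory. -/
def setN (σ : State) (A i j x : ℕ) : State := { σ with nat := write σ.nat A i j x }

/-- Overwrite a cell of the real memory. -/
def setR (σ : State) (A i j : ℕ) (x : ℝ) : State := { σ with real := write σ.real A i j x }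

@[simp] theorem setN_real (σ : State) (A i j x : ℕ) : (σ.setN A i j x).real = σ.real := rfl

theorem setN_nat_apply (σ : State) (A i j x B k l : ℕ) :
    (σ.setN A i j x).nat B k l = if B = A ∧ k = i ∧ l = j then x else σ.nat B k l := rfl

theorem setR_real_apply (σ : State) (A i j : ℕ) (x : ℝ) (B k l : ℕ) :
    (σ.setR A i j x).real B k l = if B = A ∧ k = i ∧ l = j then x else σ.real B k l := rfl

@[simp] theorem setN_nat_self (σ : State) (A i j x : ℕ) : (σ.setN A i j x).nat A i j = x := by
  simp [setN_nat_apply]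

@[simp] theorem setR_real_self (σ : State) (A i j : ℕ) (x : ℝ) :
    (σ.setR A i j x).real A i j = x := by
  simp [setR_real_apply]

@[simp] theorem setN_nat_of_ne (σ : State) {A B : ℕ} (i j x : ℕ) (h : B ≠ A) :
    (σ.setN A i j x).nat B = σ.nat B := by
  ext k l
  simp [setN_nat_apply, h]

@[simp] theorem setR_real_of_ne (σ : State) {A B : ℕ} (i j : ℕ) (x : ℝ) (h : B ≠ A) :
    (σ.setR A i j x).real B = σ.real B := by
  ext k l
  simp [setR_real_apply, h]

end State

/-- Programs with loops that run through the numbers below the cell `0[0, 0]`. -/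
inductive Stmt where
  | skip
  | nat (A : ℕ) (i j x : NExpr)
  | real (A : ℕ) (i j : NExpr) (x : RExpr)
  | seq (P Q : Stmt)
  | ite (b : Test) (P Q : Stmt)
  | forLt (c : ℕ) (P : Stmt)

/-- A cell that is used as a variable. -/
def NExpr.var (A : ℕ) : NExpr := .get A (.lit 0) (.lit 0)

@[simp] theorem NExpr.eval_var (σ : State) (A : ℕ) : (NExpr.var A).eval σ = σ.nat A 0 0 := rfl

namespace Stmt

/-- Sequential composition. -/
scoped infixr:67 " ;; " => Stmt.seq

/-- The random access program of a statement. -/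
def compile : Stmt → Prog
  | skip => .skip
  | nat A i j x => .setNat A i j x
  | real A i j x => .setReal A i j x
  | seq P Q => .seq P.compile Q.compile
  | ite b P Q => .ite b P.compile Q.compile
  | forLt c P => .seq (.setNat c (.lit 0) (.lit 0) (.lit 0))
      (.loop (.natLe (.add (.var c) (.lit 1)) (.var 0))
        (.seq P.compile (.setNat c (.lit 0) (.lit 0) (.add (.var c) (.lit 1)))))

open Classical in
/-- The final state of a statement. -/
noncomputable def den : Stmt → State → State
  | skip, σ => σ
  | nat A i j x, σ => σ.setN A (i.eval σ) (j.eval σ) (x.eval σ)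
  | real A i j x, σ => σ.setR A (i.eval σ) (j.eval σ) (x.eval σ)
  | seq P Q, σ => Q.den (P.den σ)
  | ite b P Q, σ => if b.Holds σ then P.den σ else Q.den σ
  | forLt c P, σ => (Nat.rec σ (fun k τ => P.den (τ.setN c 0 0 k)) (σ.nat 0 0 0) : State).setN
      c 0 0 (σ.nat 0 0 0)

/-- Whether a statement may write to the natural-number array `B`. -/
def natW : Stmt → ℕ → Bool
  | skip, _ => false
  | nat A _ _ _, B => Nat.beq A B
  | real _ _ _ _, _ => false
  | seq P Q, B => P.natW B || Q.natW B
  | ite _ P Q, B => P.natW B || Q.natW B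
  | forLt c P, B => Nat.beq c B || P.natW B

/-- Whether a statement may write to the real array `B`. -/
def realW : Stmt → ℕ → Bool
  | skip, _ => false
  | nat _ _ _ _, _ => false
  | real A _ _ _, B => Nat.beq A B
  | seq P Q, B => P.realW B || Q.realW B
  | ite _ P Q, B => P.realW B || Q.realW B
  | forLt _ P, B => P.realW B

/-- The loops do not change their counters and the bound. -/
def wf : Stmt → Bool
  | skip => true
  | nat A _ _ _ => !Nat.beq A 0
  | real _ _ _ _ => true
  | seq P Q => P.wf && Q.wf
  | ite _ P Q => P.wf && Q.wf
  | forLt c P => (!Nat.beq c 0) && !(P.natW c) && P.wf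

/-- A bound for the number of steps. -/
noncomputable def cost : Stmt → Polynomial ℕ
  | skip => 1
  | nat _ i j x => (i.ops + j.ops + x.ops + 1 : ℕ)
  | real _ i j x => (i.ops + j.ops + x.ops + 1 : ℕ)
  | seq P Q => P.cost + Q.cost
  | ite b P Q => (b.ops : ℕ) + P.cost + Q.cost
  | forLt _ P => 20 + Polynomial.X * (P.cost + 20)

theorem den_nat (P : Stmt) {B : ℕ} (h : P.natW B = false) (σ : State) :
    (P.den σ).nat B = σ.nat B := by
  induction P generalizing σ with
  | skip => rfl
  | nat A i j x =>
    rw [den, State.setN_nat_of_ne]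
    rintro rfl
    simp [natW] at h
  | real A i j x => rfl
  | seq P Q ihP ihQ =>
    simp only [natW, Bool.or_eq_false_iff] at h
    rw [den, ihQ h.2, ihP h.1]
  | ite b P Q ihP ihQ =>
    simp only [natW, Bool.or_eq_false_iff] at h
    rw [den]
    split_ifs
    · exact ihP h.1 σ
    · exact ihQ h.2 σ
  | forLt c P ih =>
    simp only [natW, Bool.or_eq_false_iff] at h
    have hc : B ≠ c := by
      rintro rfl
      simp at h
    rw [den, State.setN_nat_of_ne _ _ _ _ hc]
    generalize σ.nat 0 0 0 = k
    induction k with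
    | zero => rfl
    | succ k ihk => rw [← ihk]; exact (ih h.2 _).trans (State.setN_nat_of_ne _ _ _ _ hc)

theorem den_real (P : Stmt) {B : ℕ} (h : P.realW B = false) (σ : State) :
    (P.den σ).real B = σ.real B := by
  induction P generalizing σ with
  | skip => rfl
  | nat A i j x => rfl
  | real A i j x =>
    rw [den, State.setR_real_of_ne]
    rintro rfl
    simp [realW] at h
  | seq P Q ihP ihQ =>
    simp only [realW, Bool.or_eq_false_iff] at h
    rw [den, ihQ h.2, ihP h.1]
  | ite b P Q ihP ihQ =>
    simp only [realW, Bool.or_eq_false_iff] at h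
    rw [den]
    split_ifs
    · exact ihP h.1 σ
    · exact ihQ h.2 σ
  | forLt c P ih =>
    rw [den, State.setN_real]
    generalize σ.nat 0 0 0 = k
    induction k with
    | zero => rfl
    | succ k ihk => rw [← ihk]; exact ih h _

/-- Induction for loops. -/
theorem den_for {c : ℕ} {P : Stmt} {σ : State} {n : ℕ} (hn : σ.nat 0 0 0 = n)
    (Inv : ℕ → State → Prop) (h0 : Inv 0 σ)
    (hs : ∀ k < n, ∀ τ, (∀ B, (Stmt.forLt c P).natW B = false → τ.nat B = σ.nat B) →
      (∀ B, P.realW B = false → τ.real B = σ.real B) → Inv k τ →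
      Inv (k + 1) (P.den (τ.setN c 0 0 k))) :
    ∃ τ, Inv n τ ∧ (∀ B, (Stmt.forLt c P).natW B = false → τ.nat B = σ.nat B) ∧
      (∀ B, P.realW B = false → τ.real B = σ.real B) ∧
      (Stmt.forLt c P).den σ = τ.setN c 0 0 n := by
  have key : ∀ k ≤ n, Inv k (Nat.rec σ (fun k τ => P.den (τ.setN c 0 0 k)) k) ∧
      (∀ B, (Stmt.forLt c P).natW B = false →
        (Nat.rec σ (fun k τ => P.den (τ.setN c 0 0 k)) k : State).nat B = σ.nat B) ∧
      (∀ B, P.realW B = false →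
        (Nat.rec σ (fun k τ => P.den (τ.setN c 0 0 k)) k : State).real B = σ.real B) := by
    intro k
    induction k with
    | zero => exact fun _ => ⟨h0, fun _ _ => rfl, fun _ _ => rfl⟩
    | succ k ih =>
      intro hk
      obtain ⟨h1, h2, h3⟩ := ih (by omega)
      refine ⟨hs k (by omega) _ h2 h3 h1, fun B hB => ?_, fun B hB => ?_⟩
      · rw [← h2 B hB]
        simp only [natW, Bool.or_eq_false_iff] at hB
        have hc : B ≠ c := by
          rintro rfl
          simp at hB
        exact (den_nat P hB.2 _).trans (State.setN_nat_of_ne _ _ _ _ hc)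
      · rw [← h3 B hB]
        exact den_real P hB _
  obtain ⟨h1, h2, h3⟩ := key n le_rfl
  exact ⟨_, h1, h2, h3, by rw [den, hn]⟩

/-- Well-formed statements leave array 0 alone, so all loops share the constant bound `n`. -/
theorem natW_zero {P : Stmt} (h : P.wf = true) : P.natW 0 = false := by
  induction P with
  | skip => rfl
  | nat A i j x => simpa [wf, natW] using h
  | real A i j x => rfl
  | seq P Q ihP ihQ =>
    simp only [wf, Bool.and_eq_true] at h
    simp [natW, ihP h.1, ihQ h.2]
  | ite b P Q ihP ihQ =>
    simp only [wf, Bool.and_eq_true] at h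
    simp [natW, ihP h.1, ihQ h.2]
  | forLt c P ih =>
    simp only [wf, Bool.and_eq_true, Bool.not_eq_true'] at h
    simp [natW, ih h.2, h.1.1]

/-- All loops run exactly `n` times whatever their bodies do, so the time bound follows by
structural induction and is a polynomial in `n` that depends on the program alone. -/
theorem exec_compile {P : Stmt} (h : P.wf = true) (σ : State) :
    ∃ t ≤ P.cost.eval (σ.nat 0 0 0), Exec P.compile σ t (P.den σ) := by
  induction P generalizing σ with
  | skip => exact ⟨1, by simp [cost], .skip σ⟩
  | nat A i j x => exact ⟨_, by simp [cost], .setNat A i j x σ⟩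
  | real A i j x => exact ⟨_, by simp [cost], .setReal A i j x σ⟩
  | seq P Q ihP ihQ =>
    simp only [wf, Bool.and_eq_true] at h
    obtain ⟨s, hs, hP⟩ := ihP h.1 σ
    obtain ⟨t, ht, hQ⟩ := ihQ h.2 (P.den σ)
    rw [den_nat P (natW_zero h.1)] at ht
    exact ⟨s + t, by rw [cost, Polynomial.eval_add]; exact add_le_add hs ht, .seq hP hQ⟩
  | ite b P Q ihP ihQ =>
    simp only [wf, Bool.and_eq_true] at h
    simp only [cost, Polynomial.eval_add, Polynomial.eval_natCast, den, compile]
    split_ifs with hb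
    · obtain ⟨s, hs, hP⟩ := ihP h.1 σ
      exact ⟨_, by simp only [Nat.cast_id]; omega, .iteTrue hb hP⟩
    · obtain ⟨s, hs, hP⟩ := ihQ h.2 σ
      exact ⟨_, by simp only [Nat.cast_id]; omega, .iteFalse hb hP⟩
  | forLt c P ih =>
    have hW := natW_zero h
    simp only [wf, Bool.and_eq_true, Bool.not_eq_true'] at h
    obtain ⟨⟨hc0, hcP⟩, hP⟩ := h
    have hc : (0 : ℕ) ≠ c := by
      rintro rfl
      simp at hc0
    set n := σ.nat 0 0 0 with hn
    let S : ℕ → State := fun k => Nat.rec σ (fun k τ => P.den (τ.setN c 0 0 k)) k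
    have hS : ∀ k, (S k).nat 0 0 0 = n := by
      intro k
      induction k with
      | zero => rfl
      | succ k ihk =>
        rw [← ihk]
        change (P.den ((S k).setN c 0 0 k)).nat 0 0 0 = _
        rw [den_nat P (natW_zero hP), State.setN_nat_of_ne _ _ _ _ hc]
    set p := P.cost.eval n with hp
    -- `m` rounds remain and the counter is `k`. The test takes 9 steps; test and increment together
    -- take 17 steps per round, which 20 covers.
    have key : ∀ m k, k + m = n → ∃ t ≤ 9 + m * (p + 20),
        Exec (.loop (.natLe (.add (.var c) (.lit 1)) (.var 0))
          (.seq P.compile (.setNat c (.lit 0) (.lit 0) (.add (.var c) (.lit 1)))))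
          ((S k).setN c 0 0 k) t ((S n).setN c 0 0 n) := by
      intro m
      induction m with
      | zero =>
        rintro k rfl
        refine ⟨_, ?_, .loopStop ?_⟩
        · simp [Test.ops, NExpr.ops, NExpr.var]
        · simp [Test.Holds, NExpr.eval, State.setN_nat_of_ne _ _ _ _ hc, hS]
      | succ m ihm =>
        intro k hk
        obtain ⟨t, ht, hE⟩ := ihm (k + 1) (by omega)
        obtain ⟨s, hs, hP'⟩ := ih hP ((S k).setN c 0 0 k)
        rw [State.setN_nat_of_ne _ _ _ _ hc, hS] at hs
        have h1 := Exec.setNat c (.lit 0) (.lit 0) (.add (.var c) (.lit 1))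
          (P.den ((S k).setN c 0 0 k))
        have h2 : (NExpr.add (.var c) (.lit 1)).eval (P.den ((S k).setN c 0 0 k)) = k + 1 := by
          simp [NExpr.eval, den_nat P hcP]
        rw [h2] at h1
        refine ⟨_, ?_, .loopStep ?_ (.seq hP' h1) hE⟩
        · simp only [Test.ops, NExpr.ops, NExpr.var]
          rw [add_mul, ← hp] at *
          omega
        · simp only [Test.Holds, NExpr.eval, NExpr.eval_var, State.setN_nat_of_ne _ _ _ _ hc, hS,
            State.setN_nat_self]
          omega
    obtain ⟨t, ht, hE⟩ := key n 0 (zero_add n)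
    refine ⟨_, ?_, .seq (.setNat c (.lit 0) (.lit 0) (.lit 0) σ) hE⟩
    simp only [NExpr.ops, cost, Polynomial.eval_add, Polynomial.eval_mul, Polynomial.eval_X,
      Polynomial.eval_ofNat, ← hp]
    omega

end Stmt

end RAM

/-! ### Tests, matrix assignments and nested loops. -/

namespace RAM

open Stmt

attribute [simp] NExpr.eval RExpr.eval Test.Holds

namespace Test

/-- Disjunction of tests. -/
def or (b c : Test) : Test := .neg (.conj (.neg b) (.neg c))

/-- Equality of natural numbers. -/
def eq (x y : NExpr) : Test := .conj (.natLe x y) (.natLe y x)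

@[simp] theorem holds_or (σ : State) (b c : Test) : (or b c).Holds σ ↔ b.Holds σ ∨ c.Holds σ := by
  simp only [or, Holds]
  tauto

@[simp] theorem holds_eq (σ : State) (x y : NExpr) : (eq x y).Holds σ ↔ x.eval σ = y.eval σ := by
  simp only [eq, Holds]
  omega

end Test

/-- The entry of a vector. -/
def NExpr.vec (A c : ℕ) : NExpr := .get A (.var c) (.lit 0)

/-- The entry of a matrix. -/
def NExpr.mat (A c d : ℕ) : NExpr := .get A (.var c) (.var d)

@[simp] theorem NExpr.eval_vec (σ : State) (A c : ℕ) :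
    (NExpr.vec A c).eval σ = σ.nat A (σ.nat c 0 0) 0 := rfl

@[simp] theorem NExpr.eval_mat (σ : State) (A c d : ℕ) :
    (NExpr.mat A c d).eval σ = σ.nat A (σ.nat c 0 0) (σ.nat d 0 0) := rfl

/-- The matrix that is stored in an array. -/
def State.mat (n : ℕ) (σ : State) (A : ℕ) (i j : Fin n) : ℕ := σ.nat A i j

namespace Stmt

@[simp] theorem den_skip (σ : State) : skip.den σ = σ := rfl

@[simp] theorem den_natStmt (σ : State) (A : ℕ) (i j x : NExpr) :
    (nat A i j x).den σ = σ.setN A (i.eval σ) (j.eval σ) (x.eval σ) := rfl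

@[simp] theorem den_realStmt (σ : State) (A : ℕ) (i j : NExpr) (x : RExpr) :
    (real A i j x).den σ = σ.setR A (i.eval σ) (j.eval σ) (x.eval σ) := rfl

@[simp] theorem den_seq (σ : State) (P Q : Stmt) : (P ;; Q).den σ = Q.den (P.den σ) := rfl

theorem den_ite (σ : State) (b : Test) (P Q : Stmt) [Decidable (b.Holds σ)] :
    (ite b P Q).den σ = if b.Holds σ then P.den σ else Q.den σ := by
  rw [den]
  split_ifs <;> rfl

theorem den_ite_pos {σ : State} {b : Test} (h : b.Holds σ) (P Q : Stmt) :
    (ite b P Q).den σ = P.den σ := if_pos h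

theorem den_ite_neg {σ : State} {b : Test} (h : ¬ b.Holds σ) (P Q : Stmt) :
    (ite b P Q).den σ = Q.den σ := if_neg h

/-- Assign a variable. -/
def set (A : ℕ) (x : NExpr) : Stmt := nat A (.lit 0) (.lit 0) x

@[simp] theorem den_set (σ : State) (A : ℕ) (x : NExpr) :
    (set A x).den σ = σ.setN A 0 0 (x.eval σ) := rfl

/-- Set all entries of the matrix `A` to `x` where `b` holds, and to `y` elsewhere. -/
def fill (A : ℕ) (b : Test) (x y : NExpr) : Stmt :=
  .forLt 10 (.forLt 11 (.ite b (.nat A (.var 10) (.var 11) x) (.nat A (.var 10) (.var 11) y)))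

-- The value needs to be right only in states where entry `i j` still has its old content. Thus a
-- matrix may be updated in place from its own entries.
open Classical in
theorem den_fill {A : ℕ} {b : Test} {x y : NExpr} {σ : State} {n : ℕ} (hn : σ.nat 0 0 0 = n)
    (hA : A ≠ 0 ∧ A ≠ 10 ∧ A ≠ 11) (val : Fin n → Fin n → ℕ)
    (h : ∀ (i j : Fin n) (τ : State), (∀ B, B ≠ A → B ≠ 10 → B ≠ 11 → τ.nat B = σ.nat B) →
      τ.nat A i j = σ.nat A i j → τ.nat 10 0 0 = i → τ.nat 11 0 0 = j →
      (if b.Holds τ then x.eval τ else y.eval τ) = val i j) :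
    ((fill A b x y).den σ).mat n A = val := by
  refine Exists.elim (den_for (c := 10) (P := .forLt 11 (.ite b
    (.nat A (.var 10) (.var 11) x) (.nat A (.var 10) (.var 11) y))) hn
    (fun k τ => (∀ B, B ≠ A → B ≠ 10 → B ≠ 11 → τ.nat B = σ.nat B) ∧
      ∀ i j : Fin n, τ.nat A i j = if (i : ℕ) < k then val i j else σ.nat A i j)
    ⟨fun _ _ _ _ => rfl, by simp⟩ ?_) ?_
  rotate_left
  · rintro τ ⟨hτ, -, -, he⟩
    funext i j
    rw [fill, he, State.mat, State.setN_nat_of_ne _ _ _ _ hA.2.1, hτ.2, if_pos i.2]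
  · intro k hk τ _ _ hinv
    have hn1 : (τ.setN 10 0 0 k).nat 0 0 0 = n := by
      rw [State.setN_nat_of_ne _ _ _ _ (by simp), hinv.1 0 hA.1.symm (by simp) (by simp), hn]
    refine Exists.elim (den_for (c := 11) (P := .ite b
      (.nat A (.var 10) (.var 11) x) (.nat A (.var 10) (.var 11) y)) hn1
      (fun l τ' => (∀ B, B ≠ A → B ≠ 10 → B ≠ 11 → τ'.nat B = σ.nat B) ∧
        τ'.nat 10 0 0 = k ∧
        ∀ i j : Fin n, τ'.nat A i j = if (i : ℕ) < k ∨ (i : ℕ) = k ∧ (j : ℕ) < l then val i j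
          else σ.nat A i j) ?_ ?_) ?_
    rotate_left 2
    · rintro τ' ⟨hτ', -, -, he'⟩
      rw [he']
      refine ⟨fun B h1 h2 h3 => ?_, fun i j => ?_⟩
      · rw [State.setN_nat_of_ne _ _ _ _ h3, hτ'.1 B h1 h2 h3]
      · rw [State.setN_nat_of_ne _ _ _ _ hA.2.2, hτ'.2.2]
        have hj := j.2
        refine if_congr ?_ rfl rfl
        omega
    · refine ⟨fun B h1 h2 h3 => ?_, by simp, fun i j => ?_⟩
      · rw [State.setN_nat_of_ne _ _ _ _ h2, hinv.1 B h1 h2 h3]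
      · rw [State.setN_nat_of_ne _ _ _ _ hA.2.1, hinv.2]
        simp
    · rintro l hl τ' - - ⟨h1, h2, h3⟩
      have hcur : (if b.Holds (τ'.setN 11 0 0 l) then x.eval (τ'.setN 11 0 0 l)
          else y.eval (τ'.setN 11 0 0 l)) = val ⟨k, hk⟩ ⟨l, hl⟩ := by
        refine h ⟨k, hk⟩ ⟨l, hl⟩ _ (fun B g1 g2 g3 => ?_) ?_ (by simpa using h2) (by simp)
        · rw [State.setN_nat_of_ne _ _ _ _ g3, h1 B g1 g2 g3]
        · rw [State.setN_nat_of_ne _ _ _ _ hA.2.2, h3]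
          simp
      have hden : (Stmt.ite b (.nat A (.var 10) (.var 11) x) (.nat A (.var 10) (.var 11) y)).den
          (τ'.setN 11 0 0 l) = (τ'.setN 11 0 0 l).setN A k l (val ⟨k, hk⟩ ⟨l, hl⟩) := by
        rw [← hcur, den_ite]
        split_ifs <;> simp [h2]
      rw [hden]
      refine ⟨fun B g1 g2 g3 => ?_, ?_, fun i j => ?_⟩
      · rw [State.setN_nat_of_ne _ _ _ _ g1, State.setN_nat_of_ne _ _ _ _ g3, h1 B g1 g2 g3]
      · rw [State.setN_nat_of_ne _ _ _ _ hA.2.1.symm]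
        simpa using h2
      · rw [State.setN_nat_apply, State.setN_nat_of_ne _ _ _ _ hA.2.2, h3]
        by_cases hij : (i : ℕ) = k ∧ (j : ℕ) = l
        · obtain ⟨rfl, rfl⟩ := hij
          simp
        · rw [if_neg (by simpa using hij)]
          refine if_congr ?_ rfl rfl
          omega

/-- Set all entries of the vector `A` to `k`. -/
def fillVec (A k : ℕ) : Stmt := .forLt 10 (.nat A (.var 10) (.lit 0) (.lit k))

theorem den_fillVec {A k : ℕ} {σ : State} {n : ℕ} (hn : σ.nat 0 0 0 = n) (hA : A ≠ 10)
    (i : Fin n) : ((fillVec A k).den σ).nat A i 0 = k := by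
  refine Exists.elim (den_for (c := 10) (P := .nat A (.var 10) (.lit 0) (.lit k)) hn
    (fun m τ => ∀ i : Fin n, (i : ℕ) < m → τ.nat A i 0 = k) (by simp) ?_) ?_
  rotate_left
  · rintro τ ⟨hτ, -, -, he⟩
    rw [fillVec, he, State.setN_nat_of_ne _ _ _ _ hA, hτ i i.2]
  · intro m hm τ _ _ hinv i hi
    simp only [den_natStmt, NExpr.eval, NExpr.eval_var, State.setN_nat_self]
    rw [State.setN_nat_apply]
    split_ifs with h
    · rfl
    · rw [State.setN_nat_of_ne _ _ _ _ hA]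
      refine hinv i ?_
      simp only [and_true, true_and] at h
      omega

/-- A double loop. -/
theorem den_for_for {c d : ℕ} {P : Stmt} {σ : State} {n : ℕ} (hn : σ.nat 0 0 0 = n)
    (hW : (Stmt.forLt d P).natW c = false) (hc : c ≠ 0) (hd : (Stmt.forLt d P).natW 0 = false)
    (Inv : ℕ → ℕ → State → Prop) (h0 : Inv 0 0 σ)
    (hs : ∀ k < n, ∀ l < n, ∀ τ,
      (∀ B, (Stmt.forLt c (.forLt d P)).natW B = false → τ.nat B = σ.nat B) →
      (∀ B, P.realW B = false → τ.real B = σ.real B) → Inv k l τ → τ.nat c 0 0 = k →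
      Inv k (l + 1) (P.den (τ.setN d 0 0 l)))
    (hcount : ∀ k τ x, Inv k 0 τ → Inv k 0 (τ.setN c 0 0 x))
    (hnext : ∀ k τ x, Inv k n τ → Inv (k + 1) 0 (τ.setN d 0 0 x)) :
    ∃ τ, Inv n 0 τ ∧ (∀ B, (Stmt.forLt c (.forLt d P)).natW B = false → τ.nat B = σ.nat B) ∧
      (∀ B, P.realW B = false → τ.real B = σ.real B) ∧
      (Stmt.forLt c (.forLt d P)).den σ = τ.setN c 0 0 n := by
  refine den_for hn (fun k τ => Inv k 0 τ) h0 fun k hk τ h1 h2 h3 => ?_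
  have h0W : (Stmt.forLt c (.forLt d P)).natW 0 = false := by
    rw [natW, hd, Bool.or_false, Bool.eq_false_iff]
    simpa using hc
  have hn1 : (τ.setN c 0 0 k).nat 0 0 0 = n := by
    rw [State.setN_nat_of_ne _ _ _ _ hc.symm, h1 0 h0W, hn]
  refine Exists.elim (den_for hn1 (fun l τ => Inv k l τ) (hcount k τ k h3)
    fun l hl τ' g1 g2 g3 => hs k hk l hl τ' (fun B hB => ?_) (fun B hB => ?_) g3 ?_) ?_
  · have hB' := hB
    simp only [natW, Bool.or_eq_false_iff] at hB'
    have hBc : B ≠ c := by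
      rintro rfl
      simp at hB'
    rw [g1 B (by simp [natW, hB'.2]), State.setN_nat_of_ne _ _ _ _ hBc, h1 B hB]
  · rw [g2 B hB, State.setN_real, h2 B hB]
  · rw [g1 c hW, State.setN_nat_self]
  · rintro τ' ⟨g1, -, -, g4⟩
    rw [g4]
    exact hnext k τ' n g1

end Stmt

end RAM

/-! ### Graph search. -/

namespace RAM

/-- The state of a search from `src` along the positive entries of `g`: the visited nodes `S`, their
predecessors and their depths. -/
structure Search {n : ℕ} (g : Fin n → Fin n → ℕ) (src : Fin n) (vis pred : ℕ → ℕ → ℕ)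
    (S : Finset (Fin n)) (ρ : Fin n → ℕ) : Prop where
  vis_eq : ∀ i : Fin n, vis i 0 = if i ∈ S then 1 else 0
  src_mem : src ∈ S
  rank_src : ρ src = 0
  pred_eq : ∀ z ∈ S, z ≠ src → ∃ p ∈ S, pred z 0 = p ∧ ρ z = ρ p + 1 ∧ 0 < g p z
  rank_lt : ∀ z ∈ S, ρ z < S.card

namespace Search

variable {n : ℕ} {g : Fin n → Fin n → ℕ} {src : Fin n} {vis pred vis' pred' : ℕ → ℕ → ℕ}
  {S : Finset (Fin n)} {ρ : Fin n → ℕ}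

/-- The new node is one deeper than its predecessor. Depths stay below the number of visited nodes,
which later bounds the length of augmenting paths. -/
theorem insert (h : Search g src vis pred S ρ) {i j : Fin n} (hi : i ∈ S) (hj : j ∉ S)
    (hij : 0 < g i j) (hv : ∀ k : Fin n, vis' k 0 = if k = j then 1 else vis k 0)
    (hp : ∀ k : Fin n, pred' k 0 = if k = j then (i : ℕ) else pred k 0) :
    Search g src vis' pred' (insert j S) (Function.update ρ j (ρ i + 1)) := by
  have hsj : src ≠ j := fun e => hj (e ▸ h.src_mem)
  have hij' : i ≠ j := fun e => hj (e ▸ hi)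
  refine ⟨fun k => ?_, Finset.mem_insert_of_mem h.src_mem, ?_, fun z hz hzs => ?_, fun z hz => ?_⟩
  · rw [hv, h.vis_eq]
    by_cases hk : k = j <;> simp [hk]
  · rw [Function.update_of_ne hsj, h.rank_src]
  · rcases Finset.mem_insert.1 hz with rfl | hz
    · exact ⟨i, Finset.mem_insert_of_mem hi, by simp [hp], by simp [Function.update_of_ne hij'],
        hij⟩
    · obtain ⟨p, h1, h2, h3, h4⟩ := h.pred_eq z hz hzs
      have hzj : z ≠ j := fun e => hj (e ▸ hz)
      have hpj : p ≠ j := fun e => hj (e ▸ h1)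
      exact ⟨p, Finset.mem_insert_of_mem h1, by rw [hp, if_neg hzj, h2],
        by rw [Function.update_of_ne hzj, Function.update_of_ne hpj, h3], h4⟩
  · rw [Finset.card_insert_of_notMem hj]
    rcases Finset.mem_insert.1 hz with rfl | hz
    · rw [Function.update_self]
      exact Nat.succ_lt_succ (h.rank_lt i hi)
    · rw [Function.update_of_ne (fun e => hj (e ▸ hz) : z ≠ j)]
      exact (h.rank_lt z hz).trans (Nat.lt_succ_self _)

end Search

/-- The nodes that are reachable along the positive entries of a matrix. -/
def Closed {n : ℕ} (g : Fin n → Fin n → ℕ) (S : Finset (Fin n)) : Prop :=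
  ∀ i ∈ S, ∀ j ∉ S, g i j = 0

open Stmt

namespace Stmt

/-- Mark the end of a positive entry as visited if the start is visited. -/
def reachStep : Stmt :=
  ite (.conj (.natLe (.lit 1) (.vec 42 13))
      (.conj (.natLe (.vec 42 14) (.lit 0)) (.natLe (.lit 1) (.mat 40 13 14))))
    (nat 42 (.var 14) (.lit 0) (.lit 1) ;; nat 43 (.var 14) (.lit 0) (.var 13)) skip

/-- Visit the nodes that are reachable from `41` along the positive entries of the matrix `40`;
the visited nodes are marked in `42`, and `43` contains predecessors. -/
def reach : Stmt :=
  (fillVec 42 0 ;; nat 42 (.var 41) (.lit 0) (.lit 1)) ;; .forLt 12 (.forLt 13 (.forLt 14 reachStep))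

/-- A sweep over all pairs either finds a new node or certifies that the visited set is closed, so
`n` sweeps suffice. -/
theorem den_reach {σ : State} {n : ℕ} (hn : σ.nat 0 0 0 = n) {src : Fin n}
    (hsrc : σ.nat 41 0 0 = src) : ∃ S ρ, Closed (σ.mat n 40) S ∧
      Search (σ.mat n 40) src ((reach.den σ).nat 42) ((reach.den σ).nat 43) S ρ := by
  rw [reach, den_seq]
  set σ₀ := (fillVec 42 0 ;; nat 42 (.var 41) (.lit 0) (.lit 1)).den σ with hσ₀
  have hf : ∀ B, (fillVec 42 0 ;; nat 42 (.var 41) (.lit 0) (.lit 1)).natW B = false →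
      σ₀.nat B = σ.nat B := fun B hB => den_nat _ hB σ
  have h40 : σ.mat n 40 = fun i j : Fin n => σ₀.nat 40 i j := by
    funext i j
    rw [State.mat, hf 40 rfl]
  set g := σ.mat n 40
  have hn0 : σ₀.nat 0 0 0 = n := by rw [hf 0 rfl, hn]
  have hinit : Search g src (σ₀.nat 42) (σ₀.nat 43) {src} (fun _ => 0) := by
    refine ⟨fun i => ?_, by simp, rfl, by simp, by simp⟩
    rw [hσ₀, den_seq, den_natStmt, State.setN_nat_apply, den_fillVec hn (by simp)]
    have : ((fillVec 42 0).den σ).nat 41 0 0 = src := by rw [den_nat _ rfl, hsrc]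
    simp only [NExpr.eval_var, this, NExpr.eval, true_and, and_true, Finset.mem_singleton,
      Fin.ext_iff]
  let J : ℕ → State → Prop := fun k τ => ∃ S ρ, Search g src (τ.nat 42) (τ.nat 43) S ρ ∧
    (k < S.card ∨ Closed g S)
  refine Exists.elim (den_for (c := 12) (P := .forLt 13 (.forLt 14 reachStep)) hn0 J ⟨_, _, hinit, Or.inl (by simp)⟩ ?_) ?_
  rotate_left
  · rintro τ ⟨⟨S, ρ, hS, h⟩, -, -, he⟩
    rw [he]
    refine ⟨S, ρ, ?_, by simpa using hS⟩
    rcases h with h | h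
    · exact absurd (Finset.card_le_univ S) (by simpa using h)
    · exact h
  intro k hk τ hτ _ hJ
  have hn1 : (τ.setN 12 0 0 k).nat 0 0 0 = n := by
    rw [State.setN_nat_of_ne _ _ _ _ (by simp), hτ 0 rfl, hn0]
  -- Within a sweep: either it has already gained a node, or no positive entry leads out of the
  -- visited set among the pairs examined so far.
  let K : ℕ → ℕ → State → Prop := fun a b τ => ∃ S ρ, Search g src (τ.nat 42) (τ.nat 43) S ρ ∧
    (k + 1 < S.card ∨ (k < S.card ∨ Closed g S) ∧
      ∀ i ∈ S, ∀ j ∉ S, (i : ℕ) < a ∨ (i : ℕ) = a ∧ (j : ℕ) < b → g i j = 0)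
  refine Exists.elim (den_for_for (c := 13) (d := 14) (P := reachStep) hn1 rfl (by simp) rfl K ?_ ?_
    ?_ ?_) ?_
  rotate_right
  · rintro τ' ⟨⟨S, ρ, hS, h⟩, -, -, he⟩
    rw [he]
    refine ⟨S, ρ, by simpa using hS, ?_⟩
    rcases h with h | ⟨-, h⟩
    · exact Or.inl h
    · exact Or.inr fun i hi j hj => h i hi j hj (Or.inl i.2)
  · obtain ⟨S, ρ, hS, h⟩ := hJ
    exact ⟨S, ρ, by simpa using hS, Or.inr ⟨h, by simp⟩⟩
  · rintro a ha b hb τ' hτ' - ⟨S, ρ, hS, h⟩ h13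
    let i : Fin n := ⟨a, ha⟩
    let j : Fin n := ⟨b, hb⟩
    have hg : ∀ x y, τ'.nat 40 x y = σ₀.nat 40 x y := by
      intro x y
      rw [hτ' 40 rfl, State.setN_nat_of_ne _ _ _ _ (by simp), hτ 40 rfl]
    have hvi := hS.vis_eq i
    have hvj := hS.vis_eq j
    have hgij : g i j = σ₀.nat 40 a b := by rw [h40]
    by_cases hstep : i ∈ S ∧ j ∉ S ∧ 0 < g i j
    · rw [reachStep, den_ite_pos]
      · refine ⟨_, _, hS.insert hstep.1 hstep.2.1 hstep.2.2 (fun z => ?_) (fun z => ?_), ?_⟩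
        · simp [State.setN_nat_apply, Fin.ext_iff, j]
        · simp [State.setN_nat_apply, Fin.ext_iff, i, j, h13]
        · left
          rw [Finset.card_insert_of_notMem hstep.2.1]
          rcases h with h | ⟨h | h, -⟩
          · omega
          · omega
          · exact absurd (h i hstep.1 j hstep.2.1) hstep.2.2.ne'
      · rw [if_pos hstep.1] at hvi
        rw [if_neg hstep.2.1] at hvj
        simp only [Test.Holds, NExpr.eval, NExpr.eval_vec, NExpr.eval_mat]
        simp only [ne_eq, Nat.reduceEqDiff, not_false_eq_true,
          State.setN_nat_of_ne, h13, State.setN_nat_self, hg, ← hgij]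
        exact ⟨hvi.ge, hvj.le, hstep.2.2⟩
    · rw [reachStep, den_ite_neg]
      · refine ⟨S, ρ, by simpa using hS, ?_⟩
        refine h.imp id fun h => ⟨h.1, fun x hx y hy hxy => ?_⟩
        by_cases hlast : x = i ∧ y = j
        · obtain ⟨rfl, rfl⟩ := hlast
          by_contra hpos
          exact hstep ⟨hx, hy, Nat.pos_of_ne_zero hpos⟩
        · refine h.2 x hx y hy ?_
          simp only [Fin.ext_iff, i, j] at hlast
          omega
      · simp only [Test.Holds, NExpr.eval, NExpr.eval_vec, NExpr.eval_mat]
        simp only [ne_eq, Nat.reduceEqDiff, not_false_eq_true,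
          State.setN_nat_of_ne, h13, State.setN_nat_self, hg, ← hgij]
        rintro ⟨h1, h2, h3⟩
        refine hstep ⟨?_, ?_, h3⟩
        · by_contra hi
          rw [if_neg hi] at hvi
          simp only [i] at hvi
          omega
        · intro hj
          rw [if_pos hj] at hvj
          simp only [j] at hvj
          omega
  · rintro a τ x ⟨S, ρ, hS, h⟩
    exact ⟨S, ρ, by simpa using hS, h⟩
  · rintro a τ x ⟨S, ρ, hS, h⟩
    refine ⟨S, ρ, by simpa using hS, h.imp id fun h => ⟨h.1, fun i hi j hj hij => ?_⟩⟩
    have := j.2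
    exact h.2 i hi j hj (by omega)

end Stmt

end RAM

/-! ### Loops over the tree edges and their fundamental cuts. -/

namespace RAM

open Stmt TreeCut

open Classical in
/-- The tree, the terminals and a root are stored in the memory. -/
structure Ready {n : ℕ} (T : SimpleGraph (Fin n)) (V : Finset (Fin n)) (v : Fin n) (σ : State) :
    Prop where
  size : σ.nat 0 0 0 = n
  adj : ∀ i j : Fin n, σ.nat 1 i j = if T.Adj i j then 1 else 0
  term : ∀ i : Fin n, σ.nat 2 i 0 = if i ∈ V then 1 else 0
  root : σ.nat 44 0 0 = v

namespace Ready

variable {n : ℕ} {T : SimpleGraph (Fin n)} {V : Finset (Fin n)} {v : Fin n} {σ τ : State}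

theorem congr (h : Ready T V v σ) (h0 : τ.nat 0 = σ.nat 0) (h1 : τ.nat 1 = σ.nat 1)
    (h2 : τ.nat 2 = σ.nat 2) (h3 : τ.nat 44 = σ.nat 44) : Ready T V v τ :=
  ⟨by rw [h0, h.size], fun i j => by rw [h1, h.adj], fun i => by rw [h2, h.term],
    by rw [h3, h.root]⟩

theorem den (h : Ready T V v σ) (P : Stmt) (h0 : P.natW 0 = false) (h1 : P.natW 1 = false)
    (h2 : P.natW 2 = false) (h3 : P.natW 44 = false) : Ready T V v (P.den σ) :=
  h.congr (den_nat P h0 σ) (den_nat P h1 σ) (den_nat P h2 σ) (den_nat P h3 σ)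

theorem setN (h : Ready T V v σ) {A : ℕ} (i j x : ℕ) (h0 : 0 ≠ A) (h1 : 1 ≠ A) (h2 : 2 ≠ A)
    (h3 : 44 ≠ A) : Ready T V v (σ.setN A i j x) :=
  h.congr (σ.setN_nat_of_ne _ _ _ h0) (σ.setN_nat_of_ne _ _ _ h1) (σ.setN_nat_of_ne _ _ _ h2)
    (σ.setN_nat_of_ne _ _ _ h3)

end Ready

theorem Search.mem_iff {n : ℕ} {g : Fin n → Fin n → ℕ} {src : Fin n} {vis pred : ℕ → ℕ → ℕ}
    {S : Finset (Fin n)} {ρ : Fin n → ℕ} (h : Search g src vis pred S ρ) (hS : Closed g S)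
    {G : SimpleGraph (Fin n)} (hg : ∀ i j, 0 < g i j ↔ G.Adj i j) (i : Fin n) :
    i ∈ S ↔ G.Reachable src i := by
  constructor
  · intro hi
    induction hk : ρ i using Nat.strong_induction_on generalizing i with
    | _ k ih =>
      by_cases hs : i = src
      · rw [hs]
      · obtain ⟨p, hp, -, h3, h4⟩ := h.pred_eq i hi hs
        exact (ih (ρ p) (by omega) p hp rfl).trans ((hg p i).1 h4).reachable
  · rintro ⟨w⟩
    have key : ∀ {a b : Fin n} (w : G.Walk a b), a ∈ S → b ∈ S := by
      intro a b w
      induction w with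
      | nil => exact id
      | @cons a b c hab _ ih =>
        intro ha
        refine ih ?_
        by_contra hb
        exact ((hg a b).2 hab).ne' (hS a ha b hb)
    exact key w h.src_mem

namespace Stmt

/-- Mark in `42` the nodes that are reachable from the root without the edge `{15, 16}`. -/
def visEdge : Stmt :=
  (fill 40 (.or (.conj (.eq (.var 10) (.var 15)) (.eq (.var 11) (.var 16)))
    (.conj (.eq (.var 10) (.var 16)) (.eq (.var 11) (.var 15)))) (.lit 0) (.mat 1 10 11) ;;
  set 41 (.var 44)) ;; reach

variable {n : ℕ} {T : SimpleGraph (Fin n)} {V : Finset (Fin n)} {v : Fin n} {σ : State}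

theorem den_visEdge (hσ : Ready T V v σ) {x y : Fin n} (hx : σ.nat 15 0 0 = x)
    (hy : σ.nat 16 0 0 = y) (i : Fin n) :
    (visEdge.den σ).nat 42 i 0 = if i ∈ side T v s(x, y) then 1 else 0 := by
  classical
  rw [visEdge, den_seq]
  set P := fill 40 (.or (.conj (.eq (.var 10) (.var 15)) (.eq (.var 11) (.var 16)))
    (.conj (.eq (.var 10) (.var 16)) (.eq (.var 11) (.var 15)))) (.lit 0) (.mat 1 10 11) with hP
  obtain ⟨S, ρ, hS, h⟩ := den_reach (σ := (P ;; set 41 (.var 44)).den σ) (n := n) (src := v)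
    (by rw [den_nat _ rfl, hσ.size])
    (by rw [den_seq, den_set, State.setN_nat_self, NExpr.eval_var, den_nat _ rfl, hσ.root])
  have h40 : ((P ;; set 41 (.var 44)).den σ).mat n 40
      = fun i j => if (T.deleteEdges {s(x, y)}).Adj i j then 1 else 0 := by
    have hfill : (P.den σ).mat n 40
        = fun i j => if (T.deleteEdges {s(x, y)}).Adj i j then 1 else 0 := by
      refine den_fill hσ.size (by simp) _ fun i j τ h1 _ h2 h3 => ?_
      simp only [SimpleGraph.deleteEdges_adj, Set.mem_singleton_iff, Sym2.eq_iff]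
      simp only [Test.holds_or, Test.Holds, Test.holds_eq, NExpr.eval_var, h2, h3, NExpr.eval,
        NExpr.eval_mat, ne_eq, Nat.reduceEqDiff, not_false_eq_true, h1, hx, hy, hσ.adj,
        Fin.val_inj]
      split_ifs <;> tauto
    rw [← hfill]
    funext i j
    simp [State.mat]
  rw [h.vis_eq]
  refine if_congr ?_ rfl rfl
  rw [mem_side]
  refine h.mem_iff hS (fun i j => ?_) i
  rw [h40]
  change (0 < if (T.deleteEdges {s(x, y)}).Adj i j then 1 else 0) ↔ _
  split_ifs with hadj <;> simp only [hadj, zero_lt_one, lt_irrefl]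

/-- Run `P` for all edges `{15, 16}`, in both directions, with the side of the root marked. -/
def forEdges (P : Stmt) : Stmt :=
  .forLt 15 (.forLt 16 (ite (.natLe (.lit 1) (.mat 1 15 16)) (visEdge ;; P) skip))

theorem natW_forEdges (P : Stmt) (A : ℕ) :
    (forEdges P).natW A = ((forEdges skip).natW A || P.natW A) := by
  simp [forEdges, natW, Bool.or_assoc]

open Classical in
/-- The pairs of adjacent nodes. -/
noncomputable def arcs (T : SimpleGraph (Fin n)) : Finset (Fin n × Fin n) :=
  Finset.univ.filter fun p => T.Adj p.1 p.2

theorem mem_arcs {x y : Fin n} : (x, y) ∈ arcs T ↔ T.Adj x y := by simp [arcs]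

/-- The invariant is indexed by the arcs treated so far, so users need not deal with the order. It
has to survive changes of the arrays used by the loop and the search themselves. Every tree edge is
met as two arcs. -/
theorem den_forEdges {P : Stmt} (hσ : Ready T V v σ)
    (hW : P.natW 0 = false ∧ P.natW 1 = false ∧ P.natW 2 = false ∧ P.natW 44 = false ∧
      P.natW 15 = false)
    (Inv : Finset (Fin n × Fin n) → State → Prop) (h0 : Inv ∅ σ)
    (hstable : ∀ S τ τ', (∀ B, (forEdges skip).natW B = false → τ'.nat B = τ.nat B) →
      τ'.real = τ.real → Inv S τ → Inv S τ')
    (hs : ∀ x y, T.Adj x y → ∀ S, (x, y) ∉ S → ∀ τ, Ready T V v τ →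
      (∀ B, (forEdges P).natW B = false → τ.nat B = σ.nat B) →
      (∀ B, P.realW B = false → τ.real B = σ.real B) → τ.nat 15 0 0 = x → τ.nat 16 0 0 = y →
      (∀ i : Fin n, τ.nat 42 i 0 = if i ∈ side T v s(x, y) then 1 else 0) → Inv S τ →
      Inv (insert (x, y) S) (P.den τ)) :
    Inv (arcs T) ((forEdges P).den σ) := by
  classical
  obtain ⟨w0, w1, w2, w44, w15⟩ := hW
  let D : ℕ → ℕ → Finset (Fin n × Fin n) := fun a b => (arcs T).filter fun p =>
    (p.1 : ℕ) < a ∨ (p.1 : ℕ) = a ∧ (p.2 : ℕ) < b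
  have hframe : ∀ A, P.natW A = false → (forEdges skip).natW A = false →
      (forEdges P).natW A = false := fun A h1 h2 => by rw [natW_forEdges, h1, h2]; rfl
  have hset : ∀ (S) (τ : State) (c k : ℕ), c = 15 ∨ c = 16 → Inv S τ → Inv S (τ.setN c 0 0 k) := by
    intro S τ c k hc h
    refine hstable S τ _ (fun B hB => State.setN_nat_of_ne _ _ _ _ ?_) rfl h
    rintro rfl
    rcases hc with rfl | rfl <;> exact absurd hB (by decide)
  refine Exists.elim (den_for_for (c := 15) (d := 16) hσ.size
    (P := ite (.natLe (.lit 1) (.mat 1 15 16)) (visEdge ;; P) skip) ?_ (by simp) ?_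
    (fun a b τ => Inv (D a b) τ) ?_ ?_ ?_ ?_) ?_
  · simp only [natW, w15]
    rfl
  · simp only [natW, w0]
    rfl
  · have hD : D 0 0 = ∅ := by simp [D]
    rw [hD]
    exact h0
  · intro a ha b hb τ hτ hτr hI h15
    let x : Fin n := ⟨a, ha⟩
    let y : Fin n := ⟨b, hb⟩
    have hready : Ready T V v τ := hσ.congr (hτ 0 (hframe 0 w0 rfl))
      (hτ 1 (hframe 1 w1 rfl)) (hτ 2 (hframe 2 w2 rfl)) (hτ 44 (hframe 44 w44 rfl))
    have hready' := hready.setN (A := 16) 0 0 b (by simp) (by simp) (by simp) (by simp)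
    have h15' : (τ.setN 16 0 0 b).nat 15 0 0 = x := by simp [h15, x]
    have h16' : (τ.setN 16 0 0 b).nat 16 0 0 = y := by simp [y]
    have htest : (Test.natLe (.lit 1) (.mat 1 15 16)).Holds (τ.setN 16 0 0 b) ↔ T.Adj x y := by
      simp only [Test.Holds, NExpr.eval, NExpr.eval_mat, h15', h16', hready'.adj]
      split_ifs with h <;> simp [h]
    by_cases hxy : T.Adj x y
    · rw [den_ite_pos (htest.2 hxy), den_seq]
      have hD : D a (b + 1) = insert (x, y) (D a b) := by
        ext ⟨p, q⟩
        simp only [D, Finset.mem_filter, Finset.mem_insert, Prod.mk.injEq, mem_arcs, Fin.ext_iff,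
          x, y]
        constructor
        · rintro ⟨h1, h2⟩
          by_cases h : (p : ℕ) = a ∧ (q : ℕ) = b
          · exact Or.inl h
          · exact Or.inr ⟨h1, by omega⟩
        · rintro (⟨h1, h2⟩ | ⟨h1, h2⟩)
          · have e1 : p = x := Fin.ext h1
            have e2 : q = y := Fin.ext h2
            exact ⟨by rw [e1, e2]; exact hxy, by omega⟩
          · exact ⟨h1, by omega⟩
      rw [hD]
      have hvis : ∀ B, B ≠ 16 → visEdge.natW B = false →
          (visEdge.den (τ.setN 16 0 0 b)).nat B = τ.nat B := fun B hB hB' => by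
        rw [den_nat _ hB', State.setN_nat_of_ne _ _ _ _ hB]
      refine hs x y hxy _ (by simp [D, x, y]) _ (hready'.den _ rfl rfl rfl rfl) (fun B hB => ?_)
        (fun B hB => ?_) ?_ ?_ (den_visEdge hready' h15' h16') ?_
      · rw [hvis, hτ B hB]
        · rintro rfl
          simp [forEdges, natW] at hB
        · simp only [forEdges, natW, Bool.or_eq_false_iff] at hB
          exact hB.2.2.1.1
      · rw [den_real _ rfl, State.setN_real, hτr]
        simp only [realW, hB]
        rfl
      · rw [den_nat _ rfl, h15']
      · rw [den_nat _ rfl, h16']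
      · refine hstable _ τ _ (fun B hB => hvis B ?_ ?_) ?_ hI
        · rintro rfl
          simp [forEdges, natW] at hB
        · simp only [forEdges, natW, Bool.or_eq_false_iff] at hB
          exact hB.2.2.1.1
        · funext B
          rw [den_real _ rfl, State.setN_real]
    · rw [den_ite_neg (mt htest.1 hxy), den_skip]
      have hD : D a (b + 1) = D a b := by
        refine Finset.filter_congr fun p hp => ?_
        rw [← Prod.mk.eta (p := p), mem_arcs] at hp
        have : ¬ ((p.1 : ℕ) = a ∧ (p.2 : ℕ) = b) := by
          rintro ⟨h1, h2⟩
          have e1 : p.1 = x := Fin.ext h1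
          have e2 : p.2 = y := Fin.ext h2
          exact hxy (e1 ▸ e2 ▸ hp)
        omega
      rw [hD]
      exact hset _ _ _ _ (Or.inr rfl) hI
  · exact fun a τ k h => hset _ _ _ _ (Or.inl rfl) h
  · intro a τ k h
    have hD : D (a + 1) 0 = D a n := by
      refine Finset.filter_congr fun p hp => ?_
      have := p.2.2
      omega
    rw [hD]
    exact hset _ _ _ _ (Or.inr rfl) h
  · rintro τ ⟨h, -, -, he⟩
    rw [forEdges, he]
    have hD : D n 0 = arcs T := Finset.filter_true_of_mem fun p _ => Or.inl p.1.2
    rw [hD] at h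
    exact hset _ _ _ _ (Or.inl rfl) h

/-- Store a terminal in `44`. -/
def findRoot : Stmt := .forLt 12 (ite (.natLe (.lit 1) (.vec 2 12)) (set 44 (.var 12)) skip)

open Classical in
theorem den_findRoot (hn : σ.nat 0 0 0 = n) (hV : V.Nonempty)
    (hterm : ∀ i : Fin n, σ.nat 2 i 0 = if i ∈ V then 1 else 0) :
    ∃ v ∈ V, (findRoot.den σ).nat 44 0 0 = v := by
  refine Exists.elim (den_for (c := 12) hn (P := ite (.natLe (.lit 1) (.vec 2 12))
    (set 44 (.var 12)) skip) (fun k τ => (∃ i ∈ V, (i : ℕ) < k) → ∃ v ∈ V, τ.nat 44 0 0 = v)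
    (by simp) ?_) ?_
  · rintro k hk τ hτ - ih ⟨i, hi, hik⟩
    have h2 : (τ.setN 12 0 0 k).nat 2 k 0 = if (⟨k, hk⟩ : Fin n) ∈ V then 1 else 0 := by
      rw [State.setN_nat_of_ne _ _ _ _ (by simp), hτ 2 rfl, ← hterm ⟨k, hk⟩]
    by_cases hkV : (⟨k, hk⟩ : Fin n) ∈ V
    · rw [den_ite_pos]
      · exact ⟨⟨k, hk⟩, hkV, by simp⟩
      · simp only [Test.Holds, NExpr.eval, NExpr.eval_vec, State.setN_nat_self, h2, if_pos hkV,
          le_refl]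
    · rw [den_ite_neg]
      · simp only [den_skip, ne_eq, Nat.reduceEqDiff, not_false_eq_true, State.setN_nat_of_ne]
        refine ih ⟨i, hi, lt_of_le_of_ne (Nat.lt_succ_iff.1 hik) ?_⟩
        rintro rfl
        exact hkV hi
      · simp only [Test.Holds, NExpr.eval, NExpr.eval_vec, State.setN_nat_self, h2, if_neg hkV]
        simp
  · rintro τ ⟨h, -, -, he⟩
    obtain ⟨i, hi⟩ := hV
    rw [findRoot, he, State.setN_nat_of_ne _ _ _ _ (by simp)]
    exact h ⟨i, hi, i.2⟩

end Stmt

end RAM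

/-! ### Augmentation of flows in residual matrices. -/

namespace SplittingOff

variable {N : Type u} [Fintype N] [DecidableEq N]

/-- Moving a unit of residual capacity from the arc `pz` to the arc `zp`. -/
theorem cut_augment {g g' : N → N → ℕ} {p z : N} (hpz : p ≠ z) (hpos : 0 < g p z)
    (hg' : ∀ x y, g' x y = if x = z ∧ y = p then g z p + 1 else if x = p ∧ y = z then g p z - 1
      else g x y) (X : Finset N) :
    cut g' X + (if p ∈ X then 1 else 0) = cut g X + (if z ∈ X then 1 else 0) := by
  have hone : ∀ c d : N, cut (fun x y => if x = c ∧ y = d then 1 else 0) X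
      = if c ∈ X ∧ d ∉ X then 1 else 0 := by
    intro c d
    simp only [cut, between, ite_and, Finset.sum_ite_eq', Finset.sum_ite_irrel,
      Finset.sum_const_zero, Finset.mem_compl]
  have h : cut (fun x y => g' x y + if x = p ∧ y = z then 1 else 0) X
      = cut (fun x y => g x y + if x = z ∧ y = p then 1 else 0) X := by
    congr 1
    funext x y
    rw [hg']
    split_ifs with h1 h2 h2
    · exact absurd (h1.1.symm.trans h2.1) hpz.symm
    · rw [h1.1, h1.2]
    · rw [h2.1, h2.2]; omega
    · rfl
  rw [cut_add, cut_add, hone, hone] at h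
  by_cases h1 : p ∈ X <;> by_cases h2 : z ∈ X <;> simp [h1, h2] at h ⊢ <;> omega

end SplittingOff

namespace RAM

open Stmt SplittingOff

namespace Stmt

/-- Run `P` as often as the cube of the bound says. -/
def cube (c : ℕ) (P : Stmt) : Stmt := .forLt c (.forLt (c + 1) (.forLt (c + 2) P))

/-- The three nested counters act as a single counter up to `n ^ 3`. -/
theorem den_cube {c : ℕ} {P : Stmt} {σ : State} {n : ℕ} (hn : σ.nat 0 0 0 = n)
    (hW : (cube c P).natW 0 = false) (Inv : ℕ → State → Prop) (h0 : Inv 0 σ)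
    (hstable : ∀ m τ τ', (∀ B, (cube c skip).natW B = false → τ'.nat B = τ.nat B) →
      τ'.real = τ.real → Inv m τ → Inv m τ')
    (hs : ∀ m < n ^ 3, ∀ τ, (∀ B, (cube c P).natW B = false → τ.nat B = σ.nat B) →
      (∀ B, P.realW B = false → τ.real B = σ.real B) → Inv m τ → Inv (m + 1) (P.den τ)) :
    Inv (n ^ 3) ((cube c P).den σ) := by
  have hset : ∀ m τ A x, A = c ∨ A = c + 1 ∨ A = c + 2 → Inv m τ → Inv m (τ.setN A 0 0 x) := by
    intro m τ A x hA h
    refine hstable m τ _ (fun B hB => State.setN_nat_of_ne _ _ _ _ ?_) rfl h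
    rintro rfl
    simp only [cube, natW, Bool.or_eq_false_iff] at hB
    rcases hA with rfl | rfl | rfl
    · simp at hB
    · simp at hB
    · simp at hB
  have hW' := hW
  simp only [cube, natW, Bool.or_eq_false_iff] at hW'
  have hc0 : 0 ≠ c := by rintro rfl; simp at hW'
  -- One loop whose body advances the joint counter by `s`; it is applied with `s` equal to `n ^ 2`,
  -- `n` and 1.
  have hex : ∀ (d : ℕ) (Q : Stmt) (σ' : State), (∀ B, (cube c P).natW B = false →
      σ'.nat B = σ.nat B) → (∀ B, P.realW B = false → σ'.real B = σ.real B) →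
      (∀ B, (Stmt.forLt d Q).natW B = true → (cube c P).natW B = true) →
      (∀ B, Q.realW B = true → P.realW B = true) →
      (d = c ∨ d = c + 1 ∨ d = c + 2) → ∀ s m₀ : ℕ, m₀ + n * s ≤ n ^ 3 → Inv m₀ σ' →
      (∀ m τ, m + s ≤ n ^ 3 → (∀ B, (cube c P).natW B = false → τ.nat B = σ.nat B) →
        (∀ B, P.realW B = false → τ.real B = σ.real B) → Inv m τ → Inv (m + s) (Q.den τ)) →
      Inv (m₀ + n * s) ((Stmt.forLt d Q).den σ') := by
    intro d Q σ' h1 h2 h3 h4 hd s m₀ hm hI hstep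
    refine Exists.elim (den_for (c := d) (P := Q) ((congrFun (congrFun (h1 0 hW) 0) 0).trans hn)
      (fun k τ => Inv (m₀ + k * s) τ) (by simpa using hI) ?_) ?_
    · intro k hk τ g1 g2 g3
      have h5 : ∀ B, (cube c P).natW B = false → (Stmt.forLt d Q).natW B = false := by
        intro B hB
        by_contra h
        rw [Bool.not_eq_false] at h
        rw [h3 B h] at hB
        exact absurd hB (by simp)
      have h6 : ∀ B, P.realW B = false → Q.realW B = false := by
        intro B hB
        by_contra h
        rw [Bool.not_eq_false] at h
        rw [h4 B h] at hB
        exact absurd hB (by simp)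
      have hle : m₀ + k * s + s ≤ n ^ 3 := by
        refine le_trans ?_ hm
        have := Nat.mul_le_mul_right s (Nat.succ_le_of_lt hk)
        rw [Nat.succ_mul] at this
        omega
      have := hstep (m₀ + k * s) (τ.setN d 0 0 k) hle (fun B hB => ?_) (fun B hB => ?_)
        (hset _ _ _ _ hd g3)
      · rw [add_assoc, ← Nat.succ_mul] at this
        exact this
      · rw [State.setN_nat_of_ne, g1 B (h5 B hB), h1 B hB]
        rintro rfl
        have := h5 B hB
        simp [natW] at this
      · rw [State.setN_real, g2 B (h6 B hB), h2 B hB]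
    · rintro τ ⟨g1, -, -, g4⟩
      rw [g4]
      exact hset _ _ _ _ hd g1
  have hfin := hex c (.forLt (c + 1) (.forLt (c + 2) P)) σ (fun _ _ => rfl) (fun _ _ => rfl)
    (fun B hB => hB) (fun B hB => hB) (Or.inl rfl) (n * (n * 1)) 0 (by ring_nf; rfl) h0
    (fun m τ hm h1 h2 h3 => hex (c + 1) (.forLt (c + 2) P) τ h1 h2
      (fun B hB => by simp only [cube, natW, Bool.or_eq_true] at *; tauto) (fun B hB => hB)
      (Or.inr (Or.inl rfl)) (n * 1) m hm h3 fun m τ hm h1 h2 h3 =>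
        hex (c + 2) P τ h1 h2 (fun B hB => by simp only [cube, natW, Bool.or_eq_true] at *; tauto)
          (fun B hB => hB) (Or.inr (Or.inr rfl)) 1 m hm h3 fun m τ hm h1 h2 h3 =>
            hs m (by omega) τ h1 h2 h3)
  have : 0 + n * (n * (n * 1)) = n ^ 3 := by ring
  rw [this] at hfin
  exact hfin

/-- The step from `59` to its predecessor. -/
def traceStep : Stmt :=
  ite (.eq (.var 59) (.var 41)) skip
    (set 60 (.get 43 (.var 59) (.lit 0)) ;;
      nat 40 (.var 60) (.var 59) (.sub (.mat 40 60 59) (.lit 1)) ;;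
      nat 40 (.var 59) (.var 60) (.add (.mat 40 59 60) (.lit 1)) ;; set 59 (.var 60))

/-- Augment the flow along the path from `41` to `19`. -/
def trace : Stmt := set 59 (.var 19) ;; .forLt 17 traceStep

/-- The path is followed backwards from `y`. Entries between nodes that are at most as deep as the
current one are still unchanged, so the next entry is positive as the search found it. Depths are
below `n`, so `n` steps reach the source. The effects on a cut telescope to its two ends. -/
theorem den_trace {σ : State} {n : ℕ} (hn : σ.nat 0 0 0 = n) {src y : Fin n}
    (hsrc : σ.nat 41 0 0 = src) (hy : σ.nat 19 0 0 = y) {S : Finset (Fin n)} {ρ : Fin n → ℕ}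
    (h : Search (σ.mat n 40) src (σ.nat 42) (σ.nat 43) S ρ) (hyS : y ∈ S) (X : Finset (Fin n)) :
    cut ((trace.den σ).mat n 40) X + (if src ∈ X then 1 else 0)
      = cut (σ.mat n 40) X + (if y ∈ X then 1 else 0) := by
  rw [trace, den_seq, den_set]
  refine Exists.elim (den_for (c := 17) (σ := σ.setN 59 0 0 ((NExpr.var 19).eval σ)) (n := n)
    (P := traceStep) (by simpa using hn)
    (fun k τ => ∃ z ∈ S, τ.nat 59 0 0 = z ∧ (ρ z + k ≤ ρ y ∨ z = src) ∧
      (∀ X, cut (τ.mat n 40) X + (if z ∈ X then 1 else 0)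
        = cut (σ.mat n 40) X + (if y ∈ X then 1 else 0)) ∧
      ∀ a b, ρ a ≤ ρ z → ρ b ≤ ρ z → τ.mat n 40 a b = σ.mat n 40 a b) ?_ ?_) ?_
  · exact ⟨y, hyS, by simp [hy], Or.inl le_rfl, fun _ => rfl, fun _ _ _ _ => rfl⟩
  · rintro k hk τ hτ - ⟨z, hz, h59, hρ, hcut, hsame⟩
    have h41 : (τ.setN 17 0 0 k).nat 41 0 0 = src := by
      rw [State.setN_nat_of_ne _ _ _ _ (by simp), hτ 41 rfl]
      simpa using hsrc
    have h59' : (τ.setN 17 0 0 k).nat 59 0 0 = z := by simpa using h59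
    by_cases hzs : z = src
    · rw [traceStep, den_ite_pos]
      · refine ⟨z, hz, by simpa using h59, Or.inr hzs, fun X => ?_, fun a b ha hb => ?_⟩
        · rw [← hcut X]
          rfl
        · exact hsame a b ha hb
      · rw [Test.holds_eq, NExpr.eval_var, NExpr.eval_var, h41, h59', hzs]
    · rw [traceStep, den_ite_neg]
      · obtain ⟨p, hp, hpred, hpz, hpos⟩ := h.pred_eq z hz hzs
        have hpz' : p ≠ z := by
          rintro rfl
          omega
        have h43 : τ.nat 43 z 0 = p := by
          rw [hτ 43 rfl]
          simpa using hpred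
        have hmat : ∀ a b : Fin n, ((set 60 (.get 43 (.var 59) (.lit 0)) ;;
            nat 40 (.var 60) (.var 59) (.sub (.mat 40 60 59) (.lit 1)) ;;
            nat 40 (.var 59) (.var 60) (.add (.mat 40 59 60) (.lit 1)) ;;
            set 59 (.var 60)).den (τ.setN 17 0 0 k)).mat n 40 a b
            = if a = z ∧ b = p then τ.mat n 40 z p + 1 else if a = p ∧ b = z then
              τ.mat n 40 p z - 1 else τ.mat n 40 a b := by
          intro a b
          have hne : ¬ ((z : ℕ) = p ∧ (p : ℕ) = z) := fun h => hpz' (Fin.ext h.2)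
          simp only [State.mat, den_seq, den_set, den_natStmt, NExpr.eval, NExpr.eval_var,
            NExpr.eval_mat, State.setN_nat_self, ne_eq, Nat.reduceEqDiff, not_false_eq_true,
            State.setN_nat_of_ne, h59, h43]
          simp only [State.setN_nat_apply, ne_eq, Nat.reduceEqDiff, not_false_eq_true, true_and,
            Fin.ext_iff, false_and, if_false, hne]
        refine ⟨p, hp, ?_, ?_, fun X => ?_, fun a b ha hb => ?_⟩
        · simp [h59, h43]
        · rcases hρ with hρ | hρ
          · left; omega
          · exact absurd hρ hzs
        · rw [← hcut X]
          refine cut_augment hpz' ?_ hmat X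
          rw [hsame p z (by omega) le_rfl]
          exact hpos
        · rw [hmat, if_neg, if_neg, hsame a b (by omega) (by omega)]
          · rintro ⟨rfl, rfl⟩
            omega
          · rintro ⟨rfl, rfl⟩
            omega
      · rw [Test.holds_eq, NExpr.eval_var, NExpr.eval_var, h41, h59', Fin.val_inj]
        exact hzs
  · rintro τ ⟨⟨z, hz, -, hρ, hcut, -⟩, -, -, he⟩
    have hzs : z = src := by
      rcases hρ with hρ | hρ
      · have h1 := h.rank_lt y hyS
        have h2 := Finset.card_le_univ S
        rw [Fintype.card_fin] at h2
        omega
      · exact hρ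
    rw [he, ← hcut X, hzs]
    rfl

end Stmt

end RAM

/-! ### Testing the connectivity requirements by maximum flows. -/

namespace RAM

open Stmt SplittingOff

namespace Stmt

/-- Copy the matrix `B` to `A`. -/
def copy (A B : ℕ) : Stmt := fill A (.natLe (.lit 0) (.lit 0)) (.mat B 10 11) (.lit 0)

theorem den_copy {A B : ℕ} {σ : State} {n : ℕ} (hn : σ.nat 0 0 0 = n)
    (hA : A ≠ 0 ∧ A ≠ 10 ∧ A ≠ 11) (hB : B ≠ A ∧ B ≠ 10 ∧ B ≠ 11) :
    ((copy A B).den σ).mat n A = σ.mat n B := by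
  refine den_fill hn hA _ fun i j τ h1 _ h2 h3 => ?_
  simp [h2, h3, h1 B hB.1 hB.2.1 hB.2.2, State.mat]

/-- Increase the flow from `18` to `19`, or store in `57` that the requirement is not satisfied. -/
def checkStep : Stmt :=
  ite (.natLe (.add (.var 58) (.lit 1)) (.mat 54 18 19))
    (set 58 (.add (.var 58) (.lit 1)) ;; reach ;;
      ite (.natLe (.lit 1) (.vec 42 19)) trace (set 57 (.lit 0))) skip

/-- Check the requirement between `18` and `19`. -/
def checkPair : Stmt := (copy 40 56 ;; set 41 (.var 18) ;; set 58 (.lit 0)) ;; cube 20 checkStep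

/-- Check whether the matrix `56` satisfies the requirements `54` between the nodes in `55`. -/
def check : Stmt :=
  set 57 (.lit 1) ;; .forLt 18 (.forLt 19 (ite (.conj (.natLe (.lit 1) (.vec 55 18))
    (.conj (.natLe (.lit 1) (.vec 55 19)) (.neg (.eq (.var 18) (.var 19))))) checkPair skip))

variable {n : ℕ} {σ : State}

theorem checkStep_zero (h : σ.nat 57 0 0 = 0) : (checkStep.den σ).nat 57 0 0 = 0 := by
  classical
  rw [checkStep, den_ite]
  split_ifs
  · rw [den_seq, den_seq, den_ite]
    split_ifs
    · rw [den_nat _ rfl, den_nat _ rfl, den_nat _ rfl, h]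
    · simp
  · exact h

/-- For each `X` separating `x` from `y`, residual cut plus flow value remains equal to `cut g X`.
If all augmentations succeed, every such cut is at least `q x y`. If `y` is unreachable, the visited
set has residual cut 0 and hence a cut below the requirement. The bound `n ^ 3` on `q` guarantees
enough rounds. -/
theorem den_checkPair {g q : Fin n → Fin n → ℕ} {A : Finset (Fin n)} (hn : σ.nat 0 0 0 = n)
    (hg : σ.mat n 56 = g) (hq : σ.mat n 54 = q) {x y : Fin n} (hx : σ.nat 18 0 0 = x)
    (hy : σ.nat 19 0 0 = y) (hxA : x ∈ A) (hyA : y ∈ A) (hxy : x ≠ y) (hle : q x y ≤ n ^ 3)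
    (hok : σ.nat 57 0 0 = 1 ∨ σ.nat 57 0 0 = 0 ∧ ¬ Feasible q A g) :
    (σ.nat 57 0 0 = 1 ∧ (checkPair.den σ).nat 57 0 0 = 1 ∧
      ∀ X : Finset (Fin n), x ∈ X → y ∉ X → q x y ≤ cut g X) ∨
    ((checkPair.den σ).nat 57 0 0 = 0 ∧ ¬ Feasible q A g) := by
  rw [checkPair, den_seq]
  set P := copy 40 56 ;; set 41 (.var 18) ;; set 58 (.lit 0) with hP
  have hn0 : (P.den σ).nat 0 0 0 = n := by rw [den_nat _ rfl, hn]
  have h40 : (P.den σ).mat n 40 = g := by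
    rw [← hg, ← den_copy (A := 40) (B := 56) hn (by simp) (by simp)]
    funext i j
    simp [State.mat, hP]
  have h41 : (P.den σ).nat 41 0 0 = x := by
    simp only [hP, den_seq, den_set, NExpr.eval_var, ne_eq, Nat.reduceEqDiff, not_false_eq_true,
      State.setN_nat_of_ne, State.setN_nat_self]
    rw [den_nat _ rfl, hx]
  have h57 : (P.den σ).nat 57 = σ.nat 57 := den_nat _ rfl _
  have hfin := den_cube (c := 20) (P := checkStep) hn0 rfl
    (fun m τ => (σ.nat 57 0 0 = 1 ∧ τ.nat 57 0 0 = 1 ∧ τ.nat 58 0 0 = min m (q x y) ∧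
      ∀ X : Finset (Fin n), x ∈ X → y ∉ X → cut (τ.mat n 40) X + τ.nat 58 0 0 = cut g X) ∨
      (τ.nat 57 0 0 = 0 ∧ ¬ Feasible q A g)) ?_ ?_ ?_
  · rcases hfin with ⟨h1, h2, h3, h4⟩ | h
    · refine Or.inl ⟨h1, h2, fun X hX hX' => ?_⟩
      rw [← h4 X hX hX', h3, min_eq_right hle]
      exact Nat.le_add_left _ _
    · exact Or.inr h
  · rcases hok with h | h
    · refine Or.inl ⟨h, by rw [h57, h], by simp [hP], fun X _ _ => ?_⟩
      rw [h40]
      simp [hP]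
    · exact Or.inr ⟨by rw [h57, h.1], h.2⟩
  · intro m τ τ' h1 _ h
    have e40 : τ'.mat n 40 = τ.mat n 40 := by
      funext i j
      rw [State.mat, h1 40 rfl]
      rfl
    rw [h1 57 rfl, h1 58 rfl, e40]
    exact h
  · rintro m - τ hτ - (⟨h1, h2, h3, h4⟩ | ⟨h1, h2⟩)
    · have hq' : τ.mat n 54 = q := by
        rw [← hq]
        funext i j
        rw [State.mat, hτ 54 rfl, den_nat _ rfl]
        rfl
      have e18 : τ.nat 18 0 0 = x := by rw [hτ 18 rfl, den_nat _ rfl, hx]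
      have e19 : τ.nat 19 0 0 = y := by rw [hτ 19 rfl, den_nat _ rfl, hy]
      have e41 : τ.nat 41 0 0 = x := by rw [hτ 41 rfl, h41]
      have htest : (Test.natLe (.add (.var 58) (.lit 1)) (.mat 54 18 19)).Holds τ
          ↔ min m (q x y) + 1 ≤ q x y := by
        rw [← hq']
        simp only [Test.Holds, NExpr.eval, NExpr.eval_var, NExpr.eval_mat, h3, e18, e19]
        rw [← hq']
        rfl
      by_cases hlt : min m (q x y) + 1 ≤ q x y
      · rw [checkStep, den_ite_pos (htest.2 hlt), den_seq, den_seq]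
        set τ₁ := (set 58 (.add (.var 58) (.lit 1))).den τ with hτ₁
        have f58 : τ₁.nat 58 0 0 = min (m + 1) (q x y) := by
          rw [hτ₁, den_set, State.setN_nat_self]
          simp only [NExpr.eval, NExpr.eval_var, h3]
          omega
        have fne : ∀ B, B ≠ 58 → τ₁.nat B = τ.nat B := fun B hB =>
          State.setN_nat_of_ne _ _ _ _ hB
        have f40 : τ₁.mat n 40 = τ.mat n 40 := by
          funext i j
          rw [State.mat, fne 40 (by simp)]
          rfl
        obtain ⟨S, ρ, hS, hsearch⟩ := den_reach (σ := τ₁) (n := n) (src := x)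
          (by rw [fne 0 (by simp), hτ 0 rfl, hn0]) (by rw [fne 41 (by simp), e41])
        have e40 : (reach.den τ₁).mat n 40 = τ.mat n 40 := by
          rw [← f40]
          funext i j
          rw [State.mat, den_nat _ rfl]
          rfl
        rw [f40, ← e40] at hsearch
        have e19' : (reach.den τ₁).nat 19 0 0 = y := by
          rw [den_nat _ rfl, fne 19 (by simp), e19]
        have htest' : (Test.natLe (.lit 1) (.vec 42 19)).Holds (reach.den τ₁) ↔ y ∈ S := by
          simp only [Test.Holds, NExpr.eval, NExpr.eval_vec, e19', hsearch.vis_eq]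
          split_ifs with h <;> simp [h]
        by_cases hyS : y ∈ S
        · rw [den_ite_pos (htest'.2 hyS)]
          have htr := den_trace (σ := reach.den τ₁) (n := n) (src := x) (y := y)
            (by rw [den_nat _ rfl, fne 0 (by simp), hτ 0 rfl, hn0])
            (by rw [den_nat _ rfl, fne 41 (by simp), e41]) e19' hsearch hyS
          have e58 : (trace.den (reach.den τ₁)).nat 58 0 0 = min (m + 1) (q x y) := by
            rw [den_nat _ rfl, den_nat _ rfl, f58]
          refine Or.inl ⟨h1, ?_, e58, fun X hX hX' => ?_⟩
          · rw [den_nat _ rfl, den_nat _ rfl, fne 57 (by simp), h2]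
          · have g1 := htr X
            rw [if_pos hX, if_neg hX', e40] at g1
            have g2 := h4 X hX hX'
            rw [e58]
            omega
        · rw [den_ite_neg (mt htest'.1 hyS)]
          refine Or.inr ⟨by simp, fun hf => ?_⟩
          have g1 := hf x hxA y hyA hxy S hsearch.src_mem hyS
          have g2 := h4 S hsearch.src_mem hyS
          have g3 : cut (τ.mat n 40) S = 0 := by
            rw [← f40]
            exact Finset.sum_eq_zero fun i hi => Finset.sum_eq_zero fun j hj =>
              hS i hi j (Finset.mem_compl.1 hj)
          omega
      · rw [checkStep, den_ite_neg (mt htest.1 hlt)]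
        refine Or.inl ⟨h1, h2, ?_, h4⟩
        simp only [den_skip, h3]
        omega
    · exact Or.inr ⟨checkStep_zero h1, h2⟩

theorem den_check {g q : Fin n → Fin n → ℕ} {A : Finset (Fin n)} (hn : σ.nat 0 0 0 = n)
    (hg : σ.mat n 56 = g) (hq : σ.mat n 54 = q)
    (hA : ∀ i : Fin n, σ.nat 55 i 0 = if i ∈ A then 1 else 0)
    (hle : ∀ x y, x ≠ y → q x y ≤ n ^ 3) :
    (check.den σ).nat 57 0 0 = 1 ∧ Feasible q A g ∨
      (check.den σ).nat 57 0 0 = 0 ∧ ¬ Feasible q A g := by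
  rw [check, den_seq]
  have hfr : ∀ B, B ≠ 57 → ((set 57 (.lit 1)).den σ).nat B = σ.nat B := fun B hB =>
    State.setN_nat_of_ne _ _ _ _ hB
  refine Exists.elim (den_for_for (c := 18) (d := 19) (n := n)
    (P := ite (.conj (.natLe (.lit 1) (.vec 55 18))
      (.conj (.natLe (.lit 1) (.vec 55 19)) (.neg (.eq (.var 18) (.var 19))))) checkPair skip)
    (by rw [hfr 0 (by simp), hn]) rfl (by simp) rfl
    (fun a b τ => (τ.nat 57 0 0 = 1 ∧ ∀ x ∈ A, ∀ y ∈ A, x ≠ y →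
      (x : ℕ) < a ∨ (x : ℕ) = a ∧ (y : ℕ) < b → ∀ X : Finset (Fin n), x ∈ X → y ∉ X →
        q x y ≤ cut g X) ∨ (τ.nat 57 0 0 = 0 ∧ ¬ Feasible q A g)) ?_ ?_ ?_ ?_) ?_
  · exact Or.inl ⟨by simp, by simp⟩
  · intro a ha b hb τ hτ _ hI h18
    let x : Fin n := ⟨a, ha⟩
    let y : Fin n := ⟨b, hb⟩
    have hτ' : ∀ B, B ≠ 57 → B ≠ 19 → (check.natW B = false) →
        (τ.setN 19 0 0 b).nat B = σ.nat B := by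
      intro B h1 h2 h3
      rw [State.setN_nat_of_ne _ _ _ _ h2, hτ B, hfr B h1]
      simp only [check, natW, Bool.or_eq_false_iff] at h3 ⊢
      exact h3.2
    have e18 : (τ.setN 19 0 0 b).nat 18 0 0 = x := by simpa using h18
    have e19 : (τ.setN 19 0 0 b).nat 19 0 0 = y := by simp [y]
    have htest : (Test.conj (.natLe (.lit 1) (.vec 55 18))
        (.conj (.natLe (.lit 1) (.vec 55 19)) (.neg (.eq (.var 18) (.var 19))))).Holds
          (τ.setN 19 0 0 b) ↔ x ∈ A ∧ y ∈ A ∧ x ≠ y := by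
      simp only [Test.Holds, Test.holds_eq, NExpr.eval, NExpr.eval_vec, NExpr.eval_var, e18, e19,
        hτ' 55 (by simp) (by simp) rfl, hA, Fin.val_inj]
      by_cases h1 : x ∈ A <;> by_cases h2 : y ∈ A <;> simp [h1, h2]
    by_cases hxy : x ∈ A ∧ y ∈ A ∧ x ≠ y
    · rw [den_ite_pos (htest.2 hxy)]
      have e57 : (τ.setN 19 0 0 b).nat 57 = τ.nat 57 := State.setN_nat_of_ne _ _ _ _ (by simp)
      have hpair := den_checkPair (σ := τ.setN 19 0 0 b) (g := g) (q := q) (A := A) (x := x)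
        (y := y)
        (by rw [hτ' 0 (by simp) (by simp) rfl, hn])
        (by rw [← hg]; funext i j; rw [State.mat, hτ' 56 (by simp) (by simp) rfl]; rfl)
        (by rw [← hq]; funext i j; rw [State.mat, hτ' 54 (by simp) (by simp) rfl]; rfl)
        e18 e19 hxy.1 hxy.2.1 hxy.2.2 (hle x y hxy.2.2)
        (by rw [e57]; exact hI.imp (fun h => h.1) id)
      rcases hpair with ⟨h1, h2, h3⟩ | h
      · refine Or.inl ⟨h2, fun x' hx' y' hy' hne hlt => ?_⟩
        by_cases hlast : x' = x ∧ y' = y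
        · obtain ⟨rfl, rfl⟩ := hlast
          exact h3
        · rcases hI with hI | hI
          · refine hI.2 x' hx' y' hy' hne ?_
            simp only [Fin.ext_iff, x, y] at hlast
            omega
          · rw [e57, hI.1] at h1
            omega
      · exact Or.inr h
    · rw [den_ite_neg (mt htest.1 hxy), den_skip, State.setN_nat_of_ne _ _ _ _ (by simp)]
      refine hI.imp (fun h => ⟨h.1, fun x' hx' y' hy' hne hlt => ?_⟩) id
      by_cases hlast : x' = x ∧ y' = y
      · obtain ⟨rfl, rfl⟩ := hlast
        exact absurd ⟨hx', hy', hne⟩ hxy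
      · refine h.2 x' hx' y' hy' hne ?_
        simp only [Fin.ext_iff, x, y] at hlast
        omega
  · intro a τ x h
    simpa using h
  · intro a τ x h
    rw [State.setN_nat_of_ne _ _ _ _ (by simp)]
    refine h.imp (fun h => ⟨h.1, fun x' hx' y' hy' hne hlt => h.2 x' hx' y' hy' hne ?_⟩) id
    have := y'.2
    omega
  · rintro τ ⟨h, -, -, he⟩
    rw [he, State.setN_nat_of_ne _ _ _ _ (by simp)]
    exact h.imp (fun h => ⟨h.1, fun x hx y hy hne => h.2 x hx y hy hne (Or.inl x.2)⟩) id

end Stmt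

end RAM

/-! ### Splitting off the edges at one node by trial. -/

namespace RAM

open Stmt SplittingOff TreeCut

theorem State.mat_congr {n A : ℕ} {σ τ : State} (h : τ.nat A = σ.nat A) :
    τ.mat n A = σ.mat n A := by
  funext i j
  rw [mat, mat, h]

namespace Stmt

/-- Increment an entry of a matrix. -/
def inc (A a b : ℕ) : Stmt := nat A (.var a) (.var b) (.add (.mat A a b) (.lit 1))

/-- Decrement an entry of a matrix. -/
def dec (A a b : ℕ) : Stmt := nat A (.var a) (.var b) (.sub (.mat A a b) (.lit 1))

variable {n : ℕ} {σ : State}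

theorem den_inc {A a b : ℕ} {x y : Fin n} (ha : σ.nat a 0 0 = x) (hb : σ.nat b 0 0 = y) :
    ((inc A a b).den σ).mat n A = fun i j => σ.mat n A i j + if i = x ∧ j = y then 1 else 0 := by
  funext i j
  simp only [inc, den_natStmt, State.mat, State.setN_nat_apply, NExpr.eval, NExpr.eval_var,
    NExpr.eval_mat, ha, hb, true_and, Fin.val_inj]
  split_ifs with h
  · rw [h.1, h.2]
  · rfl

theorem den_dec {A a b : ℕ} {x y : Fin n} (ha : σ.nat a 0 0 = x) (hb : σ.nat b 0 0 = y) :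
    ((dec A a b).den σ).mat n A = fun i j => σ.mat n A i j - if i = x ∧ j = y then 1 else 0 := by
  funext i j
  simp only [dec, den_natStmt, State.mat, State.setN_nat_apply, NExpr.eval, NExpr.eval_var,
    NExpr.eval_mat, ha, hb, true_and, Fin.val_inj]
  split_ifs with h
  · rw [h.1, h.2]
  · rfl

/-- Store in `56` the result of splitting off the edges `{23, 27}` and `{23, 28}` in `53`. -/
def split : Stmt :=
  copy 56 53 ;; inc 56 27 28 ;; inc 56 28 27 ;; dec 56 23 27 ;; dec 56 27 23 ;; dec 56 23 28 ;;
    dec 56 28 23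

/-- Increments precede decrements, and successive truncated subtractions amount to the single one in
`splitOff`. -/
theorem den_split {g : Fin n → Fin n → ℕ} (hn : σ.nat 0 0 0 = n) (hg : σ.mat n 53 = g)
    {s u v : Fin n} (hs : σ.nat 23 0 0 = s) (hu : σ.nat 27 0 0 = u) (hv : σ.nat 28 0 0 = v) :
    (split.den σ).mat n 56 = splitOff g s u v := by
  have hc := den_copy (A := 56) (B := 53) hn (by simp) (by simp)
  rw [hg] at hc
  have fr : ∀ (P : Stmt) B (x : Fin n), P.natW B = false → σ.nat B 0 0 = x →
      (P.den σ).nat B 0 0 = x := fun P B x h1 h2 => by rw [den_nat P h1, h2]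
  let P₀ := copy 56 53
  let P₁ := P₀ ;; inc 56 27 28
  let P₂ := P₁ ;; inc 56 28 27
  let P₃ := P₂ ;; dec 56 23 27
  let P₄ := P₃ ;; dec 56 27 23
  let P₅ := P₄ ;; dec 56 23 28
  change ((dec 56 28 23).den (P₅.den σ)).mat n 56 = _
  rw [den_dec (fr P₅ 28 v rfl hv) (fr P₅ 23 s rfl hs)]
  change (fun i j => ((dec 56 23 28).den (P₄.den σ)).mat n 56 i j - _) = _
  rw [den_dec (fr P₄ 23 s rfl hs) (fr P₄ 28 v rfl hv)]
  change (fun i j => ((dec 56 27 23).den (P₃.den σ)).mat n 56 i j - _ - _) = _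
  rw [den_dec (fr P₃ 27 u rfl hu) (fr P₃ 23 s rfl hs)]
  change (fun i j => ((dec 56 23 27).den (P₂.den σ)).mat n 56 i j - _ - _ - _) = _
  rw [den_dec (fr P₂ 23 s rfl hs) (fr P₂ 27 u rfl hu)]
  change (fun i j => ((inc 56 28 27).den (P₁.den σ)).mat n 56 i j - _ - _ - _ - _) = _
  rw [den_inc (fr P₁ 28 v rfl hv) (fr P₁ 27 u rfl hu)]
  change (fun i j => ((inc 56 27 28).den (P₀.den σ)).mat n 56 i j + _ - _ - _ - _ - _) = _
  rw [den_inc (fr P₀ 27 u rfl hu) (fr P₀ 28 v rfl hv), hc]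
  funext i j
  simp only [splitOff, single]
  omega

/-- Split off the edges `{23, 27}` and `{23, 28}` if this respects the requirements. -/
def trySplit : Stmt :=
  ite (.conj (.conj (.natLe (.lit 1) (.vec 55 27)) (.natLe (.lit 1) (.vec 55 28)))
      (.conj (.conj (.natLe (.lit 1) (.mat 53 23 27)) (.natLe (.lit 1) (.mat 53 23 28)))
        (.or (.neg (.eq (.var 27) (.var 28))) (.natLe (.lit 2) (.mat 53 23 27)))))
    ((split ;; check) ;; ite (.natLe (.lit 1) (.var 57)) (copy 53 56) skip) skip

variable {g₀ q g : Fin n → Fin n → ℕ} {A W : Finset (Fin n)} {s : Fin n}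

open Classical in
theorem den_trySplit (hn : σ.nat 0 0 0 = n) (hg : σ.mat n 53 = g) (hq : σ.mat n 54 = q)
    (hA : ∀ i : Fin n, σ.nat 55 i 0 = if i ∈ A then 1 else 0) (hsA : s ∉ A)
    (hle : ∀ x y, x ≠ y → q x y ≤ n ^ 3) (hs : σ.nat 23 0 0 = s) {u v : Fin n}
    (hu : σ.nat 27 0 0 = u) (hv : σ.nat 28 0 0 = v) :
    (trySplit.den σ).mat n 53 = if (u ∈ A ∧ v ∈ A) ∧ Splittable g s u v ∧
      Feasible q A (splitOff g s u v) then splitOff g s u v else g := by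
  have htest : (Test.conj (.conj (.natLe (.lit 1) (.vec 55 27)) (.natLe (.lit 1) (.vec 55 28)))
      (.conj (.conj (.natLe (.lit 1) (.mat 53 23 27)) (.natLe (.lit 1) (.mat 53 23 28)))
        (.or (.neg (.eq (.var 27) (.var 28))) (.natLe (.lit 2) (.mat 53 23 27))))).Holds σ
      ↔ (u ∈ A ∧ v ∈ A) ∧ Splittable g s u v := by
    have h1 : ∀ w : Fin n, σ.nat 53 s w = g s w := fun w => by rw [← hg]; rfl
    have h2 : ∀ w : Fin n, 1 ≤ (if w ∈ A then 1 else 0) ↔ w ∈ A := fun w => by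
      split_ifs with h <;> simp [h]
    simp only [Test.Holds, Test.holds_or, Test.holds_eq, NExpr.eval, NExpr.eval_vec,
      NExpr.eval_mat, NExpr.eval_var, hs, hu, hv, hA, h1, Fin.val_inj, h2]
    constructor
    · rintro ⟨⟨a1, a2⟩, ⟨a3, a4⟩, a5⟩
      refine ⟨⟨a1, a2⟩, fun e => hsA (e ▸ a1), fun e => hsA (e ▸ a2), a3, a4, fun e => ?_⟩
      exact a5.resolve_left (not_not.2 e)
    · rintro ⟨h, a1, a2, a3, a4, a5⟩
      refine ⟨h, ⟨a3, a4⟩, ?_⟩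
      by_cases e : u = v
      · exact Or.inr (a5 e)
      · exact Or.inl e
  by_cases hcond : (u ∈ A ∧ v ∈ A) ∧ Splittable g s u v
  · rw [trySplit, den_ite_pos (htest.2 hcond), den_seq, den_seq]
    have hsplit := den_split hn hg hs hu hv
    have hck := den_check (σ := split.den σ) (n := n) (g := splitOff g s u v) (q := q) (A := A)
      (by rw [den_nat _ rfl, hn]) hsplit
      (by rw [← hq]; exact State.mat_congr (den_nat _ rfl _))
      (fun i => by rw [den_nat _ rfl, hA]) hle
    have h53 : (check.den (split.den σ)).mat n 53 = g := by
      rw [← hg]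
      exact State.mat_congr ((den_nat _ rfl _).trans (den_nat _ rfl _))
    have h56 : (check.den (split.den σ)).mat n 56 = splitOff g s u v := by
      rw [← hsplit]
      exact State.mat_congr (den_nat _ rfl _)
    rcases hck with ⟨h1, h2⟩ | ⟨h1, h2⟩
    · rw [den_ite_pos (by simp [h1]), if_pos ⟨hcond.1, hcond.2, h2⟩, ← h56]
      exact den_copy (by rw [den_nat _ rfl, den_nat _ rfl, hn]) (by simp) (by simp)
    · rw [den_ite_neg (by simp [h1]), if_neg fun h => h2 h.2.2]
      exact h53
  · rw [trySplit, den_ite_neg (mt htest.1 hcond), if_neg fun h => hcond ⟨h.1, h.2.1⟩]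
    exact hg

/-- Try all pairs of edges at `23`. -/
def pass : Stmt := .forLt 27 (.forLt 28 trySplit)

/-- If a sweep changes anything, the degree of `s` drops by at least 2. If not, all pairs were
tested against the same matrix and rejected, which `exists_splitOff` allows only at degree 0. -/
theorem den_pass (hn : σ.nat 0 0 0 = n) (hg : σ.mat n 53 = g) (hq : σ.mat n 54 = q)
    (hA : ∀ i : Fin n, σ.nat 55 i 0 = if i ∈ A then 1 else 0)
    (hle : ∀ x y, x ≠ y → q x y ≤ n ^ 3) (hs : σ.nat 23 0 0 = s)
    (hred : Reduction g₀ q W A g) (hAW : A = (insert s W)ᶜ) (hsW : s ∉ W)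
    (hqs : ∀ x y, q x y = q y x)
    (hcut : (∀ x y, x ≠ y → 2 ≤ q x y) ∨ ∀ X, Even (cut g₀ X)) (heven : Even (cut g₀ {s})) :
    ∃ g', (pass.den σ).mat n 53 = g' ∧ Reduction g₀ q W A g' ∧ cut g' {s} ≤ cut g {s} - 2 := by
  classical
  have hsA : s ∉ A := by simp [hAW]
  have hAW' : ∀ w ∈ A, w ∉ W := fun w hw hw' => by simp [hAW, hw'] at hw
  refine Exists.elim (den_for_for (c := 27) (d := 28) (n := n) (P := trySplit) hn rfl (by simp) rfl
    (fun a b τ => ∃ g', τ.mat n 53 = g' ∧ Reduction g₀ q W A g' ∧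
      (cut g' {s} + 2 ≤ cut g {s} ∨ g' = g ∧ ∀ u ∈ A, ∀ v ∈ A,
        (u : ℕ) < a ∨ (u : ℕ) = a ∧ (v : ℕ) < b →
          ¬ (Splittable g s u v ∧ Feasible q A (splitOff g s u v)))) ?_ ?_ ?_ ?_) ?_
  · exact ⟨g, hg, hred, Or.inr ⟨rfl, by simp⟩⟩
  · rintro a ha b hb τ hτ _ ⟨g', hg', hred', hI⟩ h27
    let u : Fin n := ⟨a, ha⟩
    let v : Fin n := ⟨b, hb⟩
    have hτ' : ∀ B, B ≠ 28 → (pass.natW B = false) → (τ.setN 28 0 0 b).nat B = σ.nat B := by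
      intro B h2 h3
      rw [State.setN_nat_of_ne _ _ _ _ h2, hτ B h3]
    have htry := den_trySplit (σ := τ.setN 28 0 0 b) (g := g') (q := q) (A := A) (s := s)
      (u := u) (v := v) (by rw [hτ' 0 (by simp) rfl, hn])
      (by rw [← hg']; exact State.mat_congr (State.setN_nat_of_ne _ _ _ _ (by simp)))
      (by rw [← hq]; exact State.mat_congr (hτ' 54 (by simp) rfl))
      (fun i => by rw [hτ' 55 (by simp) rfl, hA]) hsA hle (by rw [hτ' 23 (by simp) rfl, hs])
      (by simp [h27, u]) (by simp [v])
    refine ⟨_, htry, ?_⟩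
    split_ifs with hc
    · have h2 := cut_splitOff_self hred'.symm hc.2.1
      refine ⟨hred'.splitOff hsW (hAW' u hc.1.1) (hAW' v hc.1.2) hc.2.1 hc.2.2, Or.inl ?_⟩
      rcases hI with h | ⟨rfl, -⟩
      · omega
      · exact h2.le
    · refine ⟨hred', hI.imp id ?_⟩
      rintro ⟨rfl, hI⟩
      refine ⟨rfl, fun u' hu' v' hv' hlt => ?_⟩
      by_cases hlast : u' = u ∧ v' = v
      · obtain ⟨rfl, rfl⟩ := hlast
        exact fun h => hc ⟨⟨hu', hv'⟩, h⟩
      · refine hI u' hu' v' hv' ?_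
        simp only [Fin.ext_iff, u, v] at hlast
        omega
  · rintro a τ x h
    exact h
  · rintro a τ x ⟨g', h1, h2, h3⟩
    refine ⟨g', h1, h2, h3.imp id fun h => ⟨h.1, fun u hu v hv hlt => h.2 u hu v hv ?_⟩⟩
    have := v.2
    omega
  · rintro τ ⟨⟨g', h1, h2, h3⟩, -, -, he⟩
    rw [pass, he]
    refine ⟨g', h1, h2, ?_⟩
    rcases h3 with h3 | ⟨rfl, h3⟩
    · omega
    · rcases Nat.eq_zero_or_pos (cut g' {s}) with h0 | hpos
      · omega
      · obtain ⟨u, hu, v, hv, h⟩ := hred.exists_splitOff hAW hqs hcut heven hpos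
        exact absurd h (h3 u hu v hv (Or.inl u.2))

/-- The degree is at most `2 * n ^ 3` and drops by 2 in each sweep until it is 0. -/
theorem den_cube_pass (hn : σ.nat 0 0 0 = n) (hg : σ.mat n 53 = g) (hq : σ.mat n 54 = q)
    (hA : ∀ i : Fin n, σ.nat 55 i 0 = if i ∈ A then 1 else 0)
    (hle : ∀ x y, x ≠ y → q x y ≤ n ^ 3) (hs : σ.nat 23 0 0 = s)
    (hred : Reduction g₀ q W A g) (hAW : A = (insert s W)ᶜ) (hsW : s ∉ W)
    (hqs : ∀ x y, q x y = q y x)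
    (hcut : (∀ x y, x ≠ y → 2 ≤ q x y) ∨ ∀ X, Even (cut g₀ X)) (heven : Even (cut g₀ {s}))
    (hdeg : cut g₀ {s} ≤ 2 * n ^ 3) :
    Reduction g₀ q (insert s W) A (((cube 24 pass).den σ).mat n 53) := by
  have hfin := den_cube (c := 24) (P := pass) hn rfl
    (fun m τ => Reduction g₀ q W A (τ.mat n 53) ∧
      cut (τ.mat n 53) {s} ≤ cut g₀ {s} - 2 * m) ?_ ?_ ?_
  · exact hfin.1.isolate (by have := hfin.2; omega)
  · rw [hg]
    exact ⟨hred, hred.le _⟩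
  · intro m τ τ' h _ hI
    rw [State.mat_congr (h 53 rfl)]
    exact hI
  · rintro m - τ hτ - ⟨h1, h2⟩
    obtain ⟨g', e, h3, h4⟩ := den_pass (σ := τ) (by rw [hτ 0 rfl, hn]) rfl
      (by rw [← hq]; exact State.mat_congr (hτ 54 rfl)) (fun i => by rw [hτ 55 rfl, hA]) hle
      (by rw [hτ 23 rfl, hs]) h1 hAW hsW hqs hcut heven
    rw [e]
    exact ⟨h3, by omega⟩

end Stmt

end RAM

/-! ### Bottleneck requirements and isolation of all nodes outside `V`. -/

namespace RAM

open Stmt SplittingOff TreeCut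

namespace Stmt

variable {n : ℕ} {T : SimpleGraph (Fin n)} {V : Finset (Fin n)} {v : Fin n} {σ : State}

/-- The requirement between two nodes: the smallest entry of the matrix `52` on the path between
them, bounded by three times the number of nodes. -/
def reqs : Stmt :=
  fill 54 (.natLe (.lit 0) (.lit 0)) (.add (.var 0) (.add (.var 0) (.var 0))) (.lit 0) ;;
  forEdges (fill 54 (.conj (.eq (.add (.vec 42 10) (.vec 42 11)) (.lit 1))
    (.natLe (.mat 52 15 16) (.mat 54 10 11))) (.mat 52 15 16) (.mat 54 10 11))

/-- The matrix `q` contains the bottlenecks of the paths. -/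
structure IsBottleneck (T : SimpleGraph (Fin n)) (v : Fin n) (b : Sym2 (Fin n) → ℕ)
    (q : Fin n → Fin n → ℕ) : Prop where
  symm : ∀ x y, q x y = q y x
  le : ∀ x y, q x y ≤ 3 * n
  le_of_sep : ∀ e ∈ T.edgeSet, ∀ x y, ¬ (x ∈ side T v e ↔ y ∈ side T v e) → q x y ≤ b e
  ge : ∀ x y, ∀ k ≤ 3 * n, (∀ e ∈ T.edgeSet, ¬ (x ∈ side T v e ↔ y ∈ side T v e) → k ≤ b e) →
    k ≤ q x y

/-- The initial value `3 * n` stands for infinity. It exceeds the capacities at most `2 * n + 1`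
that are split off and keeps unit-by-unit flows polynomial. -/
theorem den_reqs (hσ : Ready T V v σ) {b : Sym2 (Fin n) → ℕ} (hb : σ.mat n 52 = treeCap T b) :
    IsBottleneck T v b ((reqs.den σ).mat n 54) := by
  classical
  rw [reqs, den_seq]
  set P := fill 54 (.natLe (.lit 0) (.lit 0)) (.add (.var 0) (.add (.var 0) (.var 0))) (.lit 0)
    with hP
  have h54 : (P.den σ).mat n 54 = fun _ _ => 3 * n := by
    refine den_fill hσ.size (by simp) _ fun i j τ h1 _ h2 h3 => ?_
    simp [h1 0 (by simp) (by simp) (by simp), hσ.size]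
    omega
  have hmain := den_forEdges (σ := P.den σ) (T := T) (V := V) (v := v)
    (P := fill 54 (.conj (.eq (.add (.vec 42 10) (.vec 42 11)) (.lit 1))
      (.natLe (.mat 52 15 16) (.mat 54 10 11))) (.mat 52 15 16) (.mat 54 10 11))
    (hσ.den P rfl rfl rfl rfl) ⟨rfl, rfl, rfl, rfl, rfl⟩
    (fun S τ => (∀ x y, τ.mat n 54 x y = τ.mat n 54 y x) ∧ (∀ x y, τ.mat n 54 x y ≤ 3 * n) ∧
      (∀ p ∈ S, ∀ x y, ¬ (x ∈ side T v s(p.1, p.2) ↔ y ∈ side T v s(p.1, p.2)) →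
        τ.mat n 54 x y ≤ b s(p.1, p.2)) ∧
      ∀ x y, ∀ k ≤ 3 * n, (∀ e ∈ T.edgeSet, ¬ (x ∈ side T v e ↔ y ∈ side T v e) → k ≤ b e) →
        k ≤ τ.mat n 54 x y) ?_ ?_ ?_
  · obtain ⟨h1, h2, h3, h4⟩ := hmain
    refine ⟨h1, h2, fun e he x y hxy => ?_, h4⟩
    induction e with | h a c
    exact h3 (a, c) (mem_arcs.2 he) x y hxy
  · rw [h54]
    exact ⟨fun _ _ => rfl, fun _ _ => le_rfl, by simp, fun x y k hk _ => hk⟩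
  · intro S τ τ' h1 _ h
    rw [State.mat_congr (h1 54 rfl)]
    exact h
  · rintro a c hac S - τ hready hτ - h15 h16 hvis ⟨h1, h2, h3, h4⟩
    have h52 : ∀ i j : Fin n, τ.nat 52 i j = treeCap T b i j := by
      intro i j
      rw [← hb, hτ 52 rfl, den_nat _ rfl]
      rfl
    have hbac : treeCap T b a c = b s(a, c) := by rw [treeCap, if_pos hac]
    have hden := den_fill (A := 54) (σ := τ)
      (b := .conj (.eq (.add (.vec 42 10) (.vec 42 11)) (.lit 1))
        (.natLe (.mat 52 15 16) (.mat 54 10 11))) (x := .mat 52 15 16) (y := .mat 54 10 11)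
      hready.size (by simp)
      (fun x y => if ¬ (x ∈ side T v s(a, c) ↔ y ∈ side T v s(a, c)) ∧
        b s(a, c) ≤ τ.mat n 54 x y then b s(a, c) else τ.mat n 54 x y)
      (fun i j τ' g1 g2 g3 g4 => by
        have e1 : ((if i ∈ side T v s(a, c) then 1 else 0) + (if j ∈ side T v s(a, c) then 1 else 0)
            = 1) ↔ ¬ (i ∈ side T v s(a, c) ↔ j ∈ side T v s(a, c)) := by
          by_cases h1 : i ∈ side T v s(a, c) <;> by_cases h2 : j ∈ side T v s(a, c) <;>
            simp [h1, h2]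
        have e2 : τ'.nat 54 i j = τ.mat n 54 i j := g2
        simp only [Test.Holds, Test.holds_eq, NExpr.eval, NExpr.eval_vec, NExpr.eval_mat,
          NExpr.eval_var, g3, g4, g1 42 (by simp) (by simp) (by simp),
          g1 15 (by simp) (by simp) (by simp), g1 16 (by simp) (by simp) (by simp),
          g1 52 (by simp) (by simp) (by simp), h15, h16, hvis, h52, hbac, e1, e2])
    rw [hden]
    refine ⟨fun x y => ?_, fun x y => ?_, fun p hp x y hxy => ?_, fun x y k hk hkb => ?_⟩
    · have hc : (x ∈ side T v s(a, c) ↔ y ∈ side T v s(a, c)) ↔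
        (y ∈ side T v s(a, c) ↔ x ∈ side T v s(a, c)) := Iff.comm
      simp only [hc, h1 x y]
    · have := h2 x y
      dsimp only
      split_ifs <;> omega
    · dsimp only
      rcases Finset.mem_insert.1 hp with rfl | hp
      · split_ifs with h
        · exact le_rfl
        · exact le_of_lt (not_le.1 fun h' => h ⟨hxy, h'⟩)
      · have := h3 p hp x y hxy
        split_ifs with h <;> omega
    · have g1 := h4 x y k hk hkb
      dsimp only
      split_ifs with h
      · exact hkb _ hac h.1
      · exact g1

/-- Split off the edges at `23` if it is not a terminal. -/
def isolate : Stmt :=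
  ite (.natLe (.vec 2 23) (.lit 0)) (nat 55 (.var 23) (.lit 0) (.lit 0) ;; cube 24 pass) skip

/-- Transform the matrix `52` into a matrix `53` on the terminals. -/
def run : Stmt := ((copy 53 52 ;; reqs) ;; fillVec 55 1) ;; .forLt 23 isolate

/-- Program version of `exists_reduction`. The bound on `b` limits both the flows and the number of
sweeps; `hreg` offers the two ways of excluding cuts of capacity one. -/
theorem den_run (hT : T.IsTree) (hσ : Ready T V v σ) {b : Sym2 (Fin n) → ℕ}
    (hb : σ.mat n 52 = treeCap T b) (hbn : ∀ e ∈ T.edgeSet, b e ≤ 2 * n + 1)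
    (hreg : (∀ e ∈ T.edgeSet, 2 ≤ b e) ∨ ∀ e ∈ T.edgeSet, Even (b e))
    (hpar : ∀ w ∉ V, Even (∑ e ∈ cutEdges T {w}, b e)) :
    ∃ q, IsBottleneck T v b q ∧ Reduction (treeCap T b) q Vᶜ V ((run.den σ).mat n 53) := by
  classical
  rw [run, den_seq]
  set P := (copy 53 52 ;; reqs) ;; fillVec 55 1 with hP
  have hn0 : 0 < n := v.pos
  have hready : Ready T V v (P.den σ) := hσ.den P rfl rfl rfl rfl
  have hq : IsBottleneck T v b ((P.den σ).mat n 54) := by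
    have h1 : (P.den σ).mat n 54 = (reqs.den ((copy 53 52).den σ)).mat n 54 :=
      State.mat_congr (den_nat (fillVec 55 1) rfl _)
    rw [h1]
    refine den_reqs (hσ.den (copy 53 52) rfl rfl rfl rfl) ?_
    rw [← hb]
    exact State.mat_congr (den_nat _ rfl _)
  have h53 : (P.den σ).mat n 53 = treeCap T b := by
    rw [← hb, ← den_copy (A := 53) (B := 52) hσ.size (by simp) (by simp)]
    exact State.mat_congr ((den_nat (fillVec 55 1) rfl _).trans (den_nat reqs rfl _))
  have h55 : ∀ i : Fin n, (P.den σ).nat 55 i 0 = 1 := fun i =>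
    den_fillVec (by rw [den_nat _ rfl, hσ.size]) (by simp) i
  set q := (P.den σ).mat n 54
  refine ⟨q, hq, ?_⟩
  -- `3 * n ≤ n ^ 3` fails for `n = 1`, but two distinct nodes give `n ≥ 2`.
  have hqn : ∀ x y, x ≠ y → q x y ≤ n ^ 3 := by
    intro x y hxy
    have h1 := hq.le x y
    have h2 : 2 ≤ n := by
      have := x.2
      have := y.2
      have := Fin.val_ne_of_ne hxy
      omega
    have h3 : 2 * 2 ≤ n * n := Nat.mul_le_mul h2 h2
    have h4 : 4 * n ≤ n * n * n := Nat.mul_le_mul_right n h3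
    have h5 : n ^ 3 = n * n * n := by ring
    omega
  have hcut : (∀ x y, x ≠ y → 2 ≤ q x y) ∨ ∀ X, Even (cut (treeCap T b) X) := by
    rcases hreg with h | h
    · exact Or.inl fun x y _ => hq.ge x y 2 (by omega) fun e he _ => h e he
    · refine Or.inr fun X => Finset.even_sum _ fun x _ => Finset.even_sum _ fun y _ => ?_
      rw [treeCap]
      split_ifs with hxy
      · exact h _ hxy
      · exact Even.zero
  have hdeg : ∀ s, cut (treeCap T b) {s} ≤ 2 * n ^ 3 := by
    intro s
    have h1 : cut (treeCap T b) {s} ≤ (n - 1) * (2 * n + 1) := by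
      rw [cut, between, Finset.sum_singleton]
      refine (Finset.sum_le_card_nsmul _ _ (2 * n + 1) fun y _ => ?_).trans_eq ?_
      · rw [treeCap]
        split_ifs with hxy
        · exact hbn _ hxy
        · exact Nat.zero_le _
      · rw [Finset.card_compl, Finset.card_singleton, Fintype.card_fin, smul_eq_mul]
    refine h1.trans ?_
    have h2 : ∀ m, m * (2 * (m + 1) + 1) ≤ 2 * (m + 1) ^ 3 := fun m => by
      have : 2 * (m + 1) ^ 3 = m * (2 * (m + 1) + 1) + (2 * m ^ 3 + 4 * m ^ 2 + 3 * m + 2) := by ring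
      omega
    have h3 := h2 (n - 1)
    rwa [Nat.sub_add_cancel hn0] at h3
  let W : ℕ → Finset (Fin n) := fun k => Finset.univ.filter fun i => (i : ℕ) < k ∧ i ∉ V
  have hmW : ∀ k i, i ∈ W k ↔ (i : ℕ) < k ∧ i ∉ V := fun k i => by simp [W]
  refine Exists.elim (den_for (c := 23) (P := isolate) hready.size (fun k τ =>
    (∀ i : Fin n, τ.nat 55 i 0 = if i ∈ (W k)ᶜ then 1 else 0) ∧
      Reduction (treeCap T b) q (W k) (W k)ᶜ (τ.mat n 53)) ?_ ?_) ?_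
  · have hW0 : W 0 = ∅ := by simp [W]
    rw [hW0, h53]
    refine ⟨fun i => by rw [h55]; simp, treeCap_symm b, by simp, fun _ => le_rfl, fun _ => Iff.rfl,
      ?_⟩
    rw [Finset.compl_empty]
    exact feasible_treeCap hT v b fun e he x y hxy => hq.le_of_sep e he x y hxy
  · rintro k hk τ hτ - ⟨h1, h2⟩
    let s : Fin n := ⟨k, hk⟩
    have hτ' : ∀ B, B ≠ 23 → (Stmt.forLt 23 isolate).natW B = false →
        (τ.setN 23 0 0 k).nat B = (P.den σ).nat B := by
      intro B h2 h3
      rw [State.setN_nat_of_ne _ _ _ _ h2, hτ B h3]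
    have e2 : (τ.setN 23 0 0 k).nat 2 k 0 = if s ∈ V then 1 else 0 := by
      rw [hτ' 2 (by simp) rfl, ← hready.term s]
    by_cases hs : s ∈ V
    · have hW' : W (k + 1) = W k := by
        ext i
        rw [hmW, hmW]
        constructor
        · rintro ⟨g1, g2⟩
          refine ⟨lt_of_le_of_ne (Nat.lt_succ_iff.1 g1) ?_, g2⟩
          rintro rfl
          exact g2 hs
        · rintro ⟨g1, g2⟩
          exact ⟨by omega, g2⟩
      rw [hW', isolate, den_ite_neg]
      · simp only [den_skip]
        exact ⟨fun i => by rw [State.setN_nat_of_ne _ _ _ _ (by simp), h1],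
          by rw [State.mat_congr (State.setN_nat_of_ne _ _ _ _ (by simp))]; exact h2⟩
      · simp [e2, hs]
    · have hsW : s ∉ W k := by simp [hmW, s]
      have hW' : W (k + 1) = insert s (W k) := by
        ext i
        rw [Finset.mem_insert, hmW, hmW, Fin.ext_iff]
        constructor
        · rintro ⟨g1, g2⟩
          by_cases h : (i : ℕ) = k
          · exact Or.inl h
          · exact Or.inr ⟨by omega, g2⟩
        · rintro (g | ⟨g1, g2⟩)
          · have : i = s := Fin.ext g
            exact ⟨by simp only [s] at g; omega, this ▸ hs⟩
          · exact ⟨by omega, g2⟩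
      rw [hW', isolate, den_ite_pos (by simp [e2, hs]), den_seq]
      set τ₁ := (nat 55 (.var 23) (.lit 0) (.lit 0)).den (τ.setN 23 0 0 k) with hτ₁
      have f : ∀ B, B ≠ 55 → τ₁.nat B = (τ.setN 23 0 0 k).nat B := fun B hB =>
        State.setN_nat_of_ne _ _ _ _ hB
      have f55 : ∀ i : Fin n, τ₁.nat 55 i 0 = if i ∈ (insert s (W k))ᶜ then 1 else 0 := by
        intro i
        rw [hτ₁, den_natStmt, State.setN_nat_apply, State.setN_nat_of_ne _ _ _ _ (by simp), h1]
        simp only [NExpr.eval_var, NExpr.eval, State.setN_nat_self, true_and, and_true,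
          Finset.mem_compl, Finset.mem_insert, Fin.ext_iff, s]
        by_cases h : (i : ℕ) = k <;> simp [h]
      refine ⟨fun i => by rw [den_nat _ rfl, f55], ?_⟩
      refine den_cube_pass (g := τ.mat n 53) (s := s) ?_ ?_ ?_ f55 hqn ?_ ?_ rfl hsW hq.symm hcut
        ?_ (hdeg s)
      · rw [f 0 (by simp), hτ' 0 (by simp) rfl, hready.size]
      · exact State.mat_congr ((f 53 (by simp)).trans (State.setN_nat_of_ne _ _ _ _ (by simp)))
      · exact State.mat_congr ((f 54 (by simp)).trans (hτ' 54 (by simp) rfl))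
      · rw [f 23 (by simp), State.setN_nat_self]
      · refine h2.mono ?_
        rw [Finset.compl_subset_compl]
        exact Finset.subset_insert _ _
      · rw [cut_treeCap_singleton]
        exact hpar s hs
  · rintro τ ⟨⟨-, h⟩, -, -, he⟩
    have hWn : W n = Vᶜ := by
      ext i
      simp [hmW]
    rw [hWn, compl_compl] at h
    rw [he, State.mat_congr (State.setN_nat_of_ne _ _ _ _ (by simp))]
    exact h

end Stmt

end RAM

/-! ### Decomposition of large capacities into levels. -/

namespace RAM

open Stmt SplittingOff TreeCut

theorem cut_congr {n : ℕ} {g g' : Fin n → Fin n → ℕ} (h : ∀ x y, x ≠ y → g x y = g' x y)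
    (X : Finset (Fin n)) : cut g X = cut g' X := by
  refine Finset.sum_congr rfl fun x hx => Finset.sum_congr rfl fun y hy => h x y ?_
  rintro rfl
  exact Finset.mem_compl.1 hy hx

theorem cut_add_mul {n : ℕ} (g g' : Fin n → Fin n → ℕ) (m : ℕ) (X : Finset (Fin n)) :
    cut (fun x y => g x y + m * g' x y) X = cut g X + m * cut g' X := by
  rw [cut_add]
  simp only [cut, between, Finset.mul_sum]

theorem le_cut_of_sep {n : ℕ} {g : Fin n → Fin n → ℕ} (hg : ∀ x y, g x y = g y x)
    {X : Finset (Fin n)} {x y : Fin n} (h : ¬ (x ∈ X ↔ y ∈ X)) : g x y ≤ cut g X := by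
  by_cases hx : x ∈ X
  · exact le_between g hx (Finset.mem_compl.2 fun hy => h ⟨fun _ => hy, fun _ => hx⟩)
  · rw [hg]
    exact le_between g (by tauto) (Finset.mem_compl.2 hx)

variable {n : ℕ} {T : SimpleGraph (Fin n)} {V : Finset (Fin n)} {v : Fin n} {σ : State}

/-- The situation after `k` rounds of the construction of a capacity `out` on the terminals that
uses `2 h` units on the edges of the tree: the levels up to `cur` have been treated, and `rank` units
of each edge have been reserved. -/
structure LevelInv (T : SimpleGraph (Fin n)) (V : Finset (Fin n)) (v : Fin n)
    (h : Sym2 (Fin n) → ℕ) (k cur : ℕ) (rank : Sym2 (Fin n) → ℕ) (out : Fin n → Fin n → ℕ) :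
    Prop where
  symm : ∀ x y, x ≠ y → out x y = out y x
  zero : ∀ x ∉ V, ∀ y, y ≠ x → out x y = 0
  load : ∀ e ∈ T.edgeSet, cut out (side T v e) + 2 * rank e ≤ 2 * min (h e) cur
  -- Here `e` is a bottleneck between `s` and `t`. The lower bound on cuts matches the upper bound
  -- in `load`, so nothing is lost on bottlenecks.
  cover : ∀ s ∈ V, ∀ t ∈ V, ∀ X : Finset (Fin n), s ∈ X → t ∉ X → ∀ e ∈ T.edgeSet,
    ¬ (s ∈ side T v e ↔ t ∈ side T v e) →
    (∀ f ∈ T.edgeSet, ¬ (s ∈ side T v f ↔ t ∈ side T v f) → h e ≤ h f) →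
    2 * min (h e) cur ≤ cut out X + 2 * rank e
  rank_mono : ∀ e ∈ T.edgeSet, ∀ f ∈ T.edgeSet, h e ≤ h f → rank e ≤ rank f
  rank_lt : ∀ e ∈ T.edgeSet, ∀ f ∈ T.edgeSet, h e < h f → h e < cur → rank e + 1 ≤ rank f
  rank_le : ∀ e ∈ T.edgeSet, rank e ≤ k
  rank_pos : 1 ≤ cur → ∀ e ∈ T.edgeSet, 1 ≤ h e → 1 ≤ rank e
  -- Every new level uses up an edge, and there are fewer than `n` edges; so after `n` rounds all
  -- levels have been treated.
  count : (∀ e ∈ T.edgeSet, h e ≤ cur) ∨ ((edgesOf T).filter fun e => cur < h e).card + k ≤ n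

namespace LevelInv

variable {h rank : Sym2 (Fin n) → ℕ} {k cur nxt : ℕ} {out out' g : Fin n → Fin n → ℕ}

theorem init (hT : T.IsTree) : LevelInv T V v h 0 0 (fun _ => 0) (fun _ _ => 0) where
  symm _ _ _ := rfl
  zero _ _ _ _ := rfl
  load e _ := by simp [cut, between]
  cover s _ t _ X _ _ e _ _ _ := by simp
  rank_mono _ _ _ _ _ := le_rfl
  rank_lt _ _ _ _ _ h := absurd h (Nat.not_lt_zero _)
  rank_le _ _ := le_rfl
  rank_pos h := absurd h (by simp)
  count := by
    classical
    right
    refine (Finset.card_filter_le _ _).trans ?_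
    have h1 := hT.card_edgeFinset
    have h2 : T.edgeFinset = edgesOf T := by
      ext e
      rw [SimpleGraph.mem_edgeFinset, mem_edgesOf]
    rw [h2, Fintype.card_fin] at h1
    omega

theorem finished (hI : LevelInv T V v h k cur rank out) (hcur : ∀ e ∈ T.edgeSet, h e ≤ cur) :
    LevelInv T V v h (k + 1) cur rank out :=
  { hI with
    rank_le := fun e he => (hI.rank_le e he).trans (Nat.le_succ k)
    count := Or.inl hcur }

/-- Passing from `cur` to `nxt` makes `2 * (nxt - cur)` units available on the edges that reach
`nxt`. All but one of the `nxt - cur` double units go to `g`, and the last one is recorded in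
`rank`. That makes `rank` strictly increasing from level to level. -/
theorem step (hI : LevelInv T V v h k cur rank out) (hlt : cur < nxt)
    (hex : ∃ e ∈ T.edgeSet, h e = nxt) (hmin : ∀ e ∈ T.edgeSet, cur < h e → nxt ≤ h e)
    (hsymm : ∀ x y, g x y = g y x) (hzero : ∀ x ∉ V, ∀ y, y ≠ x → g x y = 0)
    (hload : ∀ e ∈ T.edgeSet, cut g (side T v e) ≤ if nxt ≤ h e then 2 else 0)
    (hcover : ∀ s ∈ V, ∀ t ∈ V, ∀ X : Finset (Fin n), s ∈ X → t ∉ X →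
      (∀ f ∈ T.edgeSet, ¬ (s ∈ side T v f ↔ t ∈ side T v f) → nxt ≤ h f) → 2 ≤ cut g X)
    (hout : ∀ x y, x ≠ y → out' x y = out x y + (nxt - cur - 1) * g x y) :
    LevelInv T V v h (k + 1) nxt (fun e => if nxt ≤ h e then rank e + 1 else rank e) out' := by
  have hcut : ∀ X, cut out' X = cut out X + (nxt - cur - 1) * cut g X := fun X => by
    rw [cut_congr hout, cut_add_mul]
  refine ⟨fun x y hxy => ?_, fun x hx y hy => ?_, fun e he => ?_,
    fun s hs t ht X hsX htX e he hsep hle => ?_, fun e he f hf hef => ?_,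
    fun e he f hf hef hecur => ?_, fun e he => ?_, fun _ e he h1 => ?_, ?_⟩
  · rw [hout x y hxy, hout y x hxy.symm, hI.symm x y hxy, hsymm]
  · rw [hout x y hy.symm, hI.zero x hx y hy, hzero x hx y hy]
    rfl
  · have h1 := hI.load e he
    have h2 := Nat.mul_le_mul_left (nxt - cur - 1) (hload e he)
    have h3 := hmin e he
    rw [hcut]
    split_ifs at h2 ⊢ with hc <;> omega
  · have h1 := hI.cover s hs t ht X hsX htX e he hsep hle
    have h3 := hmin e he
    rw [hcut]
    split_ifs with hc
    · have h2 := Nat.mul_le_mul_left (nxt - cur - 1) (hcover s hs t ht X hsX htX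
        fun f hf hfs => hc.trans (hle f hf hfs))
      omega
    · omega
  · have := hI.rank_mono e he f hf hef
    split_ifs <;> omega
  · have h1 := hI.rank_mono e he f hf hef.le
    have h2 := hI.rank_lt e he f hf hef
    have h3 := hmin e he
    have h4 := hmin f hf
    split_ifs <;> omega
  · have := hI.rank_le e he
    split_ifs <;> omega
  · have h2 := hI.rank_pos
    have h3 := hmin e he
    split_ifs with hc
    · omega
    · exact h2 (by omega) e he h1
  · right
    obtain ⟨e, he, hen⟩ := hex
    rcases hI.count with h1 | h1
    · exact absurd (h1 e he) (by omega)
    · have h2 : ((edgesOf T).filter fun e => nxt < h e).card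
          < ((edgesOf T).filter fun e => cur < h e).card := by
        refine Finset.card_lt_card ⟨fun f hf => ?_, fun hsub => ?_⟩
        · rw [Finset.mem_filter] at hf ⊢
          exact ⟨hf.1, hlt.trans hf.2⟩
        · have := hsub (Finset.mem_filter.2 ⟨mem_edgesOf.2 he, by omega⟩)
          rw [Finset.mem_filter] at this
          omega
      omega

/-- The reserved capacities are used for a final round. -/
theorem finish {c : Sym2 (Fin n) → ℕ} {q : Fin n → Fin n → ℕ} {b : Sym2 (Fin n) → ℕ}
    (hT : T.IsTree) (hI : LevelInv T V v (fun e => c e / 2) n cur rank out)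
    (hcur : ∀ e ∈ T.edgeSet, c e / 2 ≤ cur) (hb : ∀ e, b e = 2 * rank e + c e % 2)
    (hq : IsBottleneck T v b q) (hred : Reduction (treeCap T b) q Vᶜ V g)
    (hout : ∀ x y, x ≠ y → out' x y = out x y + g x y) :
    (∀ x y, x ≠ y → out' x y = out' y x) ∧ (∀ x ∉ V, ∀ y, y ≠ x → out' x y = 0) ∧
    (∀ e ∈ T.edgeSet, cut out' (side T v e) ≤ c e) ∧
    ∀ s ∈ V, ∀ t ∈ V, ∀ X : Finset (Fin n), s ∈ X → t ∉ X → ∀ k,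
      (∀ e ∈ T.edgeSet, ¬ (s ∈ side T v e ↔ t ∈ side T v e) → k ≤ c e) → k ≤ cut out' X := by
  have hcut : ∀ X, cut out' X = cut out X + cut g X := fun X => by
    rw [cut_congr hout, cut_add]
  have hn : 0 < n := v.pos
  refine ⟨fun x y hxy => ?_, fun x hx y hy => ?_, fun e he => ?_,
    fun s hs t ht X hsX htX k hk => ?_⟩
  · rw [hout x y hxy, hout y x hxy.symm, hI.symm x y hxy, hred.symm]
  · rw [hout x y hy.symm, hI.zero x hx y hy, hred.zero x (Finset.mem_compl.2 hx) y hy]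
  · have h1 := hI.load e he
    have h2 := hred.le (side T v e)
    rw [cut_treeCap_side hT v b he, hb] at h2
    rw [hcut]
    have := hcur e he
    omega
  · classical
    have hst : s ≠ t := fun h => htX (h ▸ hsX)
    obtain ⟨e, he, hmin⟩ := Finset.exists_min_image
      ((edgesOf T).filter fun e => ¬ (s ∈ side T v e ↔ t ∈ side T v e)) c (by
        obtain ⟨e, he, hs⟩ := exists_edge_sep hT v hst
        exact ⟨e, Finset.mem_filter.2 ⟨mem_edgesOf.2 he, hs⟩⟩)
    obtain ⟨he, hsep⟩ := Finset.mem_filter.1 he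
    rw [mem_edgesOf] at he
    have hmin' : ∀ f ∈ T.edgeSet, ¬ (s ∈ side T v f ↔ t ∈ side T v f) → c e ≤ c f :=
      fun f hf hfs => hmin f (Finset.mem_filter.2 ⟨mem_edgesOf.2 hf, hfs⟩)
    have h1 := hI.cover s hs t ht X hsX htX e he hsep
      fun f hf hfs => Nat.div_le_div_right (hmin' f hf hfs)
    -- `b` preserves the order of `c`: for equal halves the parities decide, and otherwise the ranks
    -- differ by at least 1, which outweighs a parity. Hence `e` is a bottleneck for `b` too.
    have h2 : b e ≤ cut g X := by
      refine le_trans (hq.ge s t (b e) ?_ fun f hf hfs => ?_)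
        (hred.feasible s hs t ht hst X hsX htX)
      · have := hI.rank_le e he
        rw [hb]
        omega
      · have g1 := hmin' f hf hfs
        have g2 := hI.rank_mono e he f hf (Nat.div_le_div_right g1)
        have g3 := hI.rank_lt e he f hf
        have g4 := hcur f hf
        rw [hb, hb]
        omega
    have h3 := hk e he hsep
    have h4 := hcur e he
    rw [hb] at h2
    rw [hcut]
    omega

end LevelInv

namespace Stmt

/-- Store in `51` the smallest entry of the matrix `48` above `49`. -/
def nextLevel : Stmt :=
  set 51 (.lit 0) ;; .forLt 32 (.forLt 33 (ite
    (.conj (.natLe (.add (.var 49) (.lit 1)) (.mat 48 32 33))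
      (.or (.natLe (.var 51) (.lit 0)) (.natLe (.mat 48 32 33) (.var 51))))
    (set 51 (.mat 48 32 33)) skip))

/-- The value 0 signals that no level is left; a proper level is positive because it exceeds `cur`.
-/
theorem den_nextLevel (hn : σ.nat 0 0 0 = n) {cur : ℕ} (hcur : σ.nat 49 0 0 = cur)
    {H : Fin n → Fin n → ℕ} (hH : σ.mat n 48 = H) :
    (nextLevel.den σ).nat 51 0 0 = 0 ∧ (∀ x y, H x y ≤ cur) ∨
      cur < (nextLevel.den σ).nat 51 0 0 ∧ (∃ x y, H x y = (nextLevel.den σ).nat 51 0 0) ∧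
        ∀ x y, cur < H x y → (nextLevel.den σ).nat 51 0 0 ≤ H x y := by
  rw [nextLevel, den_seq]
  have hfr : ∀ B, B ≠ 51 → ((set 51 (.lit 0)).den σ).nat B = σ.nat B := fun B hB =>
    State.setN_nat_of_ne _ _ _ _ hB
  refine Exists.elim (den_for_for (c := 32) (d := 33) (n := n) (P := ite
    (.conj (.natLe (.add (.var 49) (.lit 1)) (.mat 48 32 33))
      (.or (.natLe (.var 51) (.lit 0)) (.natLe (.mat 48 32 33) (.var 51))))
    (set 51 (.mat 48 32 33)) skip) (by rw [hfr 0 (by simp), hn]) rfl (by simp) rfl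
    (fun a b τ => τ.nat 51 0 0 = 0 ∧
        (∀ x y : Fin n, (x : ℕ) < a ∨ (x : ℕ) = a ∧ (y : ℕ) < b → H x y ≤ cur) ∨
      cur < τ.nat 51 0 0 ∧ (∃ x y, H x y = τ.nat 51 0 0) ∧
        ∀ x y : Fin n, (x : ℕ) < a ∨ (x : ℕ) = a ∧ (y : ℕ) < b → cur < H x y →
          τ.nat 51 0 0 ≤ H x y) ?_ ?_ ?_ ?_) ?_
  · exact Or.inl ⟨by simp, by simp⟩
  · intro a ha b hb τ hτ _ hI h32
    let x : Fin n := ⟨a, ha⟩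
    let y : Fin n := ⟨b, hb⟩
    have e48 : τ.nat 48 a b = H x y := by
      rw [← hH, hτ 48 rfl, hfr 48 (by simp)]
      rfl
    have e49 : τ.nat 49 0 0 = cur := by rw [hτ 49 rfl, hfr 49 (by simp), hcur]
    have hall : ∀ x' y' : Fin n, (x' : ℕ) < a ∨ (x' : ℕ) = a ∧ (y' : ℕ) < b + 1 →
        (x' = x ∧ y' = y) ∨ ((x' : ℕ) < a ∨ (x' : ℕ) = a ∧ (y' : ℕ) < b) := by
      intro x' y' h
      simp only [Fin.ext_iff, x, y]
      omega
    have htest : (Test.conj (.natLe (.add (.var 49) (.lit 1)) (.mat 48 32 33))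
        (.or (.natLe (.var 51) (.lit 0)) (.natLe (.mat 48 32 33) (.var 51)))).Holds
          (τ.setN 33 0 0 b) ↔ cur < H x y ∧ (τ.nat 51 0 0 = 0 ∨ H x y ≤ τ.nat 51 0 0) := by
      simp [h32, e48, e49, Nat.succ_le_iff]
    by_cases hc : cur < H x y ∧ (τ.nat 51 0 0 = 0 ∨ H x y ≤ τ.nat 51 0 0)
    · rw [den_ite_pos (htest.2 hc)]
      have e51 : ((set 51 (.mat 48 32 33)).den (τ.setN 33 0 0 b)).nat 51 0 0 = H x y := by
        simp [h32, e48]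
      rw [e51]
      refine Or.inr ⟨hc.1, ⟨x, y, rfl⟩, fun x' y' h h' => ?_⟩
      rcases hall x' y' h with ⟨rfl, rfl⟩ | h
      · exact le_rfl
      · rcases hI with ⟨g1, g2⟩ | ⟨g1, g2, g3⟩
        · exact absurd (g2 x' y' h) (by omega)
        · have := g3 x' y' h h'
          have := hc.2
          omega
    · rw [den_ite_neg (mt htest.1 hc), den_skip, State.setN_nat_of_ne _ _ _ _ (by simp)]
      rcases hI with ⟨g1, g2⟩ | ⟨g1, g2, g3⟩
      · refine Or.inl ⟨g1, fun x' y' h => ?_⟩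
        rcases hall x' y' h with ⟨rfl, rfl⟩ | h
        · exact not_lt.1 fun h' => hc ⟨h', Or.inl g1⟩
        · exact g2 x' y' h
      · refine Or.inr ⟨g1, g2, fun x' y' h h' => ?_⟩
        rcases hall x' y' h with ⟨rfl, rfl⟩ | h
        · exact le_of_lt (not_le.1 fun h'' => hc ⟨h', Or.inr h''⟩)
        · exact g3 x' y' h h'
  · intro a τ x h
    simpa using h
  · intro a τ z h
    rw [State.setN_nat_of_ne _ _ _ _ (by simp)]
    have hall : ∀ x y : Fin n, (x : ℕ) < a + 1 ∨ (x : ℕ) = a + 1 ∧ (y : ℕ) < 0 →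
        (x : ℕ) < a ∨ (x : ℕ) = a ∧ (y : ℕ) < n := by
      intro x y _
      have := y.2
      omega
    exact h.imp (fun h => ⟨h.1, fun x y hxy => h.2 x y (hall x y hxy)⟩)
      fun h => ⟨h.1, h.2.1, fun x y hxy => h.2.2 x y (hall x y hxy)⟩
  · rintro τ ⟨h, -, -, he⟩
    rw [he, State.setN_nat_of_ne _ _ _ _ (by simp)]
    exact h.imp (fun h => ⟨h.1, fun x y => h.2 x y (Or.inl x.2)⟩)
      fun h => ⟨h.1, h.2.1, fun x y => h.2.2 x y (Or.inl x.2)⟩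

end Stmt

end RAM

/-! ### The loop over the levels and the final round. -/

namespace RAM

open Stmt SplittingOff TreeCut

variable {n : ℕ} {T : SimpleGraph (Fin n)} {V : Finset (Fin n)} {v : Fin n} {σ : State}

namespace Stmt

/-- Add the weight of a level to the entries of `4` where the matrix `53` is at least `k`. -/
def addLevel (k : ℕ) : Stmt :=
  fill 4 (.natLe (.lit k) (.mat 53 10 11))
    (.add (.mat 4 10 11) (.sub (.sub (.var 51) (.var 49)) (.lit 1))) (.mat 4 10 11)

/-- Replaces multiplication: the entries of 53 are at most 2 off the diagonal, so adding the weight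
once for `k = 1` and once for `k = 2` multiplies it by the entry. -/
theorem den_addLevel (hn : σ.nat 0 0 0 = n) (k : ℕ) : ((addLevel k).den σ).mat n 4 = fun x y =>
    if k ≤ σ.mat n 53 x y then σ.mat n 4 x y + (σ.nat 51 0 0 - σ.nat 49 0 0 - 1)
      else σ.mat n 4 x y := by
  refine den_fill hn (by simp) _ fun i j τ h1 h2 h3 h4 => ?_
  simp only [Test.Holds, NExpr.eval, NExpr.eval_mat, NExpr.eval_var, h2, h3, h4,
    h1 53 (by simp) (by simp) (by simp), h1 51 (by simp) (by simp) (by simp),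
    h1 49 (by simp) (by simp) (by simp), State.mat]
  by_cases hk : k ≤ σ.nat 53 i j <;> simp [hk]

/-- Treat the level `51`. -/
def treatLevel : Stmt :=
  ((fill 52 (.natLe (.var 51) (.mat 48 10 11)) (.lit 2) (.lit 0) ;;
    fill 50 (.natLe (.var 51) (.mat 48 10 11)) (.add (.mat 50 10 11) (.lit 1)) (.mat 50 10 11)) ;;
    run) ;; addLevel 1 ;; addLevel 2 ;; set 49 (.var 51)

/-- Treat the next level. -/
def levelStep : Stmt := nextLevel ;; ite (.natLe (.lit 1) (.var 51)) treatLevel skip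

theorem den_treatLevel (hT : T.IsTree) (hσ : Ready T V v σ) {h rank : Sym2 (Fin n) → ℕ}
    {k cur nxt : ℕ} (h48 : σ.mat n 48 = treeCap T h) (h50 : σ.mat n 50 = treeCap T rank)
    (h49 : σ.nat 49 0 0 = cur) (h51 : σ.nat 51 0 0 = nxt)
    (hI : LevelInv T V v h k cur rank (σ.mat n 4)) (hlt : cur < nxt)
    (hex : ∃ e ∈ T.edgeSet, h e = nxt) (hmin : ∀ e ∈ T.edgeSet, cur < h e → nxt ≤ h e) :
    (treatLevel.den σ).nat 49 0 0 = nxt ∧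
    (treatLevel.den σ).mat n 50 = treeCap T (fun e => if nxt ≤ h e then rank e + 1 else rank e) ∧
    LevelInv T V v h (k + 1) nxt (fun e => if nxt ≤ h e then rank e + 1 else rank e)
      ((treatLevel.den σ).mat n 4) := by
  set P := fill 52 (.natLe (.var 51) (.mat 48 10 11)) (.lit 2) (.lit 0) with hP
  set Q := fill 50 (.natLe (.var 51) (.mat 48 10 11)) (.add (.mat 50 10 11) (.lit 1))
    (.mat 50 10 11) with hQ
  set b : Sym2 (Fin n) → ℕ := fun e => if nxt ≤ h e then 2 else 0 with hb
  have hn0 : 0 < n := v.pos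
  have h48' : ∀ i j : Fin n, σ.nat 48 i j = treeCap T h i j := fun i j => by rw [← h48]; rfl
  have e52 : (P.den σ).mat n 52 = treeCap T b := by
    refine den_fill hσ.size (by simp) _ fun i j τ g1 _ g3 g4 => ?_
    simp only [Test.Holds, NExpr.eval, NExpr.eval_mat, NExpr.eval_var, g3, g4,
      g1 51 (by simp) (by simp) (by simp), g1 48 (by simp) (by simp) (by simp), h48', h51,
      treeCap, hb]
    by_cases hij : T.Adj i j
    · simp only [if_pos hij]
    · simp only [if_neg hij]
      rw [if_neg (by omega)]
  have e50 : (Q.den (P.den σ)).mat n 50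
      = treeCap T (fun e => if nxt ≤ h e then rank e + 1 else rank e) := by
    refine den_fill (by rw [den_nat _ rfl, hσ.size]) (by simp) _ fun i j τ g1 g2 g3 g4 => ?_
    have g5 : (P.den σ).nat 50 i j = treeCap T rank i j := by
      rw [den_nat _ rfl, ← h50]
      rfl
    rw [g5] at g2
    simp only [Test.Holds, NExpr.eval, NExpr.eval_mat, NExpr.eval_var, g2, g3, g4,
      g1 51 (by simp) (by simp) (by simp), g1 48 (by simp) (by simp) (by simp),
      den_nat P (show P.natW 51 = false from rfl), den_nat P (show P.natW 48 = false from rfl),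
      h48', h51, treeCap]
    by_cases hij : T.Adj i j
    · simp only [if_pos hij]
    · simp only [if_neg hij]
      rw [if_neg (by omega)]
  set σ₁ := Q.den (P.den σ) with hσ₁
  have hready : Ready T V v σ₁ := (hσ.den P rfl rfl rfl rfl).den Q rfl rfl rfl rfl
  have hb2 : ∀ e, b e = 0 ∨ b e = 2 := fun e => by
    simp only [hb]
    split_ifs <;> simp
  obtain ⟨q, hq, hred⟩ := den_run hT hready (b := b)
    (by rw [← e52]; exact State.mat_congr (den_nat _ rfl _))
    (fun e _ => by rcases hb2 e with h | h <;> omega)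
    -- With capacities 0 and 2 all cuts are even. The bound 2 on requirements would fail here, since
    -- some edges have capacity 0.
    (Or.inr fun e _ => by rcases hb2 e with h | h <;> rw [h] <;> decide)
    (fun w _ => Finset.even_sum _ fun e _ => by rcases hb2 e with h | h <;> rw [h] <;> decide)
  have f : ∀ B, P.natW B = false → Q.natW B = false → run.natW B = false →
      (run.den σ₁).nat B = σ.nat B := fun B g1 g2 g3 => by
    rw [den_nat _ g3, hσ₁, den_nat _ g2, den_nat _ g1]
  set σ₂ := run.den σ₁ with hσ₂
  set g := σ₂.mat n 53 with hg
  have hden : treatLevel.den σ = ((addLevel 2).den ((addLevel 1).den σ₂)).setN 49 0 0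
      (((addLevel 2).den ((addLevel 1).den σ₂)).nat 51 0 0) := by
    rw [treatLevel, den_seq, den_seq, den_seq, den_seq, den_seq, den_set, NExpr.eval_var]
  -- Some tree edge separates `x` from `y`, and its fundamental cut has capacity at most 2.
  have hgle : ∀ x y, x ≠ y → g x y ≤ 2 := by
    intro x y hxy
    obtain ⟨e, he, hs⟩ := exists_edge_sep hT v hxy
    refine (le_cut_of_sep hred.symm hs).trans ((hred.le _).trans ?_)
    rw [cut_treeCap_side hT v b he]
    rcases hb2 e with h | h <;> omega
  have e4 : ∀ x y, x ≠ y → (treatLevel.den σ).mat n 4 x y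
      = σ.mat n 4 x y + (nxt - cur - 1) * g x y := by
    intro x y hxy
    have g1 : (treatLevel.den σ).mat n 4 = ((addLevel 2).den ((addLevel 1).den σ₂)).mat n 4 := by
      rw [hden]
      exact State.mat_congr (State.setN_nat_of_ne _ _ _ _ (by simp))
    have g2 : ((addLevel 1).den σ₂).mat n 53 = g := State.mat_congr (den_nat _ rfl _)
    have g3 : σ₂.mat n 4 = σ.mat n 4 := State.mat_congr (f 4 rfl rfl rfl)
    have g4 := hgle x y hxy
    have k51 : σ₂.nat 51 0 0 = nxt := by rw [f 51 rfl rfl rfl, h51]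
    have k49 : σ₂.nat 49 0 0 = cur := by rw [f 49 rfl rfl rfl, h49]
    have k51' : ((addLevel 1).den σ₂).nat 51 0 0 = nxt := by rw [den_nat _ rfl, k51]
    have k49' : ((addLevel 1).den σ₂).nat 49 0 0 = cur := by rw [den_nat _ rfl, k49]
    rw [g1, den_addLevel (by rw [den_nat _ rfl, f 0 rfl rfl rfl, hσ.size]), g2,
      den_addLevel (by rw [f 0 rfl rfl rfl, hσ.size]), k51, k49, k51', k49', ← hg, g3]
    generalize nxt - cur - 1 = m
    have : g x y = 0 ∨ g x y = 1 ∨ g x y = 2 := by omega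
    rcases this with h | h | h <;> simp [h]
    omega
  refine ⟨?_, ?_, hI.step hlt hex hmin hred.symm
    (fun x hx y hy => hred.zero x (Finset.mem_compl.2 hx) y hy) (fun e he => ?_)
    (fun s hs t ht X hsX htX hf => ?_) e4⟩
  · rw [hden, State.setN_nat_self, den_nat _ rfl, den_nat _ rfl, f 51 rfl rfl rfl, h51]
  · rw [← e50]
    refine State.mat_congr ?_
    rw [hden, State.setN_nat_of_ne _ _ _ _ (by simp), den_nat _ rfl, den_nat _ rfl, hσ₂, den_nat _ rfl]
  · refine (hred.le _).trans_eq ?_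
    rw [cut_treeCap_side hT v b he]
  · refine le_trans (hq.ge s t 2 (by omega) fun e he hs => ?_)
      (hred.feasible s hs t ht (fun h => htX (h ▸ hsX)) X hsX htX)
    simp only [hb]
    rw [if_pos (hf e he hs)]

theorem den_levelStep (hT : T.IsTree) (hσ : Ready T V v σ) {h : Sym2 (Fin n) → ℕ}
    {k : ℕ} (h48 : σ.mat n 48 = treeCap T h)
    (hI : ∃ rank, σ.mat n 50 = treeCap T rank ∧
      LevelInv T V v h k (σ.nat 49 0 0) rank (σ.mat n 4)) :
    ∃ rank, (levelStep.den σ).mat n 50 = treeCap T rank ∧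
      LevelInv T V v h (k + 1) ((levelStep.den σ).nat 49 0 0) rank ((levelStep.den σ).mat n 4) := by
  obtain ⟨rank, h50, hI⟩ := hI
  rw [levelStep, den_seq]
  have hnext := den_nextLevel hσ.size rfl h48
  set σ₁ := nextLevel.den σ with hσ₁
  have e50 : σ₁.mat n 50 = treeCap T rank := by
    rw [← h50]
    exact State.mat_congr (den_nat _ rfl _)
  have e49 : σ₁.nat 49 = σ.nat 49 := den_nat _ rfl _
  have e4 : σ₁.mat n 4 = σ.mat n 4 := State.mat_congr (den_nat _ rfl _)
  have hedge : ∀ a c, T.Adj a c → treeCap T h a c = h s(a, c) := fun a c hac => if_pos hac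
  rcases hnext with ⟨h0, hle⟩ | ⟨hlt, ⟨x, y, hxy⟩, hmin⟩
  · rw [den_ite_neg (by simp [h0]), den_skip, e49, e4]
    refine ⟨rank, e50, hI.finished fun e he => ?_⟩
    induction e with | h a c
    rw [← hedge a c he]
    exact hle a c
  · rw [den_ite_pos (by simp only [Test.Holds, NExpr.eval, NExpr.eval_var]; omega)]
    have hadj : T.Adj x y := by
      by_contra hna
      rw [treeCap, if_neg hna] at hxy
      omega
    obtain ⟨h1, h2, h3⟩ := den_treatLevel hT (hσ.den nextLevel rfl rfl rfl rfl)
      (by rw [← h48]; exact State.mat_congr (den_nat _ rfl _)) e50 rfl rfl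
      (by rw [e49, e4]; exact hI) (by rw [e49]; exact hlt)
      ⟨s(x, y), hadj, by rw [← hedge x y hadj, hxy]⟩ (fun e he hce => by
        induction e with | h a c
        rw [← hedge a c he]
        refine hmin a c ?_
        rw [hedge a c he, ← e49]
        exact hce)
    exact ⟨_, h2, by rw [h1]; exact h3⟩

/-- The initialization of the loop over the levels. -/
def initLevels : Stmt :=
  fill 48 (.natLe (.lit 0) (.lit 0)) (.half (.mat 47 10 11)) (.lit 0) ;;
  fill 50 (.natLe (.lit 0) (.lit 0)) (.lit 0) (.lit 0) ;;
  fill 4 (.natLe (.lit 0) (.lit 0)) (.lit 0) (.lit 0) ;; set 49 (.lit 0)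

/-- The capacities of the final round. -/
def finalCap : Stmt :=
  fill 52 (.natLe (.lit 0) (.lit 0)) (.add (.add (.mat 50 10 11) (.mat 50 10 11))
    (.sub (.mat 47 10 11) (.add (.mat 48 10 11) (.mat 48 10 11)))) (.lit 0)

/-- Add the matrix `53` to the result. -/
def addFinal : Stmt :=
  fill 4 (.natLe (.lit 0) (.lit 0)) (.add (.mat 4 10 11) (.mat 53 10 11)) (.lit 0)

/-- Compute in `4` a capacity on the terminals that corresponds to the capacity `47` on the
tree. -/
def levels : Stmt := ((initLevels ;; .forLt 31 levelStep) ;; finalCap) ;; run ;; addFinal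

/-- Splitting off for arbitrarily large `c` with a number of steps depending only on `n`: each round
handles capacities bounded in terms of `n`. -/
theorem den_levels (hT : T.IsTree) (hσ : Ready T V v σ) {c : Sym2 (Fin n) → ℕ}
    (hc : σ.mat n 47 = treeCap T c) (hc2 : ∀ e ∈ T.edgeSet, 2 ≤ c e)
    (hpar : ∀ w ∉ V, Even (∑ e ∈ cutEdges T {w}, c e)) {out : Fin n → Fin n → ℕ}
    (hout : (levels.den σ).mat n 4 = out) :
    (∀ x y, x ≠ y → out x y = out y x) ∧ (∀ x ∉ V, ∀ y, y ≠ x → out x y = 0) ∧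
    (∀ e ∈ T.edgeSet, cut out (side T v e) ≤ c e) ∧
    ∀ s ∈ V, ∀ t ∈ V, ∀ X : Finset (Fin n), s ∈ X → t ∉ X → ∀ k,
      (∀ e ∈ T.edgeSet, ¬ (s ∈ side T v e ↔ t ∈ side T v e) → k ≤ c e) → k ≤ cut out X := by
  subst hout
  set σ₁ := initLevels.den σ with hσ₁
  have hready₁ : Ready T V v σ₁ := hσ.den _ rfl rfl rfl rfl
  have e48 : σ₁.mat n 48 = treeCap T fun e => c e / 2 := by
    have h1 : σ₁.mat n 48 = ((fill 48 (.natLe (.lit 0) (.lit 0)) (.half (.mat 47 10 11))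
        (.lit 0)).den σ).mat n 48 := State.mat_congr (by
      rw [hσ₁, initLevels, den_seq, den_seq, den_seq, den_nat _ rfl, den_nat _ rfl, den_nat _ rfl])
    rw [h1]
    refine den_fill hσ.size (by simp) _ fun i j τ g1 _ g3 g4 => ?_
    have g5 : σ.nat 47 i j = treeCap T c i j := by rw [← hc]; rfl
    simp only [Test.Holds, NExpr.eval, NExpr.eval_mat, le_refl, if_true, g3, g4,
      g1 47 (by simp) (by simp) (by simp), g5, treeCap]
    split_ifs <;> simp
  have e50 : σ₁.mat n 50 = treeCap T fun _ => 0 := by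
    set σ₀ := (fill 48 (.natLe (.lit 0) (.lit 0)) (.half (.mat 47 10 11)) (.lit 0)).den σ with hσ₀
    have h1 : σ₁.mat n 50 = ((fill 50 (.natLe (.lit 0) (.lit 0)) (.lit 0) (.lit 0)).den σ₀).mat n 50
        := State.mat_congr (by
      rw [hσ₁, initLevels, den_seq, den_seq, den_seq, den_nat _ rfl, den_nat _ rfl])
    rw [h1]
    refine den_fill (by rw [hσ₀, den_nat _ rfl, hσ.size]) (by simp) _ fun i j τ _ _ _ _ => ?_
    simp [treeCap]
  have e4 : σ₁.mat n 4 = fun _ _ => 0 := by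
    set σ₀ := (fill 50 (.natLe (.lit 0) (.lit 0)) (.lit 0) (.lit 0)).den
      ((fill 48 (.natLe (.lit 0) (.lit 0)) (.half (.mat 47 10 11)) (.lit 0)).den σ) with hσ₀
    have h1 : σ₁.mat n 4 = ((fill 4 (.natLe (.lit 0) (.lit 0)) (.lit 0) (.lit 0)).den σ₀).mat n 4
        := State.mat_congr (by
      rw [hσ₁, initLevels, den_seq, den_seq, den_seq, den_nat _ rfl])
    rw [h1]
    refine den_fill (by rw [hσ₀, den_nat _ rfl, den_nat _ rfl, hσ.size]) (by simp) _
      fun i j τ _ _ _ _ => ?_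
    simp
  have e49 : σ₁.nat 49 0 0 = 0 := by simp [hσ₁, initLevels]
  refine Exists.elim (den_for (c := 31) (P := levelStep) hready₁.size (fun k τ =>
    ∃ rank, τ.mat n 50 = treeCap T rank ∧
      LevelInv T V v (fun e => c e / 2) k (τ.nat 49 0 0) rank (τ.mat n 4)) ?_ ?_) ?_
  · rw [e49, e4]
    exact ⟨_, e50, LevelInv.init hT⟩
  · intro k hk τ hτ _ hI
    refine den_levelStep hT ?_ ?_ ?_
    · refine Ready.setN ?_ _ _ _ (by simp) (by simp) (by simp) (by simp)
      exact hready₁.congr (hτ 0 rfl) (hτ 1 rfl) (hτ 2 rfl) (hτ 44 rfl)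
    · rw [← e48]
      exact State.mat_congr ((State.setN_nat_of_ne _ _ _ _ (by simp)).trans (hτ 48 rfl))
    · rw [State.mat_congr (State.setN_nat_of_ne τ (A := 31) (B := 50) _ _ _ (by simp)),
        State.mat_congr (State.setN_nat_of_ne τ (A := 31) (B := 4) _ _ _ (by simp)),
        State.setN_nat_of_ne τ (A := 31) (B := 49) _ _ _ (by simp)]
      exact hI
  · rintro τ ⟨⟨rank, h50, hI⟩, hτ, -, he⟩
    set σ₂ := (Stmt.forLt 31 levelStep).den σ₁ with hσ₂
    have f : ∀ B, B ≠ 31 → σ₂.nat B = τ.nat B := fun B hB => by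
      rw [he, State.setN_nat_of_ne _ _ _ _ hB]
    rw [← f 49 (by simp), ← State.mat_congr (f 4 (by simp))] at hI
    rw [← State.mat_congr (f 50 (by simp))] at h50
    have hcur : ∀ e ∈ T.edgeSet, c e / 2 ≤ σ₂.nat 49 0 0 := by
      rcases hI.count with h | h
      · exact h
      · intro e he'
        by_contra hlt
        have : 0 < ((edgesOf T).filter fun e => σ₂.nat 49 0 0 < c e / 2).card :=
          Finset.card_pos.2 ⟨e, Finset.mem_filter.2 ⟨mem_edgesOf.2 he', not_le.1 hlt⟩⟩
        omega
    set b : Sym2 (Fin n) → ℕ := fun e => 2 * rank e + c e % 2 with hb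
    set σ₃ := finalCap.den σ₂ with hσ₃
    have hready₂ : Ready T V v σ₂ := hready₁.den _ rfl rfl rfl rfl
    have e52 : σ₃.mat n 52 = treeCap T b := by
      refine den_fill hready₂.size (by simp) _ fun i j τ' g1 _ g3 g4 => ?_
      have g5 : σ₂.nat 47 i j = treeCap T c i j := by
        rw [← hc, hσ₂, den_nat _ rfl, hσ₁, den_nat _ rfl]
        rfl
      have g6 : σ₂.nat 48 i j = treeCap T (fun e => c e / 2) i j := by
        rw [← e48, hσ₂, den_nat _ rfl]
        rfl
      have g7 : σ₂.nat 50 i j = treeCap T rank i j := by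
        rw [← h50]
        rfl
      simp only [Test.Holds, NExpr.eval, NExpr.eval_mat, le_refl, if_true, g3, g4,
        g1 47 (by simp) (by simp) (by simp), g1 48 (by simp) (by simp) (by simp),
        g1 50 (by simp) (by simp) (by simp), g5, g6, g7, treeCap, hb]
      split_ifs <;> omega
    have hready₃ : Ready T V v σ₃ := hready₂.den _ rfl rfl rfl rfl
    obtain ⟨q, hq, hred⟩ := den_run hT hready₃ e52
      (fun e he' => by
        have := hI.rank_le e he'
        simp only [hb]
        omega)
      -- From `c e ≥ 2` the half of `c e` is positive, so at least one copy is held back and `b e ≥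
      -- 2`.
      (Or.inl fun e he' => by
        have h1 := hc2 e he'
        have h2 := hcur e he'
        have h3 := hI.rank_pos (by omega) e he' (by omega)
        simp only [hb]
        omega)
      (fun w hw => by
        have h1 := hpar w hw
        simp only [hb, Finset.sum_add_distrib]
        refine Even.add (Finset.even_sum _ fun e _ => even_two_mul _) ?_
        have h2 : Even (∑ e ∈ cutEdges T {w}, (c e % 2 + 2 * (c e / 2))) := by
          simpa only [Nat.mod_add_div] using h1
        rw [Finset.sum_add_distrib] at h2
        exact (Nat.even_add.1 h2).2 (Finset.even_sum _ fun e _ => even_two_mul _))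
    refine hI.finish hT hcur (fun e => rfl) hq hred fun x y _ => ?_
    have hfin : (addFinal.den (run.den σ₃)).mat n 4 = fun x y =>
        σ₂.mat n 4 x y + (run.den σ₃).mat n 53 x y := by
      refine den_fill (by rw [den_nat _ rfl, hready₃.size]) (by simp) _
        fun i j τ' g1 g2 g3 g4 => ?_
      have g5 : (run.den σ₃).nat 4 = σ₂.nat 4 := by
        rw [den_nat _ rfl, hσ₃, den_nat _ rfl]
      rw [g5] at g2
      simp only [Test.Holds, NExpr.eval, NExpr.eval_mat, le_refl, if_true, g2, g3, g4,
        g1 53 (by simp) (by simp) (by simp), State.mat]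
    exact congrFun (congrFun hfin x) y

end Stmt

end RAM

/-! ### Joins given by terminal sets, and shortest joins. -/

namespace SplittingOff

variable {N : Type u} [Fintype N] [DecidableEq N]

/-- Edges inside `X` count twice in the degree sum, edges leaving `X` once there and once in the
cut. -/
theorem even_sum_cut_add_cut {g : N → N → ℕ} (hg : ∀ x y, g x y = g y x) (X : Finset N) :
    Even (∑ y ∈ X, cut g {y} + cut g X) := by
  induction X using Finset.induction_on with
  | empty => simp [cut, between]
  | insert a X ha ih =>
    have h1 := cut_add_cut hg {a} X
    have h2 : cut g ({a} ∩ X) = 0 := by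
      rw [Finset.singleton_inter_of_notMem ha]
      simp [cut, between]
    rw [← Finset.insert_eq, h2] at h1
    rw [Finset.sum_insert ha]
    rw [Nat.even_iff] at *
    omega

end SplittingOff

namespace TreeCut

open SplittingOff
open scoped symmDiff

theorem sum_symmDiff_add {α : Type*} [DecidableEq α] (A B : Finset α) (f : α → ℕ) :
    ∑ x ∈ A ∆ B, f x + 2 * ∑ x ∈ A ∩ B, f x = ∑ x ∈ A, f x + ∑ x ∈ B, f x := by
  have h1 : A ∆ B = (A \ B) ∪ (B \ A) := rfl
  rw [h1, Finset.sum_union (Finset.disjoint_left.2 fun x hx hx' => by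
    rw [Finset.mem_sdiff] at hx hx'
    exact hx.2 hx'.1)]
  have h2 := Finset.sum_inter_add_sum_sdiff A B f
  have h3 := Finset.sum_inter_add_sum_sdiff B A f
  rw [Finset.inter_comm B A] at h3
  omega

variable {N : Type u} [Fintype N] [DecidableEq N] {T : SimpleGraph N}

open Classical in
/-- The join of the even node set `Y` in the tree. -/
noncomputable def joinOf (T : SimpleGraph N) (v : N) (Y : Finset N) : Finset (Sym2 N) :=
  (edgesOf T).filter fun e => Odd (∑ y ∈ Y, sep (side T v e) v y)

open Classical in
/-- The edges of the path between two nodes. -/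
noncomputable def pathOf (T : SimpleGraph N) (v : N) (a b : N) : Finset (Sym2 N) :=
  (edgesOf T).filter fun e => ¬ (a ∈ side T v e ↔ b ∈ side T v e)

theorem mem_joinOf {v : N} {Y : Finset N} {e : Sym2 N} :
    e ∈ joinOf T v Y ↔ e ∈ T.edgeSet ∧ Odd (∑ y ∈ Y, sep (side T v e) v y) := by
  rw [joinOf, Finset.mem_filter, mem_edgesOf]

theorem mem_pathOf {v a b : N} {e : Sym2 N} :
    e ∈ pathOf T v a b ↔ e ∈ T.edgeSet ∧ ¬ (a ∈ side T v e ↔ b ∈ side T v e) := by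
  rw [pathOf, Finset.mem_filter, mem_edgesOf]

theorem pathOf_self (v a : N) : pathOf T v a a = ∅ := by
  ext e
  simp [mem_pathOf]

theorem joinOf_symmDiff (v : N) (Y Z : Finset N) :
    joinOf T v (Y ∆ Z) = joinOf T v Y ∆ joinOf T v Z := by
  ext e
  have h := sum_symmDiff_add Y Z fun y => sep (side T v e) v y
  simp only [Finset.mem_symmDiff, mem_joinOf, Nat.odd_iff]
  have : (∑ y ∈ Y ∆ Z, sep (side T v e) v y) % 2 = 1 ↔
      ¬ ((∑ y ∈ Y, sep (side T v e) v y) % 2 = 1 ↔ (∑ y ∈ Z, sep (side T v e) v y) % 2 = 1) := by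
    omega
  tauto

theorem joinOf_pair (v : N) {a b : N} (hab : a ≠ b) : joinOf T v {a, b} = pathOf T v a b := by
  ext e
  rw [mem_joinOf, mem_pathOf, Finset.sum_pair hab]
  refine and_congr_right fun _ => ?_
  unfold sep
  by_cases h1 : v ∈ side T v e <;> by_cases h2 : a ∈ side T v e <;>
    by_cases h3 : b ∈ side T v e <;> simp [h1, h2, h3]

theorem even_card_symmDiff {α : Type*} [DecidableEq α] {Y Z : Finset α} (hY : Even Y.card)
    (hZ : Even Z.card) : Even (Y ∆ Z).card := by
  have h := sum_symmDiff_add Y Z fun _ => 1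
  simp only [← Finset.card_eq_sum_ones] at h
  rw [Nat.even_iff] at *
  omega

theorem sum_symmDiff_eq {α : Type*} [DecidableEq α] [Fintype α] (F P : Finset α) (l : α → ℝ) :
    ∑ e ∈ F ∆ P, l e = ∑ e ∈ F, l e + ∑ e ∈ P, if e ∈ F then - l e else l e := by
  have h : ∀ (A : Finset α) (f : α → ℝ), ∑ e ∈ A, f e = ∑ e, if e ∈ A then f e else 0 := by
    intro A f
    simp
  rw [h, h F, h P, ← Finset.sum_add_distrib]
  refine Finset.sum_congr rfl fun e _ => ?_
  by_cases h1 : e ∈ F <;> by_cases h2 : e ∈ P <;> simp [h1, h2, Finset.mem_symmDiff]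

/-- Each element of `P` lies in exactly one of `F`, `F'` and merely moves to the other. -/
theorem sum_symmDiff_add_sum_symmDiff {α : Type*} [DecidableEq α] [Fintype α] {F F' P : Finset α}
    (hP : P ⊆ F ∆ F') (l : α → ℝ) :
    ∑ e ∈ F ∆ P, l e + ∑ e ∈ F' ∆ P, l e = ∑ e ∈ F, l e + ∑ e ∈ F', l e := by
  rw [sum_symmDiff_eq F P, sum_symmDiff_eq F' P]
  have h : (∑ e ∈ P, if e ∈ F then - l e else l e) + (∑ e ∈ P, if e ∈ F' then - l e else l e)
      = 0 := by
    rw [← Finset.sum_add_distrib]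
    refine Finset.sum_eq_zero fun e he => ?_
    have := hP he
    rw [Finset.mem_symmDiff] at this
    rcases this with ⟨h1, h2⟩ | ⟨h1, h2⟩ <;> simp [h1, h2]
  linarith

/-- `F` is a shortest set of the form `O ∆ joinOf T v Y` with an even subset `Y` of `U`. -/
def IsOptimalJoin (T : SimpleGraph N) (v : N) (l : Sym2 N → ℝ) (O : Finset (Sym2 N)) (U : Finset N)
    (F : Finset (Sym2 N)) : Prop :=
  (∃ Y ⊆ U, Even Y.card ∧ F = O ∆ joinOf T v Y) ∧
    ∀ Y ⊆ U, Even Y.card → ∑ e ∈ F, l e ≤ ∑ e ∈ O ∆ joinOf T v Y, l e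

theorem isOptimalJoin_empty (v : N) (l : Sym2 N → ℝ) (O : Finset (Sym2 N)) :
    IsOptimalJoin T v l O ∅ O := by
  have h : joinOf T v ∅ = ∅ := by
    ext e
    simp [mem_joinOf]
  refine ⟨⟨∅, subset_rfl, by simp, by rw [h, ← Finset.bot_eq_empty, symmDiff_bot]⟩,
    fun Y hY _ => ?_⟩
  rw [Finset.subset_empty.1 hY, h, ← Finset.bot_eq_empty, symmDiff_bot]

/-- A competitor `F'` using the new terminal `a` differs from `F` by a join that contains a path
from `a` to some `t ∈ U`. Exchanging this path in both sets preserves the total length and turns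
`F'` into a competitor for `U`, which is no shorter than `F`. So `F` with the path exchanged is no
longer than `F'`. The choice `b = a` stands for leaving `F` unchanged. -/
theorem IsOptimalJoin.insert (hT : T.IsTree) {v : N} {l : Sym2 N → ℝ} {O F : Finset (Sym2 N)}
    {U : Finset N} (h : IsOptimalJoin T v l O U F) {a b : N} (ha : a ∉ U) (hb : b ∈ insert a U)
    (hmin : ∀ t ∈ insert a U, ∑ e ∈ F ∆ pathOf T v a b, l e ≤ ∑ e ∈ F ∆ pathOf T v a t, l e) :
    IsOptimalJoin T v l O (insert a U) (F ∆ pathOf T v a b) := by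
  obtain ⟨⟨Y, hYU, hY, hF⟩, hopt⟩ := h
  have haY : a ∉ Y := fun h => ha (hYU h)
  refine ⟨?_, fun Z hZ hZe => ?_⟩
  · rcases Finset.mem_insert.1 hb with rfl | hb
    · exact ⟨Y, hYU.trans (Finset.subset_insert _ _), hY, by
      rw [pathOf_self, hF, ← Finset.bot_eq_empty, symmDiff_bot]⟩
    · have hab : a ≠ b := fun h => ha (h ▸ hb)
      refine ⟨Y ∆ {a, b}, fun x hx => ?_, even_card_symmDiff hY ?_, ?_⟩
      · rw [Finset.mem_symmDiff] at hx
        rcases hx with ⟨hx, -⟩ | ⟨hx, -⟩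
        · exact Finset.mem_insert_of_mem (hYU hx)
        · rcases Finset.mem_insert.1 hx with rfl | hx
          · exact Finset.mem_insert_self _ _
          · rw [Finset.mem_singleton.1 hx]
            exact Finset.mem_insert_of_mem hb
      · rw [Finset.card_pair hab]
        decide
      · rw [joinOf_symmDiff, joinOf_pair v hab, hF, symmDiff_assoc]
  · by_cases haZ : a ∈ Z
    · have haD : a ∈ Y ∆ Z := by
        rw [Finset.mem_symmDiff]
        exact Or.inr ⟨haZ, haY⟩
      obtain ⟨t, ht, hta, hodd⟩ := exists_path_in_join hT v a (Y ∆ Z) (even_card_symmDiff hY hZe) haD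
      have htU : t ∈ U := by
        rw [Finset.mem_symmDiff] at ht
        rcases ht with ⟨ht, -⟩ | ⟨ht, -⟩
        · exact hYU ht
        · exact (Finset.mem_insert.1 (hZ ht)).resolve_left hta
      have hP : pathOf T v a t ⊆ F ∆ (O ∆ joinOf T v Z) := by
        have h1 : F ∆ (O ∆ joinOf T v Z) = joinOf T v (Y ∆ Z) := by
          rw [hF, joinOf_symmDiff, symmDiff_comm O (joinOf T v Y), symmDiff_assoc,
            symmDiff_symmDiff_cancel_left]
        rw [h1]
        intro e he
        rw [mem_pathOf] at he
        exact mem_joinOf.2 ⟨he.1, hodd e he.1 he.2⟩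
      have h1 := sum_symmDiff_add_sum_symmDiff hP l
      have h2 : (O ∆ joinOf T v Z) ∆ pathOf T v a t = O ∆ joinOf T v (Z ∆ {a, t}) := by
        rw [joinOf_symmDiff, joinOf_pair v hta.symm, symmDiff_assoc]
      have h3 := hopt (Z ∆ {a, t}) (fun x hx => by
        rw [Finset.mem_symmDiff, Finset.mem_insert, Finset.mem_singleton] at hx
        rcases hx with ⟨hx, hx'⟩ | ⟨rfl | rfl, hx'⟩
        · exact (Finset.mem_insert.1 (hZ hx)).resolve_left fun h => hx' (Or.inl h)
        · exact absurd haZ hx'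
        · exact htU) (even_card_symmDiff hZe (by rw [Finset.card_pair hta.symm]; decide))
      rw [h2] at h1
      have h4 := hmin t (Finset.mem_insert_of_mem htU)
      linarith
    · have hZU : Z ⊆ U := fun x hx =>
        (Finset.mem_insert.1 (hZ hx)).resolve_left fun h => haZ (h ▸ hx)
      have h1 := hmin a (Finset.mem_insert_self _ _)
      rw [pathOf_self] at h1
      rw [← Finset.bot_eq_empty, symmDiff_bot] at h1
      exact h1.trans (hopt Z hZU hZe)

end TreeCut

/-! ### Parity sets of realizations as joins. -/

namespace TreeMetricInstance

open SplittingOff TreeCut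
open scoped symmDiff

variable {N : Type u} [Fintype N] [DecidableEq N] (I : TreeMetricInstance N) (v : I.V)

open Classical in
/-- The tree edges with an odd requirement. -/
noncomputable def oddReq : Finset (Sym2 N) := (edgesOf I.T).filter fun e => Odd (I.cR v e)

theorem mem_oddReq {e : Sym2 N} : e ∈ I.oddReq v ↔ e ∈ I.T.edgeSet ∧ Odd (I.cR v e) := by
  rw [oddReq, Finset.mem_filter, mem_edgesOf]

theorem mem_side_self (v : N) (e : Sym2 N) (T : SimpleGraph N) : v ∈ side T v e :=
  mem_side.2 (SimpleGraph.Reachable.refl v)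

/-- `Y` is the set of terminals of odd degree in `y`. The load of `e` has the parity of the number
of nodes of `Y` beyond `e`, which is the parity describing `joinOf`. -/
theorem exists_oddEdges_eq (y : Sym2 I.V → ℕ) : ∃ Y ⊆ I.V, Even Y.card ∧
    I.oddEdges v y = I.oddReq v ∆ joinOf I.T v Y := by
  classical
  let g : N → N → ℕ := fun a b => if h : a ∈ I.V ∧ b ∈ I.V then y s(⟨a, h.1⟩, ⟨b, h.2⟩) else 0
  have hg : ∀ a b, g a b = g b a := by
    intro a b
    simp only [g]
    by_cases h : a ∈ I.V ∧ b ∈ I.V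
    · rw [dif_pos h, dif_pos h.symm, Sym2.eq_swap]
    · rw [dif_neg h, dif_neg fun h' => h h'.symm]
  have hload : ∀ e, I.load v y e = cut g (side I.T v e) := by
    intro e
    refine sum_cutEdges_eq_cut (fun i j _ => ?_) (fun a b _ h => ?_) _
    · simp only [g]
      rw [dif_pos ⟨i.2, j.2⟩]
    · simp only [g]
      rw [dif_neg (by tauto)]
  let Y : Finset N := I.V.filter fun a => Odd (cut g {a})
  have hzero : ∀ a ∉ I.V, cut g {a} = 0 := by
    intro a ha
    rw [cut, between, Finset.sum_singleton]
    refine Finset.sum_eq_zero fun b _ => ?_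
    simp only [g]
    rw [dif_neg (by tauto)]
  have hpar : ∀ X : Finset N, Even (cut g X + ∑ a ∈ Y, if a ∈ X then 1 else 0) := by
    intro X
    have h1 := even_sum_cut_add_cut hg X
    have h2 : ∑ a ∈ Y, (if a ∈ X then 1 else 0) = ∑ a ∈ X, if Odd (cut g {a}) then 1 else 0 := by
      rw [← Finset.sum_filter, ← Finset.sum_filter]
      refine Finset.sum_congr ?_ fun _ _ => rfl
      ext a
      simp only [Y, Finset.mem_filter]
      constructor
      · rintro ⟨⟨-, h⟩, h'⟩
        exact ⟨h', h⟩
      · rintro ⟨h', h⟩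
        refine ⟨⟨?_, h⟩, h'⟩
        by_contra ha
        rw [hzero a ha] at h
        exact absurd h (by decide)
    have h3 : Even (∑ a ∈ X, (cut g {a} + if Odd (cut g {a}) then 1 else 0)) := by
      refine Finset.even_sum _ fun a _ => ?_
      split_ifs with h
      · exact h.add_odd odd_one
      · simpa using h
    rw [Finset.sum_add_distrib] at h3
    rw [h2]
    rw [Nat.even_iff] at *
    omega
  refine ⟨Y, Finset.filter_subset _ _, ?_, ?_⟩
  · have h := hpar Finset.univ
    have h0 : cut g Finset.univ = 0 := by simp [cut, between]
    rw [h0, zero_add] at h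
    simpa using h
  · ext e
    rw [mem_oddEdges, Finset.mem_symmDiff, mem_oddReq, mem_joinOf, mem_edgesOf]
    have h1 := hpar (side I.T v e)ᶜ
    rw [cut_compl hg, ← hload] at h1
    have h2 : ∑ a ∈ Y, (if a ∈ (side I.T v e)ᶜ then 1 else 0)
        = ∑ a ∈ Y, sep (side I.T v e) v a := by
      refine Finset.sum_congr rfl fun a _ => ?_
      have hv := mem_side_self (v : N) e I.T
      by_cases ha : a ∈ side I.T v e <;> simp [sep, hv, ha]
    rw [h2] at h1
    by_cases he : e ∈ I.T.edgeSet
    · simp only [he, true_and]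
      rw [Nat.even_iff] at h1
      simp only [Nat.odd_iff]
      omega
    · simp [he]

/-- On every edge the capacity has the parity of the join of `Y`, and that join has even degree at
each node outside `Y`. -/
theorem even_sum_cR_add {F : Finset (Sym2 N)} {Y : Finset N} (hY : Even Y.card)
    (hYV : Y ⊆ I.V) (hF : F = I.oddReq v ∆ joinOf I.T v Y) {w : N} (hw : w ∉ I.V) :
    Even (∑ e ∈ cutEdges I.T {w}, (I.cR v e + if e ∈ F then 1 else 0)) := by
  classical
  have h1 := (even_sum_card_iff I.isTree (v : N) w Y hY).2 fun h => hw (hYV h)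
  have h2 : Even (∑ e ∈ cutEdges I.T {w}, ((I.cR v e + if e ∈ F then 1 else 0)
      + ∑ y ∈ Y, sep (side I.T v e) v y)) := by
    refine Finset.even_sum _ fun e he => ?_
    have he' := (mem_cutEdges_singleton.1 he).1
    have h3 : e ∈ F ↔ ¬ (Odd (I.cR v e) ↔ Odd (∑ y ∈ Y, sep (side I.T v e) v y)) := by
      rw [hF, Finset.mem_symmDiff, mem_oddReq, mem_joinOf]
      tauto
    rw [Nat.odd_iff, Nat.odd_iff] at h3
    rw [Nat.even_iff]
    split_ifs with h
    · have := h3.1 h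
      omega
    · have := mt h3.2 h
      omega
  rw [Finset.sum_add_distrib] at h2
  exact (Nat.even_add.1 h2).2 h1

/-- The requirement of an edge does not depend on the root. -/
theorem cR_root (v v' : I.V) (e : Sym2 N) : I.cR v e = I.cR v' e := by
  have key : ∀ v v' : I.V, I.cR v e ≤ I.cR v' e := by
    intro v v'
    rw [cR_eq]
    refine maxReq_le _ fun i hi j hj => I.r_le_cR v' ?_
    obtain ⟨p, hp⟩ := (I.isTree.connected.preconnected (i : N) (j : N)).exists_isPath
    rw [← mem_edges_iff I.isTree (v' : N) e p hp.isTrail,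
      mem_edges_iff I.isTree (v : N) e p hp.isTrail]
    exact fun h => hj (h.1 hi)
  exact le_antisymm (key v v') (key v' v)

end TreeMetricInstance

/-! ### Computing edge requirements and a shortest join. -/

namespace RAM

open Stmt SplittingOff TreeCut
open scoped symmDiff

variable {n : ℕ} {T : SimpleGraph (Fin n)} {V : Finset (Fin n)} {v : Fin n} {σ : State}

theorem sum_arcs (φ : Sym2 (Fin n) → ℝ) :
    ∑ p ∈ arcs T, φ s(p.1, p.2) = 2 * ∑ e ∈ edgesOf T, φ e := by
  classical
  rw [← Finset.sum_fiberwise_of_maps_to (s := arcs T) (t := edgesOf T) (g := fun p => s(p.1, p.2))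
    (fun p hp => mem_edgesOf.2 (mem_arcs.1 hp)), Finset.mul_sum]
  refine Finset.sum_congr rfl fun e he => ?_
  induction e with | h a b
  have hab : T.Adj a b := mem_edgesOf.1 he
  have h : (arcs T).filter (fun p => s(p.1, p.2) = s(a, b)) = {(a, b), (b, a)} := by
    ext ⟨x, y⟩
    rw [Finset.mem_filter, mem_arcs, Finset.mem_insert, Finset.mem_singleton, Sym2.eq_iff,
      Prod.mk.injEq, Prod.mk.injEq]
    constructor
    · exact fun h => h.2
    · rintro (⟨rfl, rfl⟩ | ⟨rfl, rfl⟩)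
      · exact ⟨hab, Or.inl ⟨rfl, rfl⟩⟩
      · exact ⟨hab.symm, Or.inr ⟨rfl, rfl⟩⟩
  rw [h, Finset.sum_pair (fun h => hab.ne (congrArg Prod.fst h))]
  rw [Sym2.eq_swap (a := b)]
  ring

/-- The indicator of a set of edges. -/
def ind (F : Finset (Sym2 (Fin n))) (e : Sym2 (Fin n)) : ℕ := if e ∈ F then 1 else 0

namespace Stmt

/-- Raise the entry `45[15, 16]` to the requirement between `32` and `33` if the marked set
separates them. -/
def raise : Stmt :=
  ite (.conj (.natLe (.lit 1) (.vec 42 32)) (.conj (.natLe (.vec 42 33) (.lit 0))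
      (.natLe (.mat 45 15 16) (.mat 3 32 33))))
    (nat 45 (.var 15) (.var 16) (.mat 3 32 33)) skip

/-- Compute in `45` the requirements of the edges of the tree. -/
def reqMat : Stmt :=
  fill 45 (.natLe (.lit 0) (.lit 0)) (.lit 0) (.lit 0) ;; forEdges (.forLt 32 (.forLt 33 raise))

theorem den_raise {ρ : Fin n → Fin n → ℕ} (hn : σ.nat 0 0 0 = n) (hρ : σ.mat n 3 = ρ)
    {S : Finset (Fin n)} (hS : ∀ i : Fin n, σ.nat 42 i 0 = if i ∈ S then 1 else 0) {x y : Fin n}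
    (hx : σ.nat 15 0 0 = x) (hy : σ.nat 16 0 0 = y) {g : Fin n → Fin n → ℕ}
    (hg : ((Stmt.forLt 32 (.forLt 33 raise)).den σ).mat n 45 = g) :
    (∀ i ∈ S, ∀ j ∉ S, ρ i j ≤ g x y) ∧
      (g x y = σ.mat n 45 x y ∨ ∃ i ∈ S, ∃ j ∉ S, g x y = ρ i j) ∧
      ∀ a b, ¬ (a = x ∧ b = y) → g a b = σ.mat n 45 a b := by
  subst hg
  refine Exists.elim (den_for_for (c := 32) (d := 33) (n := n) (P := raise) hn rfl (by simp) rfl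
    (fun a b τ => (∀ i ∈ S, ∀ j ∉ S, (i : ℕ) < a ∨ (i : ℕ) = a ∧ (j : ℕ) < b →
        ρ i j ≤ τ.mat n 45 x y) ∧
      (τ.mat n 45 x y = σ.mat n 45 x y ∨ ∃ i ∈ S, ∃ j ∉ S, τ.mat n 45 x y = ρ i j) ∧
      ∀ a b, ¬ (a = x ∧ b = y) → τ.mat n 45 a b = σ.mat n 45 a b) ?_ ?_ ?_ ?_) ?_
  · exact ⟨by simp, Or.inl rfl, fun _ _ _ => rfl⟩
  · rintro a ha b hb τ hτ _ ⟨h1, h2, h3⟩ h32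
    let i : Fin n := ⟨a, ha⟩
    let j : Fin n := ⟨b, hb⟩
    have e15 : τ.nat 15 0 0 = x := by rw [hτ 15 rfl, hx]
    have e16 : τ.nat 16 0 0 = y := by rw [hτ 16 rfl, hy]
    have e3 : τ.nat 3 a b = ρ i j := by
      rw [hτ 3 rfl, ← hρ]
      rfl
    have ei : τ.nat 42 a 0 = if i ∈ S then 1 else 0 := by rw [hτ 42 rfl, ← hS i]
    have ej : τ.nat 42 b 0 = if j ∈ S then 1 else 0 := by rw [hτ 42 rfl, ← hS j]
    have hall : ∀ i' j' : Fin n, (i' : ℕ) < a ∨ (i' : ℕ) = a ∧ (j' : ℕ) < b + 1 →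
        (i' = i ∧ j' = j) ∨ ((i' : ℕ) < a ∨ (i' : ℕ) = a ∧ (j' : ℕ) < b) := by
      intro i' j' h
      simp only [Fin.ext_iff, i, j]
      omega
    have htest : (Test.conj (.natLe (.lit 1) (.vec 42 32)) (.conj (.natLe (.vec 42 33) (.lit 0))
        (.natLe (.mat 45 15 16) (.mat 3 32 33)))).Holds (τ.setN 33 0 0 b)
        ↔ i ∈ S ∧ j ∉ S ∧ τ.mat n 45 x y ≤ ρ i j := by
      simp only [Test.Holds, NExpr.eval, NExpr.eval_vec, NExpr.eval_mat, ne_eq, Nat.reduceEqDiff,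
        not_false_eq_true, State.setN_nat_of_ne, State.setN_nat_self, h32, e15, e16, e3, ei, ej,
        State.mat]
      by_cases g1 : i ∈ S <;> by_cases g2 : j ∈ S <;> simp [g1, g2]
    by_cases hc : i ∈ S ∧ j ∉ S ∧ τ.mat n 45 x y ≤ ρ i j
    · rw [raise, den_ite_pos (htest.2 hc)]
      have hm : ∀ p q : Fin n, ((nat 45 (.var 15) (.var 16) (.mat 3 32 33)).den
          (τ.setN 33 0 0 b)).mat n 45 p q = if p = x ∧ q = y then ρ i j else τ.mat n 45 p q := by
        intro p q
        simp only [State.mat, den_natStmt, State.setN_nat_apply (A := 45), NExpr.eval_var,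
          NExpr.eval_mat, ne_eq, Nat.reduceEqDiff, not_false_eq_true, State.setN_nat_of_ne,
          State.setN_nat_self, h32, e15, e16, e3, true_and, Fin.val_inj]
      refine ⟨fun i' hi' j' hj' h => ?_, ?_, fun p q hpq => ?_⟩
      · rw [hm, if_pos ⟨rfl, rfl⟩]
        rcases hall i' j' h with ⟨rfl, rfl⟩ | h
        · exact le_rfl
        · exact (h1 i' hi' j' hj' h).trans hc.2.2
      · rw [hm, if_pos ⟨rfl, rfl⟩]
        exact Or.inr ⟨i, hc.1, j, hc.2.1, rfl⟩
      · rw [hm, if_neg hpq, h3 p q hpq]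
    · rw [raise, den_ite_neg (mt htest.1 hc), den_skip,
        State.mat_congr (State.setN_nat_of_ne _ _ _ _ (by simp))]
      refine ⟨fun i' hi' j' hj' h => ?_, h2, h3⟩
      rcases hall i' j' h with ⟨rfl, rfl⟩ | h
      · exact le_of_lt (not_le.1 fun h' => hc ⟨hi', hj', h'⟩)
      · exact h1 i' hi' j' hj' h
  · intro a τ z h
    rw [State.mat_congr (State.setN_nat_of_ne _ _ _ _ (by simp))]
    exact h
  · rintro a τ z ⟨h1, h2, h3⟩
    rw [State.mat_congr (State.setN_nat_of_ne _ _ _ _ (by simp))]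
    refine ⟨fun i hi j hj hij => h1 i hi j hj ?_, h2, h3⟩
    have := j.2
    omega
  · rintro τ ⟨⟨h1, h2, h3⟩, -, -, he⟩
    rw [he, State.mat_congr (State.setN_nat_of_ne _ _ _ _ (by simp))]
    exact ⟨fun i hi j hj => h1 i hi j hj (Or.inl i.2), h2, h3⟩

theorem den_reqMat {ρ : Fin n → Fin n → ℕ} (hσ : Ready T V v σ) (hρ : σ.mat n 3 = ρ)
    {g : Fin n → Fin n → ℕ} (hg : (reqMat.den σ).mat n 45 = g) :
    (∀ x y, ¬ T.Adj x y → g x y = 0) ∧ ∀ x y, T.Adj x y →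
      (∀ i ∈ side T v s(x, y), ∀ j ∉ side T v s(x, y), ρ i j ≤ g x y) ∧
      (g x y = 0 ∨ ∃ i ∈ side T v s(x, y), ∃ j ∉ side T v s(x, y), g x y = ρ i j) := by
  classical
  subst hg
  rw [reqMat, den_seq]
  set P := fill 45 (.natLe (.lit 0) (.lit 0)) (.lit 0) (.lit 0) with hP
  have h45 : (P.den σ).mat n 45 = fun _ _ => 0 :=
    den_fill hσ.size (by simp) _ fun i j τ _ _ _ _ => by simp
  have hmain := den_forEdges (σ := P.den σ) (T := T) (V := V) (v := v)
    (P := .forLt 32 (.forLt 33 raise)) (hσ.den P rfl rfl rfl rfl) ⟨rfl, rfl, rfl, rfl, rfl⟩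
    (fun S τ => (∀ x y, (x, y) ∉ S → τ.mat n 45 x y = 0) ∧ ∀ x y, (x, y) ∈ S →
      (∀ i ∈ side T v s(x, y), ∀ j ∉ side T v s(x, y), ρ i j ≤ τ.mat n 45 x y) ∧
      (τ.mat n 45 x y = 0 ∨ ∃ i ∈ side T v s(x, y), ∃ j ∉ side T v s(x, y),
        τ.mat n 45 x y = ρ i j)) ?_ ?_ ?_
  · refine ⟨fun x y h => hmain.1 x y (mt mem_arcs.1 h), fun x y h => hmain.2 x y (mem_arcs.2 h)⟩
  · rw [h45]
    simp
  · intro S τ τ' h1 _ h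
    rw [State.mat_congr (h1 45 rfl)]
    exact h
  · rintro x y hxy S hS τ hready hτ - h15 h16 hvis ⟨h1, h2⟩
    obtain ⟨g1, g2, g3⟩ := den_raise (ρ := ρ) hready.size
      (by rw [← hρ]; exact State.mat_congr ((hτ 3 rfl).trans (den_nat _ rfl _))) hvis h15 h16 rfl
    refine ⟨fun a b hab => ?_, fun a b hab => ?_⟩
    · rw [Finset.mem_insert, Prod.mk.injEq, not_or] at hab
      rw [g3 a b hab.1, h1 a b hab.2]
    · by_cases h : a = x ∧ b = y
      · obtain ⟨rfl, rfl⟩ := h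
        rw [h1 a b hS] at g2
        exact ⟨g1, g2⟩
      · rw [Finset.mem_insert, Prod.mk.injEq] at hab
        rw [g3 a b h]
        exact h2 a b (hab.resolve_left h)

/-- Exchange the edges on the path from `29` to `61` in the edge set `46`. -/
def flip : Stmt :=
  forEdges (ite (.eq (.add (.vec 42 29) (.vec 42 61)) (.lit 1))
    (nat 46 (.var 15) (.var 16) (.sub (.lit 1) (.mat 46 15 16))) skip)

theorem sep_test {S : Finset (Fin n)} (a b : Fin n) :
    ((if a ∈ S then 1 else 0) + (if b ∈ S then 1 else 0) = 1) ↔ ¬ (a ∈ S ↔ b ∈ S) := by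
  by_cases h1 : a ∈ S <;> by_cases h2 : b ∈ S <;> simp [h1, h2]

/-- The two arcs of an edge own separate matrix entries, so visiting both directions flips each
entry once and keeps the matrix symmetric. -/
theorem den_flip (hσ : Ready T V v σ) {F : Finset (Sym2 (Fin n))}
    (hF : σ.mat n 46 = treeCap T (ind F)) {a b : Fin n} (ha : σ.nat 29 0 0 = a)
    (hb : σ.nat 61 0 0 = b) :
    (flip.den σ).mat n 46 = treeCap T (ind (F ∆ pathOf T v a b)) := by
  have hmain := den_forEdges (σ := σ) (T := T) (V := V) (v := v)
    (P := ite (.eq (.add (.vec 42 29) (.vec 42 61)) (.lit 1))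
      (nat 46 (.var 15) (.var 16) (.sub (.lit 1) (.mat 46 15 16))) skip) hσ
    ⟨rfl, rfl, rfl, rfl, rfl⟩
    (fun S τ => ∀ x y, τ.mat n 46 x y = if (x, y) ∈ S then
      treeCap T (ind (F ∆ pathOf T v a b)) x y else treeCap T (ind F) x y) ?_ ?_ ?_
  · funext x y
    rw [flip, hmain]
    by_cases hxy : T.Adj x y
    · rw [if_pos (mem_arcs.2 hxy)]
    · rw [if_neg (mt mem_arcs.1 hxy), treeCap, treeCap, if_neg hxy, if_neg hxy]
  · intro x y
    rw [hF]
    simp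
  · intro S τ τ' h1 _ h
    rw [State.mat_congr (h1 46 rfl)]
    exact h
  · intro x y hxy S hS τ hready hτ _ h15 h16 hvis hI p q
    have e29 : τ.nat 29 0 0 = a := by rw [hτ 29 rfl, ha]
    have e61 : τ.nat 61 0 0 = b := by rw [hτ 61 rfl, hb]
    have htest : (Test.eq (.add (.vec 42 29) (.vec 42 61)) (.lit 1)).Holds τ
        ↔ ¬ (a ∈ side T v s(x, y) ↔ b ∈ side T v s(x, y)) := by
      rw [Test.holds_eq]
      simp only [NExpr.eval, NExpr.eval_vec, e29, e61, hvis]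
      exact sep_test a b
    have hcur : τ.nat 46 x y = if s(x, y) ∈ F then 1 else 0 := by
      have := hI x y
      rw [if_neg hS, treeCap, if_pos hxy] at this
      exact this
    have hpath : s(x, y) ∈ pathOf T v a b ↔ ¬ (a ∈ side T v s(x, y) ↔ b ∈ side T v s(x, y)) := by
      rw [mem_pathOf]
      exact and_iff_right hxy
    have hnew : treeCap T (ind (F ∆ pathOf T v a b)) x y
        = if ¬ (s(x, y) ∈ F ↔ ¬ (a ∈ side T v s(x, y) ↔ b ∈ side T v s(x, y))) then 1 else 0 := by
      rw [treeCap, if_pos hxy, ind]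
      refine if_congr ?_ rfl rfl
      rw [Finset.mem_symmDiff, hpath]
      tauto
    have hthis : ∀ τ' : State, τ'.nat 46 x y = treeCap T (ind (F ∆ pathOf T v a b)) x y →
        (¬ (p = x ∧ q = y) → τ'.nat 46 p q = τ.nat 46 p q) → τ'.mat n 46 p q =
          if (p, q) ∈ insert (x, y) S then treeCap T (ind (F ∆ pathOf T v a b)) p q
            else treeCap T (ind F) p q := by
      intro τ' g1 g2
      have hmem : (p, q) ∈ insert (x, y) S ↔ (p = x ∧ q = y) ∨ (p, q) ∈ S := by
        rw [Finset.mem_insert, Prod.mk.injEq]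
      by_cases h : p = x ∧ q = y
      · rw [if_pos (hmem.2 (Or.inl h)), h.1, h.2]
        exact g1
      · refine ((g2 h).trans (hI p q)).trans (if_congr ?_ rfl rfl)
        rw [hmem, or_iff_right h]
    by_cases hc : ¬ (a ∈ side T v s(x, y) ↔ b ∈ side T v s(x, y))
    · rw [den_ite_pos (htest.2 hc)]
      refine hthis _ ?_ fun h => ?_
      · rw [hnew]
        simp only [den_natStmt, NExpr.eval, NExpr.eval_var, NExpr.eval_mat, h15, h16, hcur,
          State.setN_nat_self, hc, not_false_eq_true, iff_true]
        split_ifs <;> rfl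
      · simp only [den_natStmt, NExpr.eval_var, h15, h16, State.setN_nat_apply, true_and,
          Fin.val_inj, if_neg h]
    · rw [den_ite_neg (mt htest.1 hc), den_skip]
      refine hthis _ ?_ fun h => rfl
      rw [hnew, hcur]
      simp only [hc, iff_false, not_not]

/-- Update the length `1[30]` by the contribution of the edge `{15, 16}`. -/
def distStep : Stmt :=
  ite (.eq (.add (.vec 42 30) (.vec 42 29)) (.lit 1))
    (ite (.natLe (.lit 1) (.mat 46 15 16))
      (real 1 (.var 30) (.lit 0) (.sub (.get 1 (.var 30) (.lit 0)) (.get 0 (.var 15) (.var 16))))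
      (real 1 (.var 30) (.lit 0) (.add (.get 1 (.var 30) (.lit 0)) (.get 0 (.var 15) (.var 16)))))
    skip

/-- Compute in the real array `1` twice the change of the length of the edge set `46` if a path
from `29` is exchanged. -/
def dist : Stmt :=
  .forLt 30 (real 1 (.var 30) (.lit 0) .zero) ;; forEdges (.forLt 30 distStep)

theorem den_distStep (hn : σ.nat 0 0 0 = n) {S : Finset (Fin n)}
    (hS : ∀ i : Fin n, σ.nat 42 i 0 = if i ∈ S then 1 else 0) {x y a : Fin n}
    (hx : σ.nat 15 0 0 = x) (hy : σ.nat 16 0 0 = y) (ha : σ.nat 29 0 0 = a) {w : ℝ}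
    (hw : w = if 1 ≤ σ.nat 46 x y then - σ.real 0 x y else σ.real 0 x y) (t : Fin n) :
    ((Stmt.forLt 30 distStep).den σ).real 1 t 0
      = σ.real 1 t 0 + if ¬ (t ∈ S ↔ a ∈ S) then w else 0 := by
  refine Exists.elim (den_for (c := 30) (P := distStep) hn (fun k τ => ∀ t : Fin n,
    τ.real 1 t 0 = if (t : ℕ) < k then σ.real 1 t 0 + (if ¬ (t ∈ S ↔ a ∈ S) then w else 0)
      else σ.real 1 t 0) (by simp) ?_) ?_
  · intro k hk τ hτ hτr hI t
    let s : Fin n := ⟨k, hk⟩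
    have e15 : τ.nat 15 0 0 = x := by rw [hτ 15 rfl, hx]
    have e16 : τ.nat 16 0 0 = y := by rw [hτ 16 rfl, hy]
    have e29 : τ.nat 29 0 0 = a := by rw [hτ 29 rfl, ha]
    have es : τ.nat 42 k 0 = if s ∈ S then 1 else 0 := by rw [hτ 42 rfl, ← hS s]
    have ea : τ.nat 42 a 0 = if a ∈ S then 1 else 0 := by rw [hτ 42 rfl, ← hS a]
    have htest : (Test.eq (.add (.vec 42 30) (.vec 42 29)) (.lit 1)).Holds (τ.setN 30 0 0 k)
        ↔ ¬ (s ∈ S ↔ a ∈ S) := by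
      rw [Test.holds_eq]
      simp only [NExpr.eval, NExpr.eval_vec, ne_eq, Nat.reduceEqDiff, not_false_eq_true,
        State.setN_nat_of_ne, State.setN_nat_self, e29, es, ea]
      exact sep_test s a
    have hcur : τ.real 1 k 0 = σ.real 1 k 0 := by
      have := hI s
      simpa [s] using this
    have hthis : ∀ τ' : State, τ'.real 1 k 0 = σ.real 1 k 0
        + (if ¬ (s ∈ S ↔ a ∈ S) then w else 0) →
        ((t : ℕ) ≠ k → τ'.real 1 t 0 = τ.real 1 t 0) → τ'.real 1 t 0 =
          if (t : ℕ) < k + 1 then σ.real 1 t 0 + (if ¬ (t ∈ S ↔ a ∈ S) then w else 0)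
            else σ.real 1 t 0 := by
      intro τ' g1 g2
      by_cases h : (t : ℕ) = k
      · have ht : t = s := Fin.ext h
        rw [if_pos (by omega), ht]
        exact g1
      · rw [g2 h, hI]
        refine if_congr ?_ rfl rfl
        omega
    by_cases hc : ¬ (s ∈ S ↔ a ∈ S)
    · rw [distStep, den_ite_pos (htest.2 hc)]
      by_cases hc' : 1 ≤ σ.nat 46 x y
      · rw [den_ite_pos]
        · refine hthis _ ?_ fun h => ?_
          · rw [if_pos hc, hw, if_pos hc']
            simp [e15, e16, hcur, hτr 0 rfl]
            ring
          · simp [State.setR_real_apply, h]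
        · simp [e15, e16, hτ 46 rfl]
          omega
      · rw [den_ite_neg]
        · refine hthis _ ?_ fun h => ?_
          · rw [if_pos hc, hw, if_neg hc']
            simp [e15, e16, hcur, hτr 0 rfl]
          · simp [State.setR_real_apply, h]
        · simp [e15, e16, hτ 46 rfl]
          omega
    · rw [distStep, den_ite_neg (mt htest.1 hc), den_skip]
      exact hthis _ (by rw [if_neg hc, add_zero]; exact hcur) fun _ => rfl
  · rintro τ ⟨h, -, -, he⟩
    rw [he, State.setN_real, h t, if_pos t.2]

/-- The factor 2 comes from meeting every edge in both directions. It is harmless, as the values are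
only compared. -/
theorem den_dist (hσ : Ready T V v σ) {F : Finset (Sym2 (Fin n))} {l : Sym2 (Fin n) → ℝ}
    (hF : σ.mat n 46 = treeCap T (ind F)) (hl : ∀ x y, T.Adj x y → σ.real 0 x y = l s(x, y))
    {a : Fin n} (ha : σ.nat 29 0 0 = a) (t : Fin n) :
    (dist.den σ).real 1 t 0 = 2 * ∑ e ∈ pathOf T v a t, if e ∈ F then - l e else l e := by
  classical
  rw [dist, den_seq]
  set P : Stmt := .forLt 30 (real 1 (.var 30) (.lit 0) .zero) with hP
  have hzero : ∀ t : Fin n, (P.den σ).real 1 t 0 = 0 := by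
    intro t
    refine Exists.elim (den_for (c := 30) (P := real 1 (.var 30) (.lit 0) .zero) hσ.size
      (fun k τ => ∀ t : Fin n, (t : ℕ) < k → τ.real 1 t 0 = 0) (by simp) ?_) ?_
    · intro k hk τ _ _ hI t ht
      simp only [den_realStmt, NExpr.eval_var, NExpr.eval, RExpr.eval, State.setN_nat_self,
        State.setR_real_apply, State.setN_real]
      split_ifs with h
      · rfl
      · exact hI t (by simp only [true_and, and_true] at h; omega)
    · rintro τ ⟨h, -, -, he⟩
      rw [hP, he]
      exact h t t.2
  have hmain := den_forEdges (σ := P.den σ) (T := T) (V := V) (v := v)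
    (P := .forLt 30 distStep) (hσ.den P rfl rfl rfl rfl) ⟨rfl, rfl, rfl, rfl, rfl⟩
    (fun S τ => ∀ t : Fin n, τ.real 1 t 0 = ∑ p ∈ S,
      if ¬ (t ∈ side T v s(p.1, p.2) ↔ a ∈ side T v s(p.1, p.2)) then
        (if s(p.1, p.2) ∈ F then - l s(p.1, p.2) else l s(p.1, p.2)) else 0) ?_ ?_ ?_
  · rw [hmain t, sum_arcs (T := T) fun e => if ¬ (t ∈ side T v e ↔ a ∈ side T v e) then
      (if e ∈ F then - l e else l e) else 0, ← Finset.sum_filter]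
    congr 1
    refine Finset.sum_congr ?_ fun _ _ => rfl
    rw [pathOf]
    refine Finset.filter_congr fun e _ => ?_
    tauto
  · intro t
    rw [hzero, Finset.sum_empty]
  · intro S τ τ' _ h2 h t
    rw [h2]
    exact h t
  · intro x y hxy S hS τ hready hτ hτr h15 h16 hvis hI t
    have e29 : τ.nat 29 0 0 = a := by rw [hτ 29 rfl, den_nat _ rfl, ha]
    have e46 : τ.nat 46 x y = if s(x, y) ∈ F then 1 else 0 := by
      have h1 : τ.nat 46 x y = treeCap T (ind F) x y := by
        rw [← hF, hτ 46 rfl, den_nat _ rfl]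
        rfl
      rw [h1, treeCap, if_pos hxy, ind]
    have el : τ.real 0 x y = l s(x, y) := by rw [hτr 0 rfl, den_real _ rfl, hl x y hxy]
    rw [den_distStep hready.size hvis h15 h16 e29 rfl t, hI, Finset.sum_insert hS, add_comm, e46,
      el]
    congr 1
    dsimp only
    split_ifs <;> first | rfl | (exfalso; omega)

/-- Store in `61` the best end of a path from `29`. -/
def best : Stmt :=
  set 61 (.var 29) ;; .forLt 30 (ite (.conj (.natLe (.add (.var 30) (.lit 1)) (.var 29))
    (.conj (.natLe (.lit 1) (.vec 2 30))
      (.realLe (.get 1 (.var 30) (.lit 0)) (.get 1 (.var 61) (.lit 0))))) (set 61 (.var 30)) skip)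

theorem den_best (hσ : Ready T V v σ) {a : Fin n} (ha : σ.nat 29 0 0 = a) {D : Fin n → ℝ}
    (hD : ∀ t : Fin n, σ.real 1 t 0 = D t) :
    ∃ b : Fin n, (best.den σ).nat 61 0 0 = b ∧ (b = a ∨ b ∈ V ∧ b < a) ∧ D b ≤ D a ∧
      ∀ t ∈ V, t < a → D b ≤ D t := by
  rw [best, den_seq]
  have hfr : ∀ B, B ≠ 61 → ((set 61 (.var 29)).den σ).nat B = σ.nat B := fun B hB =>
    State.setN_nat_of_ne _ _ _ _ hB
  refine Exists.elim (den_for (c := 30) (n := n) (P := ite (.conj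
    (.natLe (.add (.var 30) (.lit 1)) (.var 29)) (.conj (.natLe (.lit 1) (.vec 2 30))
      (.realLe (.get 1 (.var 30) (.lit 0)) (.get 1 (.var 61) (.lit 0))))) (set 61 (.var 30)) skip)
    (by rw [hfr 0 (by simp), hσ.size])
    (fun k τ => ∃ b : Fin n, τ.nat 61 0 0 = b ∧ (b = a ∨ b ∈ V ∧ b < a) ∧ D b ≤ D a ∧
      ∀ t ∈ V, t < a → (t : ℕ) < k → D b ≤ D t) ?_ ?_) ?_
  · exact ⟨a, by simp [ha], Or.inl rfl, le_rfl, by simp⟩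
  · rintro k hk τ hτ hτr ⟨b, h1, h2, h3, h4⟩
    let s : Fin n := ⟨k, hk⟩
    have e29 : τ.nat 29 0 0 = a := by rw [hτ 29 rfl, hfr 29 (by simp), ha]
    have e2 : τ.nat 2 k 0 = if s ∈ V then 1 else 0 := by
      rw [hτ 2 rfl, hfr 2 (by simp), ← hσ.term s]
    have eD : ∀ t : Fin n, τ.real 1 t 0 = D t := fun t => by rw [hτr 1 rfl, ← hD t]; rfl
    have htest : (Test.conj (.natLe (.add (.var 30) (.lit 1)) (.var 29))
        (.conj (.natLe (.lit 1) (.vec 2 30))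
        (.realLe (.get 1 (.var 30) (.lit 0)) (.get 1 (.var 61) (.lit 0))))).Holds
        (τ.setN 30 0 0 k) ↔ s < a ∧ s ∈ V ∧ D s ≤ D b := by
      have g1 : τ.real 1 k 0 = D s := eD s
      simp only [Test.Holds, NExpr.eval, RExpr.eval, NExpr.eval_vec, NExpr.eval_var, ne_eq,
        Nat.reduceEqDiff, not_false_eq_true, State.setN_nat_of_ne, State.setN_nat_self,
        State.setN_real, e29, e2, h1, g1, eD, Fin.lt_def, s]
      refine and_congr Iff.rfl (and_congr ?_ Iff.rfl)
      split_ifs with h <;> simp [h]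
    have hall : ∀ t : Fin n, (t : ℕ) < k + 1 → t = s ∨ (t : ℕ) < k := by
      intro t ht
      rw [Fin.ext_iff]
      simp only [s]
      omega
    by_cases hc : s < a ∧ s ∈ V ∧ D s ≤ D b
    · rw [den_ite_pos (htest.2 hc)]
      refine ⟨s, by simp [s], Or.inr ⟨hc.2.1, hc.1⟩, hc.2.2.trans h3, fun t ht hta htk => ?_⟩
      rcases hall t htk with rfl | htk
      · exact le_rfl
      · exact hc.2.2.trans (h4 t ht hta htk)
    · rw [den_ite_neg (mt htest.1 hc)]
      refine ⟨b, by simpa using h1, h2, h3, fun t ht hta htk => ?_⟩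
      rcases hall t htk with rfl | htk
      · exact le_of_lt (not_le.1 fun h => hc ⟨hta, ht, h⟩)
      · exact h4 t ht hta htk
  · rintro τ ⟨⟨b, h1, h2, h3, h4⟩, -, -, he⟩
    refine ⟨b, ?_, h2, h3, fun t ht hta => h4 t ht hta t.2⟩
    rw [he, State.setN_nat_of_ne _ _ _ _ (by simp), h1]

/-- Improve the edge set `46` by a path from `29`. -/
def joinStep : Stmt := ite (.natLe (.lit 1) (.vec 2 29)) ((dist ;; best) ;; flip) skip

/-- Compute a shortest join in `46`. -/
def join : Stmt := .forLt 29 joinStep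

theorem den_join (hT : T.IsTree) (hσ : Ready T V v σ) {O : Finset (Sym2 (Fin n))}
    {l : Sym2 (Fin n) → ℝ} (hO : σ.mat n 46 = treeCap T (ind O))
    (hl : ∀ x y, T.Adj x y → σ.real 0 x y = l s(x, y)) :
    ∃ F, (join.den σ).mat n 46 = treeCap T (ind F) ∧ IsOptimalJoin T v l O V F := by
  -- The terminals are admitted in increasing order; `best` accordingly looks only at terminals
  -- below the current one.
  let U : ℕ → Finset (Fin n) := fun k => V.filter fun i => (i : ℕ) < k
  refine Exists.elim (den_for (c := 29) (P := joinStep) hσ.size (fun k τ => ∃ F,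
    τ.mat n 46 = treeCap T (ind F) ∧ IsOptimalJoin T v l O (U k) F) ?_ ?_) ?_
  · have hU : U 0 = ∅ := by simp [U]
    rw [hU]
    exact ⟨O, hO, isOptimalJoin_empty v l O⟩
  · rintro k hk τ hτ hτr ⟨F, h46, hF⟩
    let a : Fin n := ⟨k, hk⟩
    set τ₁ := τ.setN 29 0 0 k with hτ₁
    have f : ∀ B, B ≠ 29 → τ₁.nat B = τ.nat B := fun B hB => State.setN_nat_of_ne _ _ _ _ hB
    have hready : Ready T V v τ₁ := Ready.setN (hσ.congr (hτ 0 rfl) (hτ 1 rfl) (hτ 2 rfl)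
      (hτ 44 rfl)) _ _ _ (by simp) (by simp) (by simp) (by simp)
    have e29 : τ₁.nat 29 0 0 = a := by simp [hτ₁, a]
    have e46 : τ₁.mat n 46 = treeCap T (ind F) := by
      rw [← h46]
      exact State.mat_congr (f 46 (by simp))
    have htest : (Test.natLe (.lit 1) (.vec 2 29)).Holds τ₁ ↔ a ∈ V := by
      simp only [Test.Holds, NExpr.eval, NExpr.eval_vec, e29, hready.term]
      split_ifs with h <;> simp [h]
    by_cases haV : a ∈ V
    · have hU : U (k + 1) = insert a (U k) := by
        ext i
        simp only [U, Finset.mem_filter, Finset.mem_insert, Fin.ext_iff, a]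
        constructor
        · rintro ⟨h1, h2⟩
          by_cases h : (i : ℕ) = k
          · exact Or.inl h
          · exact Or.inr ⟨h1, by omega⟩
        · rintro (h | ⟨h1, h2⟩)
          · have : i = a := Fin.ext h
            exact ⟨this ▸ haV, by omega⟩
          · exact ⟨h1, by omega⟩
      rw [hU, joinStep, den_ite_pos (htest.2 haV), den_seq, den_seq]
      have hdist := den_dist hready e46 (l := l)
        (fun x y hxy => by rw [hτ₁, State.setN_real, hτr 0 rfl, hl x y hxy]) e29
      obtain ⟨b, g1, g2, g3, g4⟩ := den_best (hready.den dist rfl rfl rfl rfl)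
        (by rw [den_nat _ rfl, e29]) hdist
      refine ⟨_, den_flip ((hready.den dist rfl rfl rfl rfl).den best rfl rfl rfl rfl)
        (by rw [← e46]; exact State.mat_congr ((den_nat _ rfl _).trans (den_nat _ rfl _)))
        (by rw [den_nat _ rfl, den_nat _ rfl, e29]) g1, ?_⟩
      have haU : a ∉ U k := by simp [U, a]
      refine hF.insert hT haU ?_ fun t ht => ?_
      · rcases g2 with rfl | ⟨h1, h2⟩
        · exact Finset.mem_insert_self _ _
        · exact Finset.mem_insert_of_mem (Finset.mem_filter.2 ⟨h1, h2⟩)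
      · rw [sum_symmDiff_eq, sum_symmDiff_eq]
        have h5 : 2 * (∑ e ∈ pathOf T v a b, if e ∈ F then - l e else l e)
            ≤ 2 * ∑ e ∈ pathOf T v a t, if e ∈ F then - l e else l e := by
          rcases Finset.mem_insert.1 ht with rfl | ht
          · exact g3
          · exact g4 t (Finset.mem_filter.1 ht).1 (Finset.mem_filter.1 ht).2
        linarith
    · have hU : U (k + 1) = U k := by
        refine Finset.filter_congr fun i hi => ?_
        have : (i : ℕ) ≠ k := fun h => haV ((Fin.ext h : i = a) ▸ hi)
        omega
      rw [hU, joinStep, den_ite_neg (mt htest.1 haV), den_skip]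
      exact ⟨F, e46, hF⟩
  · rintro τ ⟨⟨F, h1, h2⟩, -, -, he⟩
    have hU : U n = V := Finset.filter_true_of_mem fun i _ => i.2
    rw [hU] at h2
    refine ⟨F, ?_, h2⟩
    rw [join, he, ← h1]
    exact State.mat_congr (State.setN_nat_of_ne _ _ _ _ (by simp))

end Stmt

end RAM

/-! ### The complete algorithm and the theorem. -/

namespace RAM

open Stmt SplittingOff TreeCut
open scoped symmDiff

namespace Stmt

/-- Store in `46` the parities of `45`. -/
def parities : Stmt :=
  fill 46 (.natLe (.lit 0) (.lit 0)) (.sub (.mat 45 10 11)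
    (.add (.half (.mat 45 10 11)) (.half (.mat 45 10 11)))) (.lit 0)

/-- Store in `47` the sum of `45` and `46`. -/
def sumMat : Stmt :=
  fill 47 (.natLe (.lit 0) (.lit 0)) (.add (.mat 45 10 11) (.mat 46 10 11)) (.lit 0)

/-- Compute a minimum-cost integer realization in `4`. -/
def synthesis : Stmt :=
  findRoot ;; (reqMat ;; (parities ;; (join ;; (sumMat ;; levels))))

end Stmt

variable {n : ℕ} {σ : State}

theorem den_parities (hn : σ.nat 0 0 0 = n) :
    (parities.den σ).mat n 46 = fun i j => σ.mat n 45 i j % 2 := by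
  refine den_fill hn (by simp) _ fun i j τ hτ _ h10 h11 => ?_
  rw [if_pos (by simp [Test.Holds, NExpr.eval])]
  simp only [NExpr.eval, NExpr.eval_mat, h10, h11, State.mat, hτ 45 (by simp) (by simp) (by simp)]
  omega

theorem den_sumMat (hn : σ.nat 0 0 0 = n) :
    (sumMat.den σ).mat n 47 = fun i j => σ.mat n 45 i j + σ.mat n 46 i j := by
  refine den_fill hn (by simp) _ fun i j τ hτ _ h10 h11 => ?_
  rw [if_pos (by simp [Test.Holds, NExpr.eval])]
  simp only [NExpr.eval, NExpr.eval_mat, h10, h11, State.mat, hτ 45 (by simp) (by simp) (by simp),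
    hτ 46 (by simp) (by simp) (by simp)]

end RAM

namespace TreeMetricInstance

open RAM RAM.Stmt SplittingOff TreeCut
open scoped symmDiff

variable {n : ℕ} (I : TreeMetricInstance (Fin n))

theorem input_term (i : Fin n) : I.input.nat 2 i 0 = if i ∈ I.V then 1 else 0 := by
  simp [input]

theorem input_req (i j : Fin n) : I.input.nat 3 i j
    = if h : i ∈ I.V ∧ j ∈ I.V then I.r ⟨i, h.1⟩ ⟨j, h.2⟩ else 0 := by
  simp [input]

theorem input_length {x y : Fin n} (h : I.T.Adj x y) : I.input.real 0 x y = I.l s(x, y) := by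
  simp [input, h]

theorem ready_findRoot {v : Fin n} (hv : (findRoot.den I.input).nat 44 0 0 = v) :
    Ready I.T I.V v (findRoot.den I.input) where
  size := by
    rw [den_nat _ rfl]
    simp [input]
  adj i j := by
    rw [den_nat _ rfl]
    by_cases h : I.T.Adj i j <;> simp [input, h]
  term i := by rw [den_nat _ rfl, input_term]
  root := hv

theorem den_reqMat_eq {σ : State} (v : I.V) (hσ : Ready I.T I.V v σ)
    (hρ : σ.nat 3 = I.input.nat 3) : (reqMat.den σ).mat n 45 = treeCap I.T (I.cR v) := by
  obtain ⟨h1, h2⟩ := den_reqMat hσ rfl (g := (reqMat.den σ).mat n 45) rfl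
  have hmat : ∀ i j, σ.mat n 3 i j = if h : i ∈ I.V ∧ j ∈ I.V then I.r ⟨i, h.1⟩ ⟨j, h.2⟩ else 0 :=
    fun i j => by rw [State.mat, hρ, input_req]
  funext x y
  rw [treeCap]
  split_ifs with hxy
  · obtain ⟨h3, h4⟩ := h2 x y hxy
    apply le_antisymm
    · rcases h4 with h4 | ⟨i, hi, j, hj, h4⟩
      · rw [h4]
        exact Nat.zero_le _
      · rw [h4, hmat]
        split_ifs with h
        · exact I.r_le_cR v fun h' => hj (h'.1 hi)
        · exact Nat.zero_le _
    · rw [cR_eq]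
      refine maxReq_le _ fun i hi j hj => ?_
      have := h3 i hi j hj
      rwa [hmat, dif_pos ⟨i.2, j.2⟩] at this
  · exact h1 x y hxy

/-- The output uses no tree edge beyond `cR + 1_F` for the computed join `F`. The parity set of any
realization is among the sets over which `F` is shortest, so the lower bound on its cost is at least
the cost of the output. -/
theorem den_synthesis (v₀ : I.V) (hR : ∀ e ∈ I.T.edgeSet, 1 < I.cR v₀ e) :
    ∃ y : Sym2 I.V → ℕ, I.Outputs (synthesis.den I.input) y ∧
      IsMinCostIntegerRealization I.a I.r y := by
  obtain ⟨v', hv', hroot⟩ := den_findRoot (σ := I.input) (n := n) (by simp [input]) I.nonempty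
    I.input_term
  let v : I.V := ⟨v', hv'⟩
  have hσ₁ : Ready I.T I.V v (findRoot.den I.input) := I.ready_findRoot hroot
  rw [synthesis, den_seq, den_seq, den_seq, den_seq, den_seq]
  set σ₁ := findRoot.den I.input with hσ₁'
  have e3 : σ₁.nat 3 = I.input.nat 3 := den_nat _ rfl _
  have r1 : σ₁.real 0 = I.input.real 0 := den_real _ rfl _
  have h45 := I.den_reqMat_eq v hσ₁ e3
  have hσ₂ := hσ₁.den reqMat rfl rfl rfl rfl
  have r2 : (reqMat.den σ₁).real 0 = I.input.real 0 := (den_real _ rfl _).trans r1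
  set σ₂ := reqMat.den σ₁
  have h46 := den_parities hσ₂.size
  have hσ₃ := hσ₂.den parities rfl rfl rfl rfl
  have h45' : (parities.den σ₂).mat n 45 = treeCap I.T (I.cR v) :=
    (State.mat_congr (den_nat _ rfl _)).trans h45
  have r3 : (parities.den σ₂).real 0 = I.input.real 0 := (den_real _ rfl _).trans r2
  set σ₃ := parities.den σ₂
  have hO : σ₃.mat n 46 = treeCap I.T (ind (I.oddReq v)) := by
    rw [h46, h45]
    funext x y
    rw [treeCap, treeCap]
    split_ifs with hxy
    · rw [ind]
      have : s(x, y) ∈ I.oddReq v ↔ Odd (I.cR v s(x, y)) := by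
        rw [mem_oddReq]
        exact and_iff_right hxy
      rw [Nat.odd_iff] at this
      split_ifs with h
      · exact this.1 h
      · have := mt this.2 h
        omega
    · rfl
  obtain ⟨F, hF, hopt⟩ := den_join I.isTree hσ₃ (l := I.l) hO fun x y hxy => by
    rw [r3, I.input_length hxy]
  have hσ₄ := hσ₃.den join rfl rfl rfl rfl
  have h45'' : (join.den σ₃).mat n 45 = treeCap I.T (I.cR v) :=
    (State.mat_congr (den_nat _ rfl _)).trans h45'
  set σ₄ := join.den σ₃
  let c : Sym2 (Fin n) → ℕ := fun e => I.cR v e + if e ∈ F then 1 else 0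
  have h47 : (sumMat.den σ₄).mat n 47 = treeCap I.T c := by
    rw [den_sumMat hσ₄.size, h45'', hF]
    funext x y
    simp only [treeCap]
    split_ifs with hxy <;> rfl
  have hσ₅ := hσ₄.den sumMat rfl rfl rfl rfl
  set σ₅ := sumMat.den σ₄
  obtain ⟨⟨Y, hYV, hY, hFY⟩, hmin⟩ := hopt
  obtain ⟨hsymm, hzero, hload, hcut⟩ := den_levels I.isTree hσ₅ h47
    -- The program chooses its own root, but the requirement of an edge does not depend on the root.
    (fun e he => (Nat.succ_le_of_lt (I.cR_root v₀ v e ▸ hR e he)).trans (Nat.le_add_right _ _))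
    (fun w hw => I.even_sum_cR_add v hY hYV hFY hw) (out := (levels.den σ₅).mat n 4) rfl
  set out := (levels.den σ₅).mat n 4 with hout
  let y : Sym2 I.V → ℕ := Sym2.lift ⟨fun i j => if i = j then 0 else out i j, fun i j => by
    by_cases h : i = j
    · rw [h]
    · dsimp only
      rw [if_neg h, if_neg (Ne.symm h), hsymm _ _ fun h' => h (Subtype.ext h')]⟩
  have hy : ∀ i j : I.V, i ≠ j → out i j = y s(i, j) := fun i j hij => by
    simp only [y, Sym2.lift_mk, if_neg hij]
  have hz : ∀ x y, x ≠ y → x ∉ I.V ∨ y ∉ I.V → out x y = 0 := by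
    rintro x y hxy (h | h)
    · exact hzero x h y hxy.symm
    · rw [hsymm x y hxy]
      exact hzero y h x hxy
  refine ⟨y, hy, I.isIntegerRealization_of_cut hy hz fun s t hst X hs ht => ?_, fun z hzr => ?_⟩
  · exact hcut s s.2 t t.2 X hs ht _ fun e _ he => (I.r_le_cR v he).trans (Nat.le_add_right _ _)
  · have hcost := I.capacityCost_le v (y := y) (c := c) fun e he => by
      rw [load, sum_cutEdges_eq_cut hy hz]
      exact hload e he
    have hFE : F ⊆ edgesOf I.T := by
      intro e he
      rw [hFY, Finset.mem_symmDiff, mem_oddReq, mem_joinOf, ← mem_edgesOf] at he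
      tauto
    have hsum : ∑ e ∈ edgesOf I.T, I.l e * (c e : ℝ)
        = ∑ e ∈ edgesOf I.T, I.l e * (I.cR v e : ℝ) + ∑ e ∈ F, I.l e := by
      have h1 : ∑ e ∈ F, I.l e = ∑ e ∈ edgesOf I.T, if e ∈ F then I.l e else 0 := by
        rw [← Finset.sum_filter, Finset.filter_mem_eq_inter, Finset.inter_eq_right.2 hFE]
      rw [h1, ← Finset.sum_add_distrib]
      refine Finset.sum_congr rfl fun e _ => ?_
      simp only [c]
      split_ifs <;> push_cast <;> ring
    obtain ⟨Z, hZV, hZ, hodd⟩ := I.exists_oddEdges_eq v z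
    have h1 := hmin Z hZV hZ
    rw [← hodd] at h1
    have h2 := I.le_capacityCost v hzr
    linarith

end TreeMetricInstance

theorem theorem2p4 :
    (∃ (P : RAM.Prog) (q : Polynomial ℕ), ∀ (n : ℕ) (I : TreeMetricInstance (Fin n)) (v : I.V),
      (∀ e ∈ I.T.edgeSet, 1 < maxReq I.r (sideOf I.T I.V v e)) →
        ∃ (t : ℕ) (τ : RAM.State) (y : Sym2 I.V → ℕ),
          RAM.Exec P I.input t τ ∧ t ≤ q.eval n ∧ I.Outputs τ y ∧
            IsMinCostIntegerRealization I.a I.r y) ∧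
    (∀ (N : Type u) [Finite N] (I : TreeMetricInstance N) (v : I.V),
      (∀ e ∈ I.T.edgeSet, 1 < maxReq I.r (sideOf I.T I.V v e)) →
        ∃ m : ℝ,
          IsLeast {x : ℝ | ∃ F : Finset (Sym2 N), I.IsInnerOddJoin v F ∧ x = ∑ e ∈ F, I.l e} m ∧
          IsLeast {x : ℝ | ∃ y : Sym2 I.V → ℕ,
              IsIntegerRealization I.r y ∧ x = capacityCost I.a y}
            ((∑ e ∈ edgesOf I.T, I.l e * (maxReq I.r (sideOf I.T I.V v e) : ℝ)) + m)) := by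
  classical
  refine ⟨⟨RAM.Stmt.synthesis.compile, RAM.Stmt.synthesis.cost, fun n I v hR => ?_⟩,
    fun N _ I v hR => ?_⟩
  · obtain ⟨y, h1, h2⟩ := I.den_synthesis v hR
    obtain ⟨t, ht, hexec⟩ := RAM.Stmt.exec_compile (P := RAM.Stmt.synthesis) rfl I.input
    have hn : I.input.nat 0 0 0 = n := by simp [TreeMetricInstance.input]
    rw [hn] at ht
    exact ⟨t, _, y, hexec, ht, h1, h2⟩
  · have := Fintype.ofFinite N
    exact I.exists_isLeast v hR
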